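/- **Setting.** Let $a<b$, $c<d$, and write $L_2[x],L_2[y],L_2[x,y]$ for the real $L_2$ spaces on $[a,b]$, $[c,d]$, $[a,b]\times[c,d]$. For $k\in\mathbb N$ let $H_k[x,y]=\{u:\partial_x^i\partial_y^ju\in L_2[x,y],\ 0\le i,j\le k\}$ (weak derivatives). Let $n_0,n_1,n_2\in\mathbb N$, $n=n_0+n_1+n_2$; states are $u=(u_0,u_1,u_2)\in L_2^n[x,y]$ with $u_i$ having $n_i$ components. *PI operators.* Let $\mathcal N_{2D}^{n\times n}$ be the set of $N=(N_{ij})_{0\le i,j\le2}$ of square integrable $n\times n$-matrix functions $N_{00}(x,y)$, $N_{i0}(x,y,\theta)$, $N_{0j}(x,y,\nu)$, $N_{ij}(x,y,\theta,\nu)$ $(i,j\geq 1)$. With $I_1(x)=[a,x]$, $I_2(x)=[x,b]$, $J_1(y)=[c,y]$, $J_2(y)=[y,d]$, the 2D-PI operator $\mathcal P[N]$ on $L_2^n[x,y]$ is $$(\mathcal P[N]u)(x,y)=N_{00}u(x,y)+\sum_{i=1}^2\int_{I_i(x)}\!\!N_{i0}u(\theta,y)\,d\theta+\sum_{j=1}^2\int_{J_j(y)}\!\!N_{0j}u(x,\nu)\,d\nu+\sum_{i,j=1}^2\int_{I_i(x)}\int_{J_j(y)}\!\!N_{ij}u(\theta,\nu)\,d\nu\,d\theta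 .$$ A 011-PI operator $\mathcal P[B]:\mathbb R^{m_0}\times L_2^{m_1}[x]\times L_2^{m_1}[y]\to\mathbb R^{k_0}\times L_2^{k_1}[x]\times L_2^{k_1}[y]$ sends $(v,f,g)$ to $$\Bigl(B_{00}v+\int_a^b\!B_{01}f\,dx+\int_c^d\!B_{02}g\,dy,\;\; B_{10}(x)v+\mathcal P[B_{11}]f+\int_c^d\!B_{12}(x,y)g(y)\,dy,\;\; B_{20}(y)v+\int_a^b\!B_{21}(y,x)f(x)\,dx+\mathcal P[B_{22}]g\Bigr),$$ where $\mathcal P[\{M_0,M_1,M_2\}]f(x)=M_0(x)f(x)+\int_a^xM_1(x,\theta)f(\theta)\,d\theta+\int_x^bM_2(x,\theta)f(\theta)\,d\theta$ (similarly on $[c,d]$), $B_{00}$ is a matrix and all other parameters are square integrable; the set of such $B$ is $\mathcal N_{011}$. In both cases $\mathcal P[\cdot]$ is understood to be a bounded operator between the indicated spaces. *Boundary values.* For $u\in L_2^{n_0}\times H_1^{n_1}\times H_2^{n_2}$ let $\Lambda_{bf}u\in\mathbb R^{4n_1+16n_2}\times L_2^{2n_1+4n_2}[x]\times L_2^{2n_1+4n_2}[y]$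 consist of: the values of $u_1,u_2,\partial_xu_2,\partial_yu_2,\partial_x\partial_yu_2$ at the four corners; the restrictions of $\partial_xu_1,\partial_x^2u_2,\partial_x^2\partial_yu_2$ to $y=c$ and $y=d$; the restrictions of $\partial_yu_1,\partial_y^2u_2,\partial_x\partial_y^2u_2$ to $x=a$ and $x=b$. Let $\Lambda_{bc}u\in\mathbb R^{n_1+4n_2}\times L_2^{n_1+2n_2}[x]\times L_2^{n_1+2n_2}[y]$ be the part of it that belongs to the corner $(a,c)$ and to the edges $y=c$ and $x=a$. Let $\mathcal D u=(u_0,\partial_x\partial_yu_1,\partial_x^2\partial_y^2u_2)$. For $w=\bigl((w^1,w^2_{kl}),(f^1,f^2_l),(g^1,g^2_l)\bigr)_{k,l\in\{0,1\}}\in\mathbb R^{n_1+4n_2}\times L_2^{n_1+2n_2}[x]\times L_2^{n_1+2n_2}[y]$ and $\hat u\in L_2^n[x,y]$, let $\mathcal K_1w=(0,z_1,z_2)$ with $$z_1=w^1+\int_a^x\!f^1(\theta)d\theta+\int_c^y\!g^1(\nu)d\nu,$$ $$z_2=\sum_{k,l\in\{0,1\}}(x-a)^k(y-c)^lw^2_{kl}+\sum_{l\in\{0,1\}}\Bigl[(y-c)^l\!\int_a^x\!(x-\theta)f^2_l(\theta)d\theta+(x-a)^l\!\int_c^y\!(y-\nu)g^2_l(\nu)d\nu\Bigr],$$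 and $\mathcal K_2\hat u=\bigl(\hat u_0,\int_a^x\!\int_c^y\hat u_1\,d\nu\,d\theta,\int_a^x\!\int_c^y(x-\theta)(y-\nu)\hat u_2\,d\nu\,d\theta\bigr)$; here $w^1,w^2_{kl}$ stand for $u_1,\partial_x^k\partial_y^lu_2$ at $(a,c)$, $f^1,f^2_l$ for $\partial_xu_1,\partial_x^2\partial_y^lu_2$ on $y=c$, and $g^1,g^2_l$ for $\partial_yu_1,\partial_x^l\partial_y^2u_2$ on $x=a$. Let $\mathcal H_1,\mathcal H_2$ be the bounded PI operators obtained from these formulas by differentiating under them and taking boundary values, $\mathcal H_1w=\Lambda_{bf}\mathcal K_1w$ and $\mathcal H_2\hat u=\Lambda_{bf}\mathcal K_2\hat u$, so that $\Lambda_{bf}u=\mathcal H_1\Lambda_{bc}u+\mathcal H_2\mathcal Du$. *The PDE.* Let $N_m$ select the components of differentiability class at least $m$: $N_0u=u$, $N_1u=(u_1,u_2)$, $N_2u=u_2$. Given real matrices $A_{ij}$ ($0\le i,j\le2$) of matching size and $B\in\mathcal N_{011}$ with $\mathcal B=\mathcal P[B]:\mathbb R^{4n_1+16n_2}\times L_2^{2n_1+4n_2}[x]\times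 L_2^{2n_1+4n_2}[y]\to\mathbb R^{n_1+4n_2}\times L_2^{n_1+2n_2}[x]\times L_2^{n_1+2n_2}[y]$, let $X(\mathcal B)=\{u\in L_2^{n_0}\times H_1^{n_1}\times H_2^{n_2}:\mathcal B\Lambda_{bf}u=0\}$. A solution of the PDE defined by $\{A_{ij},\mathcal B\}$ is a differentiable $u:[0,\infty)\to L_2^n[x,y]$ with $u(t)\in X(\mathcal B)$ and $\dot u(t)=\sum_{i,j=0}^2A_{ij}\partial_x^i\partial_y^j(N_{\max\{i,j\}}u(t))$ for all $t\ge0$. The boundary conditions are *well-posed* if $\mathcal B\mathcal H_1$ is invertible with inverse $\mathcal P[\hat E]$ for some $\hat E\in\mathcal N_{011}$. In that case define on $L_2^n[x,y]$ the operators $$\mathcal T=\mathcal K_2-\mathcal K_1(\mathcal B\mathcal H_1)^{-1}\mathcal B\mathcal H_2,\qquad \mathcal A=\sum_{i,j=0}^2A_{ij}\,\partial_x^i\partial_y^j[N_{\max\{i,j\}}\mathcal T].$$ **Theorem.** Let the boundary conditions be well-posed, and suppose that there are $\epsilon,\delta>0$ and $P\in\mathcal N_{2D}^{n\times n}$ such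 that $\mathcal P=\mathcal P[P]$ satisfies $\mathcal P=\mathcal P^*$, $\mathcal P\ge\epsilon I$ and $$\mathcal A^*\mathcal P\mathcal T+\mathcal T^*\mathcal P\mathcal A\le-\delta\,\mathcal T^*\mathcal T .$$ Then every solution $u$ of the PDE defined by $\{A_{ij},\mathcal B\}$ satisfies, for all $t\ge0$, $$\|u(t)\|_{L_2}^2\le\frac{\zeta}{\epsilon}\,\|u(0)\|_{L_2}^2\,e^{-\frac{\delta}{\zeta}t},\qquad \zeta=\|\mathcal P\|_{\mathcal L(L_2)} .$$ (If $n=0$, all spaces are trivial and the claim reads $0\le0$, with any convention for $\delta/0$.) -/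

import Mathlib

open MeasureTheory Set
open scoped Matrix ContDiff

noncomputable section

namespace PIE

/-! ### The rectangle, its function spaces, and pointwise matrix operators -/

/-- A non-degenerate rectangle `[a,b] × [c,d]`. -/
structure Rectangle where
  a : ℝ
  b : ℝ
  c : ℝ
  d : ℝ
  hab : a < b
  hcd : c < d

/-- Lebesgue measure on `[a,b]`. -/
def Rectangle.μx (R : Rectangle) : Measure ℝ := volume.restrict (Icc R.a R.b)

/-- Lebesgue measure on `[c,d]`. -/
def Rectangle.μy (R : Rectangle) : Measure ℝ := volume.restrict (Icc R.c R.d)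

/-- Lebesgue measure on `[a,b] × [c,d]`. -/
def Rectangle.μxy (R : Rectangle) : Measure (ℝ × ℝ) := R.μx.prod R.μy

/-- The endpoints of `[a,b]`: `0 ↦ a`, `1 ↦ b`. -/
def Rectangle.xEnd (R : Rectangle) (p : Fin 2) : ℝ := if p = 0 then R.a else R.b

/-- The endpoints of `[c,d]`: `0 ↦ c`, `1 ↦ d`. -/
def Rectangle.yEnd (R : Rectangle) (q : Fin 2) : ℝ := if q = 0 then R.c else R.d

/-- `L₂[x]` with values in `ℝ^ι`. -/
abbrev L2x (R : Rectangle) (ι : Type) [Fintype ι] := Lp (EuclideanSpace ℝ ι) 2 R.μx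

/-- `L₂[y]` with values in `ℝ^ι`. -/
abbrev L2y (R : Rectangle) (ι : Type) [Fintype ι] := Lp (EuclideanSpace ℝ ι) 2 R.μy

/-- `L₂[x,y]` with values in `ℝ^ι`. -/
abbrev L2xy (R : Rectangle) (ι : Type) [Fintype ι] := Lp (EuclideanSpace ℝ ι) 2 R.μxy

/-- `RL = ℝ^ι₀ × L₂[x]^ι₁ × L₂[y]^ι₁`. -/
abbrev RL (R : Rectangle) (ι₀ ι₁ : Type) [Fintype ι₀] [Fintype ι₁] :=
  EuclideanSpace ℝ ι₀ × L2x R ι₁ × L2y R ι₁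

/-- A real matrix applied to a vector. -/
abbrev mv {κ ι : Type} [Fintype ι] (A : Matrix κ ι ℝ) (v : EuclideanSpace ℝ ι) :
    EuclideanSpace ℝ κ :=
  WithLp.toLp 2 (A *ᵥ v.ofLp)

/-- The bounded operator on `L₂` that multiplies pointwise by a constant matrix. -/
def matOp {α : Type} [MeasurableSpace α] (μ : Measure α) {κ ι : Type} [Fintype κ] [Fintype ι]
    [DecidableEq ι] (A : Matrix κ ι ℝ) :
    Lp (EuclideanSpace ℝ ι) 2 μ →L[ℝ] Lp (EuclideanSpace ℝ κ) 2 μ :=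
  (LinearMap.toContinuousLinearMap (Matrix.toEuclideanLin A)).compLpL 2 μ

/-- All entries of a matrix-valued function are square integrable. -/
def SqInt {α : Type} [MeasurableSpace α] (μ : Measure α) {κ ι : Type}
    (f : α → Matrix κ ι ℝ) : Prop :=
  ∀ i j, MemLp (fun s => f s i j) 2 μ

/-! ### 2D-PI operators: `L₂[x,y] → L₂[x,y]` -/

/-- Parameters `N_{ij}` of a 2D-PI operator. Arguments are listed in the order
`x, y, θ, ν`, those that do not occur being left out. -/
structure Par2D (κ ι : Type) where
  N00 : ℝ → ℝ → Matrix κ ι ℝ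
  N10 : ℝ → ℝ → ℝ → Matrix κ ι ℝ
  N20 : ℝ → ℝ → ℝ → Matrix κ ι ℝ
  N01 : ℝ → ℝ → ℝ → Matrix κ ι ℝ
  N02 : ℝ → ℝ → ℝ → Matrix κ ι ℝ
  N11 : ℝ → ℝ → ℝ → ℝ → Matrix κ ι ℝ
  N21 : ℝ → ℝ → ℝ → ℝ → Matrix κ ι ℝ
  N12 : ℝ → ℝ → ℝ → ℝ → Matrix κ ι ℝ
  N22 : ℝ → ℝ → ℝ → ℝ → Matrix κ ι ℝ

/-- The parameter space `𝒩_{2D}`: all parameters are square integrable. -/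
structure MemN2D (R : Rectangle) {κ ι : Type} (N : Par2D κ ι) : Prop where
  m00 : SqInt R.μxy (fun s : ℝ × ℝ => N.N00 s.1 s.2)
  m10 : SqInt (R.μxy.prod R.μx) (fun s : (ℝ × ℝ) × ℝ => N.N10 s.1.1 s.1.2 s.2)
  m20 : SqInt (R.μxy.prod R.μx) (fun s : (ℝ × ℝ) × ℝ => N.N20 s.1.1 s.1.2 s.2)
  m01 : SqInt (R.μxy.prod R.μy) (fun s : (ℝ × ℝ) × ℝ => N.N01 s.1.1 s.1.2 s.2)
  m02 : SqInt (R.μxy.prod R.μy) (fun s : (ℝ × ℝ) × ℝ => N.N02 s.1.1 s.1.2 s.2)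
  m11 : SqInt (R.μxy.prod R.μxy)
    (fun s : (ℝ × ℝ) × (ℝ × ℝ) => N.N11 s.1.1 s.1.2 s.2.1 s.2.2)
  m21 : SqInt (R.μxy.prod R.μxy)
    (fun s : (ℝ × ℝ) × (ℝ × ℝ) => N.N21 s.1.1 s.1.2 s.2.1 s.2.2)
  m12 : SqInt (R.μxy.prod R.μxy)
    (fun s : (ℝ × ℝ) × (ℝ × ℝ) => N.N12 s.1.1 s.1.2 s.2.1 s.2.2)
  m22 : SqInt (R.μxy.prod R.μxy)
    (fun s : (ℝ × ℝ) × (ℝ × ℝ) => N.N22 s.1.1 s.1.2 s.2.1 s.2.2)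

/-- The function `𝒫[N]u`. -/
def Par2D.apply (R : Rectangle) {κ ι : Type} [Fintype κ] [Fintype ι] (N : Par2D κ ι)
    (u : ℝ × ℝ → EuclideanSpace ℝ ι) (x y : ℝ) : EuclideanSpace ℝ κ :=
  mv (N.N00 x y) (u (x, y))
  + (∫ θ in R.a..x, mv (N.N10 x y θ) (u (θ, y)))
  + (∫ θ in x..R.b, mv (N.N20 x y θ) (u (θ, y)))
  + (∫ ν in R.c..y, mv (N.N01 x y ν) (u (x, ν)))
  + (∫ ν in y..R.d, mv (N.N02 x y ν) (u (x, ν)))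
  + (∫ θ in R.a..x, ∫ ν in R.c..y, mv (N.N11 x y θ ν) (u (θ, ν)))
  + (∫ θ in x..R.b, ∫ ν in R.c..y, mv (N.N21 x y θ ν) (u (θ, ν)))
  + (∫ θ in R.a..x, ∫ ν in y..R.d, mv (N.N12 x y θ ν) (u (θ, ν)))
  + (∫ θ in x..R.b, ∫ ν in y..R.d, mv (N.N22 x y θ ν) (u (θ, ν)))

/-- The bounded operator `T` on `L₂[x,y]` is given by the formula for `𝒫[N]`. -/
def Par2D.Represents (R : Rectangle) {κ ι : Type} [Fintype κ] [Fintype ι] (N : Par2D κ ι)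
    (T : L2xy R ι →L[ℝ] L2xy R κ) : Prop :=
  ∀ u : L2xy R ι, T u =ᵐ[R.μxy] fun s => N.apply R u s.1 s.2

open Classical in
/-- The operator `𝒫[N] : L₂[x,y] → L₂[x,y]`. (If the formula does not define a bounded operator
between these spaces, the value is the conventional `0`.) -/
def Par2D.op (R : Rectangle) {κ ι : Type} [Fintype κ] [Fintype ι] (N : Par2D κ ι) :
    L2xy R ι →L[ℝ] L2xy R κ :=
  if h : ∃ T, N.Represents R T then h.choose else 0

/-! ### 011-PI operators: `RL → RL` -/

/-- Parameters `N₀, N₁, N₂` of a 1D-PI operator. -/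
structure Par1D (κ ι : Type) where
  N0 : ℝ → Matrix κ ι ℝ
  N1 : ℝ → ℝ → Matrix κ ι ℝ
  N2 : ℝ → ℝ → Matrix κ ι ℝ

/-- The parameter space `𝒩_{1D}` for functions that are square integrable for `μ`. -/
structure MemN1D (μ : Measure ℝ) {κ ι : Type} (N : Par1D κ ι) : Prop where
  m0 : SqInt μ N.N0
  m1 : SqInt (μ.prod μ) (fun s : ℝ × ℝ => N.N1 s.1 s.2)
  m2 : SqInt (μ.prod μ) (fun s : ℝ × ℝ => N.N2 s.1 s.2)

/-- The function `𝒫[N]u` of one variable in `[a,b]`. -/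
def Par1D.apply {κ ι : Type} [Fintype κ] [Fintype ι] (N : Par1D κ ι) (a b : ℝ)
    (u : ℝ → EuclideanSpace ℝ ι) (x : ℝ) : EuclideanSpace ℝ κ :=
  mv (N.N0 x) (u x) + (∫ θ in a..x, mv (N.N1 x θ) (u θ)) + (∫ θ in x..b, mv (N.N2 x θ) (u θ))

/-- Parameters of a 011-PI operator. The arguments of `B12` are `x, y`, those of `B21` are
`y, x`. -/
structure Par011 (κ₀ κ₁ ι₀ ι₁ : Type) where
  B00 : Matrix κ₀ ι₀ ℝ
  B01 : ℝ → Matrix κ₀ ι₁ ℝ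
  B02 : ℝ → Matrix κ₀ ι₁ ℝ
  B10 : ℝ → Matrix κ₁ ι₀ ℝ
  B11 : Par1D κ₁ ι₁
  B12 : ℝ → ℝ → Matrix κ₁ ι₁ ℝ
  B20 : ℝ → Matrix κ₁ ι₀ ℝ
  B21 : ℝ → ℝ → Matrix κ₁ ι₁ ℝ
  B22 : Par1D κ₁ ι₁

/-- The parameter space `𝒩_{011}`. -/
structure MemN011 (R : Rectangle) {κ₀ κ₁ ι₀ ι₁ : Type} (B : Par011 κ₀ κ₁ ι₀ ι₁) : Prop where
  m01 : SqInt R.μx B.B01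
  m02 : SqInt R.μy B.B02
  m10 : SqInt R.μx B.B10
  m11 : MemN1D R.μx B.B11
  m12 : SqInt R.μxy (fun s : ℝ × ℝ => B.B12 s.1 s.2)
  m20 : SqInt R.μy B.B20
  m21 : SqInt (R.μy.prod R.μx) (fun s : ℝ × ℝ => B.B21 s.1 s.2)
  m22 : MemN1D R.μy B.B22

section

variable {κ₀ κ₁ ι₀ ι₁ : Type} [Fintype κ₀] [Fintype κ₁] [Fintype ι₀] [Fintype ι₁]

/-- The bounded operator `T` on `RL` is given by the formula for `𝒫[B]`. -/
def Par011.Represents (R : Rectangle) (B : Par011 κ₀ κ₁ ι₀ ι₁)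
    (T : RL R ι₀ ι₁ →L[ℝ] RL R κ₀ κ₁) : Prop :=
  ∀ (v : EuclideanSpace ℝ ι₀) (f : L2x R ι₁) (g : L2y R ι₁),
    (T (v, f, g)).1 = mv B.B00 v + (∫ x in R.a..R.b, mv (B.B01 x) (f x))
        + (∫ y in R.c..R.d, mv (B.B02 y) (g y)) ∧
    (T (v, f, g)).2.1 =ᵐ[R.μx] (fun x =>
        mv (B.B10 x) v + B.B11.apply R.a R.b f x + ∫ y in R.c..R.d, mv (B.B12 x y) (g y)) ∧
    (T (v, f, g)).2.2 =ᵐ[R.μy] (fun y =>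
        mv (B.B20 y) v + (∫ x in R.a..R.b, mv (B.B21 y x) (f x)) + B.B22.apply R.c R.d g y)

open Classical in
/-- The operator `𝒫[B] : RL → RL`. (If the formula does not define a bounded operator between
these spaces, the value is the conventional `0`.) -/
def Par011.op (R : Rectangle) (B : Par011 κ₀ κ₁ ι₀ ι₁) : RL R ι₀ ι₁ →L[ℝ] RL R κ₀ κ₁ :=
  if h : ∃ T, B.Represents R T then h.choose else 0

end

/-! ### PI operators `RL → L₂[x,y]` and `L₂[x,y] → RL` -/

/-- Three parameters, the last two with one argument more. They are used both for the
operators `1D → 2D` and for the operators `2D → 1D`. -/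
structure ParMix (κ ι : Type) where
  E0 : ℝ → ℝ → Matrix κ ι ℝ
  E1 : ℝ → ℝ → ℝ → Matrix κ ι ℝ
  E2 : ℝ → ℝ → ℝ → Matrix κ ι ℝ

section

variable {κ ι : Type} [Fintype κ] [Fintype ι]

/-- `L₂[x] → L₂[x,y]`. -/
def ParMix.applyXto2 (R : Rectangle) (E : ParMix κ ι) (f : ℝ → EuclideanSpace ℝ ι)
    (x y : ℝ) : EuclideanSpace ℝ κ :=
  mv (E.E0 x y) (f x) + (∫ θ in R.a..x, mv (E.E1 x y θ) (f θ))
    + (∫ θ in x..R.b, mv (E.E2 x y θ) (f θ))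

/-- `L₂[y] → L₂[x,y]`. -/
def ParMix.applyYto2 (R : Rectangle) (E : ParMix κ ι) (g : ℝ → EuclideanSpace ℝ ι)
    (x y : ℝ) : EuclideanSpace ℝ κ :=
  mv (E.E0 x y) (g y) + (∫ ν in R.c..y, mv (E.E1 x y ν) (g ν))
    + (∫ ν in y..R.d, mv (E.E2 x y ν) (g ν))

/-- `L₂[x,y] → L₂[x]`. -/
def ParMix.apply2toX (R : Rectangle) (E : ParMix κ ι) (u : ℝ × ℝ → EuclideanSpace ℝ ι)
    (x : ℝ) : EuclideanSpace ℝ κ :=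
  ∫ y in R.c..R.d, (mv (E.E0 x y) (u (x, y)) + (∫ θ in R.a..x, mv (E.E1 x y θ) (u (θ, y)))
    + (∫ θ in x..R.b, mv (E.E2 x y θ) (u (θ, y))))

/-- `L₂[x,y] → L₂[y]`. -/
def ParMix.apply2toY (R : Rectangle) (E : ParMix κ ι) (u : ℝ × ℝ → EuclideanSpace ℝ ι)
    (y : ℝ) : EuclideanSpace ℝ κ :=
  ∫ x in R.a..R.b, (mv (E.E0 x y) (u (x, y)) + (∫ ν in R.c..y, mv (E.E1 x y ν) (u (x, ν)))
    + (∫ ν in y..R.d, mv (E.E2 x y ν) (u (x, ν))))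

end

/-- Parameters of a PI operator `RL → L₂[x,y]`. -/
structure Par011to2 (κ ι₀ ι₁ : Type) where
  C0 : ℝ → ℝ → Matrix κ ι₀ ℝ
  C1 : ParMix κ ι₁
  C2 : ParMix κ ι₁

/-- Parameters of a PI operator `L₂[x,y] → RL`. -/
structure Par2to011 (κ₀ κ₁ ι : Type) where
  C0 : ℝ → ℝ → Matrix κ₀ ι ℝ
  C1 : ParMix κ₁ ι
  C2 : ParMix κ₁ ι

section

variable {κ ι κ₀ κ₁ ι₀ ι₁ : Type} [Fintype κ] [Fintype ι] [Fintype κ₀] [Fintype κ₁]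
  [Fintype ι₀] [Fintype ι₁]

/-- The bounded operator `T` is given by the formula for `𝒫[C] : RL → L₂[x,y]`. -/
def Par011to2.Represents (R : Rectangle) (C : Par011to2 κ ι₀ ι₁)
    (T : RL R ι₀ ι₁ →L[ℝ] L2xy R κ) : Prop :=
  ∀ (v : EuclideanSpace ℝ ι₀) (f : L2x R ι₁) (g : L2y R ι₁),
    T (v, f, g) =ᵐ[R.μxy] fun s =>
      mv (C.C0 s.1 s.2) v + C.C1.applyXto2 R f s.1 s.2 + C.C2.applyYto2 R g s.1 s.2

open Classical in
/-- The operator `𝒫[C] : RL → L₂[x,y]`. -/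
def Par011to2.op (R : Rectangle) (C : Par011to2 κ ι₀ ι₁) : RL R ι₀ ι₁ →L[ℝ] L2xy R κ :=
  if h : ∃ T, C.Represents R T then h.choose else 0

/-- The bounded operator `T` is given by the formula for `𝒫[C] : L₂[x,y] → RL`. -/
def Par2to011.Represents (R : Rectangle) (C : Par2to011 κ₀ κ₁ ι)
    (T : L2xy R ι →L[ℝ] RL R κ₀ κ₁) : Prop :=
  ∀ u : L2xy R ι,
    (T u).1 = (∫ x in R.a..R.b, ∫ y in R.c..R.d, mv (C.C0 x y) (u (x, y))) ∧
    (T u).2.1 =ᵐ[R.μx] C.C1.apply2toX R u ∧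
    (T u).2.2 =ᵐ[R.μy] C.C2.apply2toY R u

open Classical in
/-- The operator `𝒫[C] : L₂[x,y] → RL`. -/
def Par2to011.op (R : Rectangle) (C : Par2to011 κ₀ κ₁ ι) : L2xy R ι →L[ℝ] RL R κ₀ κ₁ :=
  if h : ∃ T, C.Represents R T then h.choose else 0

end

/-! ### Weak derivatives, Sobolev spaces, boundary values -/

/-- The classical derivative `∂ₓⁱ ∂_yʲ φ`. -/
def pd (i j : ℕ) (φ : ℝ × ℝ → ℝ) (s : ℝ × ℝ) : ℝ :=
  iteratedDeriv i (fun x => iteratedDeriv j (fun y => φ (x, y)) s.2) s.1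

section

variable {ι κ : Type} [Fintype ι] [Fintype κ]

/-- `v` is the weak derivative `∂ₓⁱ ∂_yʲ u` on the open rectangle. -/
def IsWeakDeriv (R : Rectangle) (i j : ℕ) (u v : L2xy R ι) : Prop :=
  ∀ φ : ℝ × ℝ → ℝ, ContDiff ℝ ∞ φ → HasCompactSupport φ →
    tsupport φ ⊆ Ioo R.a R.b ×ˢ Ioo R.c R.d →
    ∫ s, pd i j φ s • u s ∂(R.μxy) = (-1 : ℝ) ^ (i + j) • ∫ s, φ s • v s ∂(R.μxy)

/-- `u ∈ H_k[x,y]`: all weak derivatives of order at most `k` in each variable are in `L₂`. -/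
def MemH (R : Rectangle) (k : ℕ) (u : L2xy R ι) : Prop :=
  ∀ i j : ℕ, i ≤ k → j ≤ k → ∃ v : L2xy R ι, IsWeakDeriv R i j u v

open Classical in
/-- The weak derivative `∂ₓⁱ ∂_yʲ u ∈ L₂` (`0` if there is none). -/
def weakDeriv (R : Rectangle) (i j : ℕ) (u : L2xy R ι) : L2xy R ι :=
  if h : ∃ v, IsWeakDeriv R i j u v then h.choose else 0

open Classical in
/-- The composition `∂ₓⁱ ∂_yʲ S` of a differential operator with a bounded operator `S` on
`L₂`, when it is a bounded operator on `L₂` (and `0` otherwise). -/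
def diffComp (R : Rectangle) (i j : ℕ) (S : L2xy R κ →L[ℝ] L2xy R ι) :
    L2xy R κ →L[ℝ] L2xy R ι :=
  if h : ∃ D : L2xy R κ →L[ℝ] L2xy R ι, ∀ u, IsWeakDeriv R i j (S u) (D u)
  then h.choose else 0

/-- `g` is the restriction of `f` to the line `y = y₀`, for `f` with a representative that is
continuous in `y`. -/
def IsTraceY (R : Rectangle) (y₀ : ℝ) (f : L2xy R ι) (g : L2x R ι) : Prop :=
  ∃ F : ℝ → ℝ → EuclideanSpace ℝ ι, (f =ᵐ[R.μxy] fun s => F s.1 s.2) ∧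
    (∀ᵐ x ∂(R.μx), ContinuousOn (F x) (Icc R.c R.d)) ∧ g =ᵐ[R.μx] fun x => F x y₀

/-- `g` is the restriction of `f` to the line `x = x₀`, for `f` with a representative that is
continuous in `x`. -/
def IsTraceX (R : Rectangle) (x₀ : ℝ) (f : L2xy R ι) (g : L2y R ι) : Prop :=
  ∃ F : ℝ → ℝ → EuclideanSpace ℝ ι, (f =ᵐ[R.μxy] fun s => F s.1 s.2) ∧
    (∀ᵐ y ∂(R.μy), ContinuousOn (fun x => F x y) (Icc R.a R.b)) ∧ g =ᵐ[R.μy] fun y => F x₀ y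

/-- `v` is the value at `p` of the continuous representative of `f`. -/
def IsValueAt (R : Rectangle) (p : ℝ × ℝ) (f : L2xy R ι) (v : EuclideanSpace ℝ ι) : Prop :=
  ∃ F : ℝ × ℝ → EuclideanSpace ℝ ι, f =ᵐ[R.μxy] F ∧
    ContinuousOn F (Icc R.a R.b ×ˢ Icc R.c R.d) ∧ F p = v

open Classical in
/-- The Dirac operator `Λ_y^{y₀}`. -/
def traceY (R : Rectangle) (y₀ : ℝ) (f : L2xy R ι) : L2x R ι :=
  if h : ∃ g, IsTraceY R y₀ f g then h.choose else 0

open Classical in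
/-- The Dirac operator `Λ_x^{x₀}`. -/
def traceX (R : Rectangle) (x₀ : ℝ) (f : L2xy R ι) : L2y R ι :=
  if h : ∃ g, IsTraceX R x₀ f g then h.choose else 0

open Classical in
/-- The Dirac operator `Λ_x^{x₀} Λ_y^{y₀}`. -/
def valueAt (R : Rectangle) (x₀ y₀ : ℝ) (f : L2xy R ι) : EuclideanSpace ℝ ι :=
  if h : ∃ v, IsValueAt R (x₀, y₀) f v then h.choose else 0

end

/-! ### State components and boundary values -/

/-- Components of a state `u = (u₀, u₁, u₂)`. -/
abbrev St (n₀ n₁ n₂ : ℕ) := Fin n₀ ⊕ Fin n₁ ⊕ Fin n₂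

/-- The differentiability class (0, 1 or 2) of a component. -/
def St.order {n₀ n₁ n₂ : ℕ} : St n₀ n₁ n₂ → ℕ
  | .inl _ => 0
  | .inr (.inl _) => 1
  | .inr (.inr _) => 2

/-- The components of differentiability class at least `m`. -/
abbrev Sub (n₀ n₁ n₂ m : ℕ) := {s : St n₀ n₁ n₂ // m ≤ s.order}

/-- The selection matrix `N_m`, `m = 0, 1, 2`. -/
def selN (n₀ n₁ n₂ m : ℕ) : Matrix (Sub n₀ n₁ n₂ m) (St n₀ n₁ n₂) ℝ :=
  Matrix.of fun s t => if s.1 = t then 1 else 0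

/-- Selection of `u₁`. -/
def sel1 (n₀ n₁ n₂ : ℕ) : Matrix (Fin n₁) (St n₀ n₁ n₂) ℝ :=
  Matrix.of fun i t => if t = .inr (.inl i) then 1 else 0

/-- Selection of `u₂`. -/
def sel2 (n₀ n₁ n₂ : ℕ) : Matrix (Fin n₂) (St n₀ n₁ n₂) ℝ :=
  Matrix.of fun i t => if t = .inr (.inr i) then 1 else 0

/-- Core boundary values at the corner `(a,c)`: `u₁`, and `∂ₓᵏ ∂_yˡ u₂` with index `(k, l, ·)`
for `k, l ∈ {0, 1}`. There are `n₁ + 4 n₂` of them. -/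
abbrev Core0 (n₁ n₂ : ℕ) := Fin n₁ ⊕ (Fin 2 × Fin 2 × Fin n₂)

/-- Core boundary values on the edge `y = c`: `∂ₓ u₁`, and `∂ₓ² ∂_yˡ u₂` with index `(l, ·)`;
on the edge `x = a`: `∂_y u₁`, and `∂ₓˡ ∂_y² u₂` with index `(l, ·)`.
On each edge there are `n₁ + 2 n₂` of them. -/
abbrev Core1 (n₁ n₂ : ℕ) := Fin n₁ ⊕ (Fin 2 × Fin n₂)

/-- All boundary values at the corners: `u₁` at the corner `(p,q)` with index `(p, q, ·)`, and
`∂ₓʳ ∂_yˢ u₂` at the corner `(p,q)` with index `(p, q, r, s, ·)`, for `p, q, r, s ∈ {0, 1}`.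
There are `4 n₁ + 16 n₂` of them. -/
abbrev Full0 (n₁ n₂ : ℕ) :=
  (Fin 2 × Fin 2 × Fin n₁) ⊕ (Fin 2 × Fin 2 × Fin 2 × Fin 2 × Fin n₂)

/-- All boundary values on the edges `y = c, d` (side `q = 0, 1`): `∂ₓ u₁` with index `(q, ·)`
and `∂ₓ² ∂_yˢ u₂` with index `(q, s, ·)`; on the edges `x = a, b` (side `p`): `∂_y u₁` with
index `(p, ·)` and `∂ₓˢ ∂_y² u₂` with index `(p, s, ·)`.
In each direction there are `2 n₁ + 4 n₂` of them. -/
abbrev Full1 (n₁ n₂ : ℕ) := (Fin 2 × Fin n₁) ⊕ (Fin 2 × Fin 2 × Fin n₂)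

/-- Embedding of the `∂u₁`-part at a side `q`. -/
def emb1 (n₁ n₂ : ℕ) (q : Fin 2) : Matrix (Full1 n₁ n₂) (Fin n₁) ℝ :=
  Matrix.of fun f i => if f = .inl (q, i) then 1 else 0

/-- Embedding of the `∂u₂`-part of order `s` at a side `q`. -/
def emb2 (n₁ n₂ : ℕ) (q s : Fin 2) : Matrix (Full1 n₁ n₂) (Fin n₂) ℝ :=
  Matrix.of fun f i => if f = .inr (q, s, i) then 1 else 0

/-- The operator `Λ_bf`, listing all boundary values of `u₁` and `u₂`. -/
def bdry (R : Rectangle) {n₀ n₁ n₂ : ℕ} (u : L2xy R (St n₀ n₁ n₂)) :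
    RL R (Full0 n₁ n₂) (Full1 n₁ n₂) :=
  let u₁ : L2xy R (Fin n₁) := matOp R.μxy (sel1 n₀ n₁ n₂) u
  let u₂ : L2xy R (Fin n₂) := matOp R.μxy (sel2 n₀ n₁ n₂) u
  (WithLp.toLp 2 fun
      | .inl (p, q, i) => valueAt R (R.xEnd p) (R.yEnd q) u₁ i
      | .inr (p, q, r, s, i) => valueAt R (R.xEnd p) (R.yEnd q) (weakDeriv R r s u₂) i,
    ∑ q, matOp R.μx (emb1 n₁ n₂ q) (traceY R (R.yEnd q) (weakDeriv R 1 0 u₁))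
      + ∑ q, ∑ s : Fin 2,
          matOp R.μx (emb2 n₁ n₂ q s) (traceY R (R.yEnd q) (weakDeriv R 2 s u₂)),
    ∑ p, matOp R.μy (emb1 n₁ n₂ p) (traceX R (R.xEnd p) (weakDeriv R 0 1 u₁))
      + ∑ p, ∑ s : Fin 2,
          matOp R.μy (emb2 n₁ n₂ p s) (traceX R (R.xEnd p) (weakDeriv R s 2 u₂)))

/-! ### The PDE -/

/-- Parameters of the operator `ℬ` that defines the boundary conditions. -/
abbrev BCPar (n₁ n₂ : ℕ) := Par011 (Core0 n₁ n₂) (Core1 n₁ n₂) (Full0 n₁ n₂) (Full1 n₁ n₂)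

/-- The space `X(ℬ)`: `u₀ ∈ L₂`, `u₁ ∈ H₁`, `u₂ ∈ H₂` and `ℬ Λ_bf u = 0`. -/
def stateSpace (R : Rectangle) {n₀ n₁ n₂ : ℕ} (B : BCPar n₁ n₂) :
    Set (L2xy R (St n₀ n₁ n₂)) :=
  {u | MemH R 1 (matOp R.μxy (sel1 n₀ n₁ n₂) u) ∧ MemH R 2 (matOp R.μxy (sel2 n₀ n₁ n₂) u) ∧
    B.op R (bdry R u) = 0}

/-- The coefficient matrices `A_{ij}`, `0 ≤ i, j ≤ 2`. -/
abbrev Coeffs (n₀ n₁ n₂ : ℕ) :=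
  (i j : Fin 3) → Matrix (St n₀ n₁ n₂) (Sub n₀ n₁ n₂ (max i.val j.val)) ℝ

/-- The right-hand side `∑ A_{ij} ∂ₓⁱ ∂_yʲ (N_{max(i,j)} u)` of the PDE. -/
def pdeRHS (R : Rectangle) {n₀ n₁ n₂ : ℕ} (A : Coeffs n₀ n₁ n₂) (u : L2xy R (St n₀ n₁ n₂)) :
    L2xy R (St n₀ n₁ n₂) :=
  ∑ i : Fin 3, ∑ j : Fin 3, matOp R.μxy (A i j)
    (weakDeriv R i j (matOp R.μxy (selN n₀ n₁ n₂ (max i.val j.val)) u))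

/-- `u` satisfies the PDE defined by `{A_{ij}, ℬ}` on `[0,∞)` with initial condition `uI`. -/
structure IsSolution (R : Rectangle) {n₀ n₁ n₂ : ℕ} (A : Coeffs n₀ n₁ n₂) (B : BCPar n₁ n₂)
    (uI : L2xy R (St n₀ n₁ n₂)) (u : ℝ → L2xy R (St n₀ n₁ n₂)) : Prop where
  init : u 0 = uI
  mem : ∀ t, 0 ≤ t → u t ∈ stateSpace R B
  eq : ∀ t, 0 ≤ t → HasDerivWithinAt u (pdeRHS R A (u t)) (Ici 0) t

/-! ### The operators `𝒦₁, 𝒦₂, ℋ₁, ℋ₂`, and the PIE operators `𝒯, 𝒜` -/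

/-- The `r`-th derivative of `h ^ k` (for `r, k ∈ {0, 1}`). -/
def tay (r k : Fin 2) (h : ℝ) : ℝ := if r ≤ k then h ^ (k.val - r.val) else 0

/-- The Kronecker symbol. -/
def kron {n : ℕ} (i j : Fin n) : ℝ := if i = j then 1 else 0

section

variable (R : Rectangle) (n₀ n₁ n₂ : ℕ)

def K30 (x y : ℝ) : Matrix (St n₀ n₁ n₂) (Core0 n₁ n₂) ℝ := Matrix.of fun
  | .inr (.inl i), .inl j => kron i j
  | .inr (.inr i), .inr (k, l, j) => kron i j * (x - R.a) ^ k.val * (y - R.c) ^ l.val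
  | _, _ => 0

def K31 (x y θ : ℝ) : Matrix (St n₀ n₁ n₂) (Core1 n₁ n₂) ℝ := Matrix.of fun
  | .inr (.inl i), .inl j => kron i j
  | .inr (.inr i), .inr (l, j) => kron i j * (x - θ) * (y - R.c) ^ l.val
  | _, _ => 0

def K32 (x y ν : ℝ) : Matrix (St n₀ n₁ n₂) (Core1 n₁ n₂) ℝ := Matrix.of fun
  | .inr (.inl i), .inl j => kron i j
  | .inr (.inr i), .inr (l, j) => kron i j * (y - ν) * (x - R.a) ^ l.val
  | _, _ => 0

def K33 (x y θ ν : ℝ) : Matrix (St n₀ n₁ n₂) (St n₀ n₁ n₂) ℝ := Matrix.of fun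
  | .inr (.inl i), .inr (.inl j) => kron i j
  | .inr (.inr i), .inr (.inr j) => kron i j * (x - θ) * (y - ν)
  | _, _ => 0

def T00 : Matrix (St n₀ n₁ n₂) (St n₀ n₁ n₂) ℝ := Matrix.of fun
  | .inl i, .inl j => kron i j
  | _, _ => 0

def K1 : Par011to2 (St n₀ n₁ n₂) (Core0 n₁ n₂) (Core1 n₁ n₂) where
  C0 := K30 R n₀ n₁ n₂
  C1 := ⟨0, K31 R n₀ n₁ n₂, 0⟩
  C2 := ⟨0, K32 R n₀ n₁ n₂, 0⟩

def K2 : Par2D (St n₀ n₁ n₂) (St n₀ n₁ n₂) where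
  N00 := fun _ _ => T00 n₀ n₁ n₂
  N10 := 0
  N20 := 0
  N01 := 0
  N02 := 0
  N11 := K33 n₀ n₁ n₂
  N21 := 0
  N12 := 0
  N22 := 0

def H00 : Matrix (Full0 n₁ n₂) (Core0 n₁ n₂) ℝ := Matrix.of fun
  | .inl (_, _, i), .inl j => kron i j
  | .inr (p, q, r, s, i), .inr (k, l, j) =>
      kron i j * tay r k (R.xEnd p - R.a) * tay s l (R.yEnd q - R.c)
  | _, _ => 0

def H01 (x : ℝ) : Matrix (Full0 n₁ n₂) (Core1 n₁ n₂) ℝ := Matrix.of fun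
  | .inl (p, _, i), .inl j => if p = 1 then kron i j else 0
  | .inr (p, q, r, s, i), .inr (l, j) =>
      if p = 1 then kron i j * (R.b - x) ^ (1 - r.val) * tay s l (R.yEnd q - R.c) else 0
  | _, _ => 0

def H02 (y : ℝ) : Matrix (Full0 n₁ n₂) (Core1 n₁ n₂) ℝ := Matrix.of fun
  | .inl (_, q, i), .inl j => if q = 1 then kron i j else 0
  | .inr (p, q, r, s, i), .inr (l, j) =>
      if q = 1 then kron i j * (R.d - y) ^ (1 - s.val) * tay r l (R.xEnd p - R.a) else 0
  | _, _ => 0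

def H11 : Matrix (Full1 n₁ n₂) (Core1 n₁ n₂) ℝ := Matrix.of fun
  | .inl (_, i), .inl j => kron i j
  | .inr (q, s, i), .inr (l, j) => kron i j * tay s l (R.yEnd q - R.c)
  | _, _ => 0

def H22 : Matrix (Full1 n₁ n₂) (Core1 n₁ n₂) ℝ := Matrix.of fun
  | .inl (_, i), .inl j => kron i j
  | .inr (p, s, i), .inr (l, j) => kron i j * tay s l (R.xEnd p - R.a)
  | _, _ => 0

def H03 (x y : ℝ) : Matrix (Full0 n₁ n₂) (St n₀ n₁ n₂) ℝ := Matrix.of fun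
  | .inl (p, q, i), .inr (.inl j) => if p = 1 ∧ q = 1 then kron i j else 0
  | .inr (p, q, r, s, i), .inr (.inr j) =>
      if p = 1 ∧ q = 1 then kron i j * (R.b - x) ^ (1 - r.val) * (R.d - y) ^ (1 - s.val) else 0
  | _, _ => 0

def H13 (y : ℝ) : Matrix (Full1 n₁ n₂) (St n₀ n₁ n₂) ℝ := Matrix.of fun
  | .inl (q, i), .inr (.inl j) => if q = 1 then kron i j else 0
  | .inr (q, s, i), .inr (.inr j) => if q = 1 then kron i j * (R.d - y) ^ (1 - s.val) else 0
  | _, _ => 0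

def H23 (x : ℝ) : Matrix (Full1 n₁ n₂) (St n₀ n₁ n₂) ℝ := Matrix.of fun
  | .inl (p, i), .inr (.inl j) => if p = 1 then kron i j else 0
  | .inr (p, s, i), .inr (.inr j) => if p = 1 then kron i j * (R.b - x) ^ (1 - s.val) else 0
  | _, _ => 0

def H1 : Par011 (Full0 n₁ n₂) (Full1 n₁ n₂) (Core0 n₁ n₂) (Core1 n₁ n₂) where
  B00 := H00 R n₁ n₂
  B01 := H01 R n₁ n₂
  B02 := H02 R n₁ n₂
  B10 := 0
  B11 := ⟨fun _ => H11 R n₁ n₂, 0, 0⟩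
  B12 := 0
  B20 := 0
  B21 := 0
  B22 := ⟨fun _ => H22 R n₁ n₂, 0, 0⟩

def H2 : Par2to011 (Full0 n₁ n₂) (Full1 n₁ n₂) (St n₀ n₁ n₂) where
  C0 := H03 R n₀ n₁ n₂
  C1 := ⟨fun _ y => H13 R n₀ n₁ n₂ y, 0, 0⟩
  C2 := ⟨fun x _ => H23 R n₀ n₁ n₂ x, 0, 0⟩

end

/-- Well-posed boundary conditions: `ℬ ℋ₁` is invertible, and its inverse is a 011-PI
operator. -/
def WellPosed (R : Rectangle) {n₁ n₂ : ℕ} (B : BCPar n₁ n₂) : Prop :=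
  ∃ E : Par011 (Core0 n₁ n₂) (Core1 n₁ n₂) (Core0 n₁ n₂) (Core1 n₁ n₂), MemN011 R E ∧
    E.op R ∘L (B.op R ∘L (H1 R n₁ n₂).op R) = ContinuousLinearMap.id ℝ _ ∧
    (B.op R ∘L (H1 R n₁ n₂).op R) ∘L E.op R = ContinuousLinearMap.id ℝ _

/-- The operator `𝒯 = 𝒦₂ - 𝒦₁ (ℬ ℋ₁)⁻¹ ℬ ℋ₂`, which maps the fundamental state to the PDE
state. -/
def opT (R : Rectangle) (n₀ : ℕ) {n₁ n₂ : ℕ} (B : BCPar n₁ n₂) :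
    L2xy R (St n₀ n₁ n₂) →L[ℝ] L2xy R (St n₀ n₁ n₂) :=
  (K2 n₀ n₁ n₂).op R - (K1 R n₀ n₁ n₂).op R ∘L
    (ContinuousLinearMap.inverse (B.op R ∘L (H1 R n₁ n₂).op R) ∘L
      (B.op R ∘L (H2 R n₀ n₁ n₂).op R))

/-- The operator `𝒜 = ∑ A_{ij} ∂ₓⁱ ∂_yʲ [N_{max(i,j)} 𝒯]`. -/
def opA (R : Rectangle) {n₀ n₁ n₂ : ℕ} (A : Coeffs n₀ n₁ n₂) (B : BCPar n₁ n₂) :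
    L2xy R (St n₀ n₁ n₂) →L[ℝ] L2xy R (St n₀ n₁ n₂) :=
  ∑ i : Fin 3, ∑ j : Fin 3, matOp R.μxy (A i j) ∘L
    diffComp R i j (matOp R.μxy (selN n₀ n₁ n₂ (max i.val j.val)) ∘L opT R n₀ B)

end PIE

end

noncomputable section

set_option linter.unusedSectionVars false

namespace PIE

/-! ### Bounded operators on `L₂` from operators on functions -/

section Lift

variable {α β : Type*} [MeasurableSpace α] [MeasurableSpace β]
  {E F : Type*} [NormedAddCommGroup E] [NormedSpace ℝ E] [NormedAddCommGroup F] [NormedSpace ℝ F]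

/-! In terms of the fundamental state `v = 𝒟u` the PDE involves only bounded operators: a state `u`
in `X(ℬ)` equals `𝒯v`, and the right-hand side of the PDE at `u` equals `𝒜v`. For `V = ⟪u, 𝒫u⟫` this
gives `V' = ⟪𝒜v, 𝒫𝒯v⟫ + ⟪𝒯v, 𝒫𝒜v⟫ ≤ -δ‖u‖² ≤ -(δ/ζ)V`, and `ε‖u‖² ≤ V ≤ ζ‖u‖²` turns the decay of
`V` into decay of the norm (`energy_decay`). Only `u` is differentiated in time; `v(t)` is merely
chosen for each `t`, with no regularity.

The work lies in `u = 𝒯v`. A function with weak derivatives up to order `m` in each variable has a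
Taylor expansion with integral remainder at the corner `(a,c)`: corner values, functions on the
edges `y = c` and `x = a`, and the highest mixed derivative (`exists_jetV_eq_of_memH`). It rests on
one fact: if `∂ₓg = 0` weakly, then `g` depends on `y` alone (`exists_liftY_of_isWeakDeriv_zero`).
This is used for one derivative at a time, in each variable; the corner constants appear because a
function of `x` alone that equals a function of `y` alone is constant. Conversely, `jetV` is built
by a recursion in `x` and satisfies the mirrored recursion in `y` (`jetV_succ_right`), since
primitives in the two variables commute. Weak derivatives, traces and corner values of the expansion
are then found by peeling off primitives.

Hence `stateMap (w, v) = 𝒦₁w + 𝒦₂v` reaches every admissible `u`, and its boundary values are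
`bdryMap (w, v) = ℋ₁w + ℋ₂v` (`bdry_stateMap`). The boundary condition reads `ℬℋ₁w + ℬℋ₂v = 0`;
invertibility of `ℬℋ₁` determines `w` from `v`, and `u = 𝒯v` follows (`exists_opT_eq`).

The operators in the statement are picked by choice, with value `0` if none exists. So each of `𝒦₁,
𝒦₂, ℋ₁, ℋ₂` must be exhibited as a bounded operator with the prescribed kernels (`K1_represents`,
`K2_represents`, `H1_represents`, `H2_represents`). The compositions `∂ₓⁱ∂_yʲ[N𝒯]` are bounded by
the closed graph theorem (`diffComp_apply`), which yields `opA_apply`. All bounded operators are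
assembled from a few elementary ones: extension, primitive and integration in one variable. The
versions in `y` are those in `x` on the reflected rectangle. -/

/-- The bounded operator between `L₂` spaces induced by a bounded linear operation `Φ` on
functions. -/
def liftL2 {μ : Measure α} {ν : Measure β} (Φ : (α → E) → β → F) (C : NNReal)
    (hm : ∀ f : Lp E 2 μ, AEStronglyMeasurable (Φ f) ν)
    (hb : ∀ f : Lp E 2 μ, eLpNorm (Φ f) 2 ν ≤ C * eLpNorm f 2 μ)
    (hadd : ∀ f g : Lp E 2 μ, Φ (f + g : Lp E 2 μ) =ᵐ[ν] Φ f + Φ g)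
    (hsmul : ∀ (c : ℝ) (f : Lp E 2 μ), Φ (c • f : Lp E 2 μ) =ᵐ[ν] c • Φ f) :
    Lp E 2 μ →L[ℝ] Lp F 2 ν :=
  have hmem : ∀ f : Lp E 2 μ, MemLp (Φ f) 2 ν := fun f =>
    ⟨hm f, (hb f).trans_lt (ENNReal.mul_lt_top ENNReal.coe_lt_top (Lp.eLpNorm_lt_top f))⟩
  LinearMap.mkContinuous
    { toFun := fun f => (hmem f).toLp _
      map_add' := fun f g => by
        rw [← MemLp.toLp_add]
        exact MemLp.toLp_congr _ _ (hadd f g)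
      map_smul' := fun c f => by
        rw [RingHom.id_apply, ← MemLp.toLp_const_smul]
        exact MemLp.toLp_congr _ _ (hsmul c f) }
    C fun f => by
      simp only [LinearMap.coe_mk, AddHom.coe_mk]
      rw [Lp.norm_toLp, Lp.norm_def]
      refine (ENNReal.toReal_mono ?_ (hb f)).trans_eq ?_
      · exact (ENNReal.mul_lt_top ENNReal.coe_lt_top (Lp.eLpNorm_lt_top f)).ne
      · simp

theorem coeFn_liftL2 {μ : Measure α} {ν : Measure β} {Φ : (α → E) → β → F} {C : NNReal}
    {hm : ∀ f : Lp E 2 μ, AEStronglyMeasurable (Φ f) ν}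
    {hb : ∀ f : Lp E 2 μ, eLpNorm (Φ f) 2 ν ≤ C * eLpNorm f 2 μ}
    {hadd : ∀ f g : Lp E 2 μ, Φ (f + g : Lp E 2 μ) =ᵐ[ν] Φ f + Φ g}
    {hsmul : ∀ (c : ℝ) (f : Lp E 2 μ), Φ (c • f : Lp E 2 μ) =ᵐ[ν] c • Φ f} (f : Lp E 2 μ) :
    liftL2 Φ C hm hb hadd hsmul f =ᵐ[ν] Φ f :=
  MemLp.coeFn_toLp (μ := ν) (p := 2) (f := Φ f)
    ⟨hm f, (hb f).trans_lt (ENNReal.mul_lt_top ENNReal.coe_lt_top (Lp.eLpNorm_lt_top f))⟩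

/-- `∫ ‖f(θ, y)‖ dθ` is square integrable in `y`. -/
theorem eLpNorm_lintegral_enorm_le {μ : Measure α} {ν : Measure β} [IsFiniteMeasure μ]
    [IsFiniteMeasure ν] {f : α × β → E} (hf : StronglyMeasurable f) :
    eLpNorm (fun y => ∫⁻ θ, ‖f (θ, y)‖ₑ ∂μ) 2 ν
      ≤ μ univ ^ (1 / 2 : ℝ) * eLpNorm f 2 (μ.prod ν) := by
  -- Cauchy–Schwarz on each section, as the comparison of the `L¹` and `L²` norms on a finite
  -- measure space; Tonelli then integrates the bound over `y`.
  have key : ∀ y, (∫⁻ θ, ‖f (θ, y)‖ₑ ∂μ) ^ (2 : ℝ)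
      ≤ μ univ * ∫⁻ θ, ‖f (θ, y)‖ₑ ^ (2 : ℝ) ∂μ := by
    intro y
    have h := eLpNorm_le_eLpNorm_mul_rpow_measure_univ (μ := μ) (p := 1) (q := 2)
      (f := fun θ => f (θ, y)) (by norm_num)
      (hf.comp_measurable measurable_prodMk_right).aestronglyMeasurable
    rw [eLpNorm_one_eq_lintegral_enorm,
      eLpNorm_eq_lintegral_rpow_enorm_toReal (by norm_num) (by norm_num)] at h
    refine (ENNReal.rpow_le_rpow h (by norm_num : (0 : ℝ) ≤ 2)).trans_eq ?_
    rw [ENNReal.mul_rpow_of_nonneg _ _ (by norm_num), ← ENNReal.rpow_mul, ← ENNReal.rpow_mul]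
    norm_num [mul_comm]
  rw [eLpNorm_eq_lintegral_rpow_enorm_toReal (by norm_num) (by norm_num),
    eLpNorm_eq_lintegral_rpow_enorm_toReal (by norm_num) (by norm_num)]
  simp only [ENNReal.toReal_ofNat, enorm_eq_self]
  rw [← ENNReal.mul_rpow_of_nonneg _ _ (by norm_num)]
  refine ENNReal.rpow_le_rpow ?_ (by norm_num)
  refine (lintegral_mono key).trans ?_
  rw [lintegral_const_mul' _ _ (measure_ne_top _ _), lintegral_prod_symm]
  exact (hf.enorm.pow_const _).aemeasurable

/-- The image of `κ.prod ν` under the second projection is `κ univ • ν`; scaling a measure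
multiplies the `L²` norm by the square root of the factor. -/
theorem eLpNorm_comp_snd_le {γ : Type*} [MeasurableSpace γ] {κ : Measure γ} {ν : Measure β}
    [IsFiniteMeasure κ] [IsFiniteMeasure ν] {ε : Type*} [TopologicalSpace ε]
    [ContinuousENorm ε] {N : β → ε} (hN : AEStronglyMeasurable N ν) :
    eLpNorm (fun z : γ × β => N z.2) 2 (κ.prod ν) = κ univ ^ (1 / 2 : ℝ) * eLpNorm N 2 ν := by
  have h : AEStronglyMeasurable N (Measure.map Prod.snd (κ.prod ν)) := by
    rw [Measure.map_snd_prod]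
    exact hN.mono_ac (Measure.smul_absolutelyContinuous)
  have := eLpNorm_map_measure (p := 2) h measurable_snd.aemeasurable
  rw [Measure.map_snd_prod, eLpNorm_smul_measure_of_ne_top (by norm_num)] at this
  simpa [Function.comp_def] using this.symm

end Lift

/-! ### The rectangle and its reflection -/

section Rect

variable (R : Rectangle)

instance : IsFiniteMeasure R.μx := by unfold Rectangle.μx; infer_instance
instance : IsFiniteMeasure R.μy := by unfold Rectangle.μy; infer_instance
instance : IsFiniteMeasure R.μxy := by unfold Rectangle.μxy; infer_instance

/-- The rectangle with the roles of `x` and `y` exchanged. -/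
@[reducible] def Rectangle.swap : Rectangle := ⟨R.c, R.d, R.a, R.b, R.hcd, R.hab⟩

theorem ae_μx : ∀ᵐ x ∂(R.μx), x ∈ Icc R.a R.b := ae_restrict_mem measurableSet_Icc
theorem ae_μy : ∀ᵐ x ∂(R.μy), x ∈ Icc R.c R.d := ae_restrict_mem measurableSet_Icc

theorem ae_μxy_fst {p : ℝ → Prop} (h : ∀ᵐ x ∂(R.μx), p x) : ∀ᵐ s ∂(R.μxy), p s.1 :=
  Measure.quasiMeasurePreserving_fst.ae h

theorem ae_μxy_snd {p : ℝ → Prop} (h : ∀ᵐ y ∂(R.μy), p y) : ∀ᵐ s ∂(R.μxy), p s.2 :=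
  Measure.quasiMeasurePreserving_snd.ae h

theorem ae_ae_of_ae {p : ℝ × ℝ → Prop} (h : ∀ᵐ s ∂(R.μxy), p s) :
    ∀ᵐ x ∂(R.μx), ∀ᵐ y ∂(R.μy), p (x, y) :=
  Measure.ae_ae_of_ae_prod h

theorem measurePreserving_swap : MeasurePreserving Prod.swap R.μxy R.swap.μxy :=
  Measure.measurePreserving_swap

theorem ae_swap {p : ℝ × ℝ → Prop} (h : ∀ᵐ s ∂(R.μxy), p s) : ∀ᵐ s ∂(R.swap.μxy), p s.swap :=
  (measurePreserving_swap R.swap).quasiMeasurePreserving.ae h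

theorem ae_ae_of_ae' {p : ℝ × ℝ → Prop} (h : ∀ᵐ s ∂(R.μxy), p s) :
    ∀ᵐ y ∂(R.μy), ∀ᵐ x ∂(R.μx), p (x, y) :=
  ae_ae_of_ae R.swap (ae_swap R h)

variable {E : Type*} [NormedAddCommGroup E]

theorem ae_eq_mono {α : Type*} [MeasurableSpace α] {μ : Measure α} {f g : α → E} (h : f =ᵐ[μ] g)
    (s : Set α) : f =ᵐ[μ.restrict s] g := ae_restrict_of_ae h

variable [NormedSpace ℝ E]

theorem integral_μx (f : ℝ → E) : ∫ x, f x ∂(R.μx) = ∫ x in R.a..R.b, f x := by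
  rw [intervalIntegral.integral_of_le R.hab.le, Rectangle.μx, integral_Icc_eq_integral_Ioc]

/-- Over a half-line the upper limit enters through an indicator function only. This form gives
measurability of primitives in `primX` and, via `integral_rect_eq`, their joint continuity in
`continuousOn_integral_rect`. -/
theorem integral_Iic_μx (f : ℝ → E) {x : ℝ} (hx : x ∈ Icc R.a R.b) :
    ∫ θ in Iic x, f θ ∂(R.μx) = ∫ θ in R.a..x, f θ := by
  rw [intervalIntegral.integral_of_le hx.1, Rectangle.μx, Measure.restrict_restrict measurableSet_Iic,
    ← integral_Icc_eq_integral_Ioc]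
  congr 2
  ext t
  simp only [mem_inter_iff, mem_Iic, mem_Icc]
  constructor
  · rintro ⟨h1, h2, h3⟩; exact ⟨h2, h1⟩
  · rintro ⟨h1, h2⟩; exact ⟨h2, h1, h2.trans hx.2⟩

theorem intervalIntegrable_of_μx {f : ℝ → E} (h : Integrable f R.μx) {x x' : ℝ}
    (hx : x ∈ Icc R.a R.b) (hx' : x' ∈ Icc R.a R.b) : IntervalIntegrable f volume x x' := by
  rw [intervalIntegrable_iff]
  exact IntegrableOn.mono_set (s := uIoc x x') (t := Icc R.a R.b) h
    (uIoc_subset_uIcc.trans (uIcc_subset_Icc hx hx'))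

theorem integrable_L2 {α : Type*} [MeasurableSpace α] {μ : Measure α} [IsFiniteMeasure μ]
    (f : Lp E 2 μ) : Integrable f μ := (Lp.memLp f).integrable (by norm_num)

end Rect

/-! ### Elementary operators -/

section Bricks

variable (R : Rectangle) {E : Type*} [NormedAddCommGroup E] [NormedSpace ℝ E]

/-- Exchange of the variables. -/
def swapL : Lp E 2 R.μxy →L[ℝ] Lp E 2 R.swap.μxy :=
  (Lp.compMeasurePreservingₗᵢ ℝ Prod.swap (measurePreserving_swap R.swap)).toContinuousLinearMap

theorem coeFn_swapL (u : Lp E 2 R.μxy) : swapL R u =ᵐ[R.swap.μxy] fun s => u s.swap :=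
  Lp.coeFn_compMeasurePreserving u (measurePreserving_swap R.swap)

@[simp] theorem swapL_swapL (u : Lp E 2 R.μxy) : swapL R.swap (swapL R u) = u := by
  refine Lp.ext ((coeFn_swapL R.swap _).trans ?_)
  filter_upwards [ae_swap R.swap (coeFn_swapL R u)] with s hs
  rw [hs, Prod.swap_swap]

/-- A function of `x` as a function of `x, y`. -/
def liftX : Lp E 2 R.μx →L[ℝ] Lp E 2 R.μxy :=
  liftL2 (fun f s => f s.1) ((R.μy univ ^ (1 / 2 : ℝ)).toNNReal)
    (fun f => (Lp.aestronglyMeasurable f).comp_fst)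
    (fun f => by
      rw [ENNReal.coe_toNNReal (ENNReal.rpow_ne_top_of_nonneg (by norm_num) (measure_ne_top _ _)),
        ← eLpNorm_comp_snd_le (κ := R.μy) (Lp.aestronglyMeasurable f)]
      exact ((eLpNorm_comp_measurePreserving (f := Prod.swap) (g := fun s : ℝ × ℝ => f s.2)
        (Lp.aestronglyMeasurable f).comp_snd (measurePreserving_swap R))).le)
    (fun f g => ae_μxy_fst R (Lp.coeFn_add f g))
    (fun c f => ae_μxy_fst R (Lp.coeFn_smul c f))

theorem coeFn_liftX (f : Lp E 2 R.μx) : liftX R f =ᵐ[R.μxy] fun s => f s.1 := coeFn_liftL2 f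

/-- The dominating function depends on `y` alone. One mass factor comes from spreading it over the
first variable, the other from Cauchy–Schwarz on the sections of `f`. -/
theorem eLpNorm_snd_bound {κ : Measure ℝ} [IsFiniteMeasure κ] (f : Lp E 2 R.μxy)
    {G : ℝ × ℝ → E} (h : ∀ s, ‖G s‖ₑ ≤ ∫⁻ θ, ‖f (θ, s.2)‖ₑ ∂(R.μx)) :
    eLpNorm G 2 (κ.prod R.μy) ≤
      ((κ univ ^ (1 / 2 : ℝ)).toNNReal * (R.μx univ ^ (1 / 2 : ℝ)).toNNReal : NNReal)
        * eLpNorm f 2 R.μxy := by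
  have hm : Measurable fun y => ∫⁻ θ, ‖f (θ, y)‖ₑ ∂(R.μx) :=
    Measurable.lintegral_prod_left (f := fun a b : ℝ => ‖f (a, b)‖ₑ)
      (Lp.stronglyMeasurable f).enorm
  rw [ENNReal.coe_mul,
    ENNReal.coe_toNNReal (ENNReal.rpow_ne_top_of_nonneg (by norm_num) (measure_ne_top _ _)),
    ENNReal.coe_toNNReal (ENNReal.rpow_ne_top_of_nonneg (by norm_num) (measure_ne_top _ _)),
    mul_assoc]
  refine le_trans ?_ (mul_le_mul_right
    (eLpNorm_lintegral_enorm_le (μ := R.μx) (ν := R.μy) (Lp.stronglyMeasurable f)) _)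
  rw [← eLpNorm_comp_snd_le hm.aestronglyMeasurable]
  exact eLpNorm_mono_enorm fun s => by simpa using h s

theorem ae_section_eq {f g : ℝ × ℝ → E} (h : f =ᵐ[R.μxy] g) :
    ∀ᵐ s ∂(R.μxy), (fun θ => f (θ, s.2)) =ᵐ[R.μx] fun θ => g (θ, s.2) :=
  ae_μxy_snd R (ae_ae_of_ae' R h)

theorem ae_section_integrable (f : Lp E 2 R.μxy) :
    ∀ᵐ y ∂(R.μy), Integrable (fun θ => f (θ, y)) R.μx :=
  (Integrable.prod_left_ae (integrable_L2 f))

theorem coeFn_section_add (f g : Lp E 2 R.μxy) : ∀ᵐ y ∂(R.μy),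
    (fun θ => (f + g : Lp E 2 R.μxy) (θ, y)) =ᵐ[R.μx] fun θ => f (θ, y) + g (θ, y) :=
  ae_ae_of_ae' R (Lp.coeFn_add f g)

theorem coeFn_section_smul (c : ℝ) (f : Lp E 2 R.μxy) : ∀ᵐ y ∂(R.μy),
    (fun θ => (c • f : Lp E 2 R.μxy) (θ, y)) =ᵐ[R.μx] fun θ => c • f (θ, y) :=
  ae_ae_of_ae' R (Lp.coeFn_smul c f)

/-- `∫_a^x f(θ, y) dθ`. -/
def primX : Lp E 2 R.μxy →L[ℝ] Lp E 2 R.μxy :=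
  liftL2 (fun f s => ∫ θ in Iic s.1, f (θ, s.2) ∂(R.μx))
    ((R.μx univ ^ (1 / 2 : ℝ)).toNNReal * (R.μx univ ^ (1 / 2 : ℝ)).toNNReal)
    (fun f => by
      -- The variable limit becomes the condition `θ ≤ x` in a jointly measurable integrand;
      -- integrating out `θ` keeps measurability in `(x, y)`.
      have h : StronglyMeasurable fun z : (ℝ × ℝ) × ℝ =>
          {z : (ℝ × ℝ) × ℝ | z.2 ≤ z.1.1}.indicator (fun z => f (z.2, z.1.2)) z :=
        ((Lp.stronglyMeasurable f).comp_measurable (by fun_prop)).indicator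
          (measurableSet_le (by fun_prop) (by fun_prop))
      refine (h.integral_prod_right' (ν := R.μx)).aestronglyMeasurable.congr ?_
      refine Filter.Eventually.of_forall fun s => ?_
      simp only [← integral_indicator measurableSet_Iic]
      rfl)
    (fun f => eLpNorm_snd_bound R f fun s =>
      (enorm_integral_le_lintegral_enorm _).trans (setLIntegral_le_lintegral _ _))
    (fun f g => by
      filter_upwards [ae_μxy_snd R (coeFn_section_add R f g),
        ae_μxy_snd R (ae_section_integrable R f), ae_μxy_snd R (ae_section_integrable R g)]
        with s hs hf hg
      rw [Pi.add_apply, ← integral_add hf.integrableOn hg.integrableOn]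
      exact integral_congr_ae (ae_eq_mono hs _))
    (fun c f => by
      filter_upwards [ae_μxy_snd R (coeFn_section_smul R c f)] with s hs
      rw [Pi.smul_apply, ← integral_smul]
      exact integral_congr_ae (ae_eq_mono hs _))

theorem coeFn_primX (f : Lp E 2 R.μxy) :
    primX R f =ᵐ[R.μxy] fun s => ∫ θ in R.a..s.1, f (θ, s.2) := by
  refine (coeFn_liftL2 f).trans ?_
  filter_upwards [ae_μxy_fst R (ae_μx R)] with s hs
  exact integral_Iic_μx R _ hs

/-- `∫_a^b f(θ, y) dθ`. -/
def intX : Lp E 2 R.μxy →L[ℝ] Lp E 2 R.μy :=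
  liftL2 (fun f y => ∫ θ, f (θ, y) ∂(R.μx)) ((R.μx univ ^ (1 / 2 : ℝ)).toNNReal)
    (fun f => ((Lp.stronglyMeasurable f).integral_prod_left').aestronglyMeasurable)
    (fun f => by
      rw [ENNReal.coe_toNNReal (ENNReal.rpow_ne_top_of_nonneg (by norm_num) (measure_ne_top _ _))]
      refine le_trans ?_
        (eLpNorm_lintegral_enorm_le (μ := R.μx) (ν := R.μy) (Lp.stronglyMeasurable f))
      exact eLpNorm_mono_enorm fun y => enorm_integral_le_lintegral_enorm _)
    (fun f g => by
      filter_upwards [coeFn_section_add R f g, ae_section_integrable R f,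
        ae_section_integrable R g] with s hs hf hg
      rw [Pi.add_apply, ← integral_add hf hg]
      exact integral_congr_ae hs)
    (fun c f => by
      filter_upwards [coeFn_section_smul R c f] with s hs
      rw [Pi.smul_apply, ← integral_smul]
      exact integral_congr_ae hs)

theorem coeFn_intX (f : Lp E 2 R.μxy) :
    intX R f =ᵐ[R.μy] fun y => ∫ θ in R.a..R.b, f (θ, y) := by
  refine (coeFn_liftL2 f).trans (Filter.Eventually.of_forall fun y => ?_)
  exact integral_μx R _

/-- Constant functions of `x`. -/
def constX : E →L[ℝ] Lp E 2 R.μx := Lp.constL 2 R.μx ℝ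

theorem coeFn_constX (w : E) : constX R w =ᵐ[R.μx] fun _ => w := Lp.coeFn_const 2 R.μx w

/-- A function of `y` as a function of `x, y`. -/
def liftY : Lp E 2 R.μy →L[ℝ] Lp E 2 R.μxy := swapL R.swap ∘L liftX R.swap

/-- `∫_c^y f(x, ν) dν`. -/
def primY : Lp E 2 R.μxy →L[ℝ] Lp E 2 R.μxy := swapL R.swap ∘L primX R.swap ∘L swapL R

/-- `∫_c^d f(x, ν) dν`. -/
def intY : Lp E 2 R.μxy →L[ℝ] Lp E 2 R.μx := intX R.swap ∘L swapL R

/-- Constant functions of `y`. -/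
def constY : E →L[ℝ] Lp E 2 R.μy := constX R.swap

theorem coeFn_constY (w : E) : constY R w =ᵐ[R.μy] fun _ => w := coeFn_constX R.swap w

theorem coeFn_liftY (f : Lp E 2 R.μy) : liftY R f =ᵐ[R.μxy] fun s => f s.2 :=
  (coeFn_swapL R.swap _).trans (ae_swap R.swap (coeFn_liftX R.swap f))

theorem coeFn_primY (f : Lp E 2 R.μxy) :
    primY R f =ᵐ[R.μxy] fun s => ∫ ν in R.c..s.2, f (s.1, ν) := by
  refine (coeFn_swapL R.swap _).trans ?_
  filter_upwards [ae_swap R.swap (coeFn_primX R.swap (swapL R f)), ae_μxy_snd R (ae_μy R),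
    ae_swap R.swap (ae_section_eq R.swap (coeFn_swapL R f))] with s hs h2 h3
  refine hs.trans ?_
  refine intervalIntegral.integral_congr_ae_restrict ?_
  refine ae_mono (Measure.restrict_mono ?_ le_rfl) h3
  exact uIoc_subset_uIcc.trans (uIcc_subset_Icc (left_mem_Icc.2 R.hcd.le) h2)

theorem coeFn_intY (f : Lp E 2 R.μxy) :
    intY R f =ᵐ[R.μx] fun x => ∫ ν in R.c..R.d, f (x, ν) := by
  refine (coeFn_intX R.swap _).trans ?_
  filter_upwards [ae_ae_of_ae' R.swap (coeFn_swapL R f)] with s hs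
  refine intervalIntegral.integral_congr_ae_restrict ?_
  refine ae_mono (Measure.restrict_mono ?_ le_rfl) hs
  exact uIoc_subset_uIcc.trans (uIcc_of_le R.hcd.le).subset

end Bricks

/-! ### Weighted integrals as bounded functionals -/

section WInt

variable {α : Type*} [MeasurableSpace α] {E : Type*} [NormedAddCommGroup E] [NormedSpace ℝ E]

theorem integrable_smul_L2 {μ : Measure α} [IsFiniteMeasure μ] {ψ : α → ℝ} {C : ℝ}
    (hm : AEStronglyMeasurable ψ μ) (hC : ∀ x, |ψ x| ≤ C) (f : Lp E 2 μ) :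
    Integrable (fun x => ψ x • f x) μ :=
  (integrable_L2 f).bdd_smul C hm (Filter.Eventually.of_forall hC)

/-- The functional `f ↦ ∫ ψ f` on `L₂` with a bounded weight `ψ`. -/
def weightInt (μ : Measure α) [IsFiniteMeasure μ] (ψ : α → ℝ) (C : ℝ)
    (hm : AEStronglyMeasurable ψ μ) (hC : ∀ x, |ψ x| ≤ C) : Lp E 2 μ →L[ℝ] E :=
  LinearMap.mkContinuous
    { toFun := fun f => ∫ x, ψ x • f x ∂μ
      map_add' := fun f g => by
        rw [← integral_add (integrable_smul_L2 hm hC f) (integrable_smul_L2 hm hC g)]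
        refine integral_congr_ae ?_
        filter_upwards [Lp.coeFn_add f g] with x hx
        rw [hx, Pi.add_apply, smul_add]
      map_smul' := fun c f => by
        rw [RingHom.id_apply, ← integral_smul]
        refine integral_congr_ae ?_
        filter_upwards [Lp.coeFn_smul c f] with x hx
        rw [hx, Pi.smul_apply, smul_comm] }
    (C * (μ univ ^ (1 / 2 : ℝ)).toReal) fun f => by
      simp only [LinearMap.coe_mk, AddHom.coe_mk]
      have h1 : ∫ x, ‖f x‖ ∂μ ≤ (μ univ ^ (1 / 2 : ℝ)).toReal * ‖f‖ := by
        rw [integral_norm_eq_lintegral_enorm (Lp.aestronglyMeasurable f), Lp.norm_def,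
          ← ENNReal.toReal_mul, ← eLpNorm_one_eq_lintegral_enorm]
        have h := eLpNorm_le_eLpNorm_mul_rpow_measure_univ (μ := μ) (p := 1) (q := 2)
          (f := f) (by norm_num) (Lp.aestronglyMeasurable f)
        refine ENNReal.toReal_mono (ENNReal.mul_ne_top (ENNReal.rpow_ne_top_of_nonneg
          (by norm_num) (measure_ne_top _ _)) (Lp.eLpNorm_ne_top f)) (h.trans_eq ?_)
        norm_num [mul_comm]
      -- Nonnegativity of `C` is read off from `|ψ x₀| ≤ C` at some point, so the empty space is
      -- treated apart.
      rcases isEmpty_or_nonempty α with hα | ⟨⟨x₀⟩⟩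
      · simp [Measure.eq_zero_of_isEmpty μ]
      have hC0 : 0 ≤ C := (abs_nonneg _).trans (hC x₀)
      calc ‖∫ x, ψ x • f x ∂μ‖ ≤ ∫ x, C * ‖f x‖ ∂μ :=
            norm_integral_le_of_norm_le ((integrable_L2 f).norm.const_mul C)
              (Filter.Eventually.of_forall fun x => by
                rw [norm_smul]
                exact mul_le_mul_of_nonneg_right (hC x) (norm_nonneg _))
        _ = C * ∫ x, ‖f x‖ ∂μ := integral_const_mul _ _
        _ ≤ _ := by rw [mul_assoc]; exact mul_le_mul_of_nonneg_left h1 hC0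

theorem weightInt_apply {μ : Measure α} [IsFiniteMeasure μ] {ψ : α → ℝ} {C : ℝ}
    {hm : AEStronglyMeasurable ψ μ} {hC : ∀ x, |ψ x| ≤ C} (f : Lp E 2 μ) :
    weightInt μ ψ C hm hC f = ∫ x, ψ x • f x ∂μ := rfl

end WInt

/-! ### Primitives on edges, and commutation relations of the elementary operators -/

section Bricks

variable (R : Rectangle) {E : Type*} [NormedAddCommGroup E] [NormedSpace ℝ E]

theorem intervalIntegral_congr_μx {f g : ℝ → E} (h : f =ᵐ[R.μx] g) {x x' : ℝ}
    (hx : x ∈ Icc R.a R.b) (hx' : x' ∈ Icc R.a R.b) :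
    ∫ θ in x..x', f θ = ∫ θ in x..x', g θ := by
  refine intervalIntegral.integral_congr_ae_restrict (ae_mono (Measure.restrict_mono ?_ le_rfl) h)
  exact uIoc_subset_uIcc.trans (uIcc_subset_Icc hx hx')

theorem left_mem_x : R.a ∈ Icc R.a R.b := left_mem_Icc.2 R.hab.le
theorem right_mem_x : R.b ∈ Icc R.a R.b := right_mem_Icc.2 R.hab.le
theorem left_mem_y : R.c ∈ Icc R.c R.d := left_mem_Icc.2 R.hcd.le
theorem right_mem_y : R.d ∈ Icc R.c R.d := right_mem_Icc.2 R.hcd.le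

theorem primX_ae {f : Lp E 2 R.μxy} {F : ℝ × ℝ → E} (h : f =ᵐ[R.μxy] F) :
    primX R f =ᵐ[R.μxy] fun s => ∫ θ in R.a..s.1, F (θ, s.2) := by
  filter_upwards [coeFn_primX R f, ae_section_eq R h, ae_μxy_fst R (ae_μx R)] with s h1 h2 h3
  rw [h1]
  exact intervalIntegral_congr_μx R h2 (left_mem_x R) h3

theorem ae_section_eq' {f g : ℝ × ℝ → E} (h : f =ᵐ[R.μxy] g) :
    ∀ᵐ s ∂(R.μxy), (fun ν => f (s.1, ν)) =ᵐ[R.μy] fun ν => g (s.1, ν) :=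
  ae_μxy_fst R (ae_ae_of_ae R h)

theorem primY_ae {f : Lp E 2 R.μxy} {F : ℝ × ℝ → E} (h : f =ᵐ[R.μxy] F) :
    primY R f =ᵐ[R.μxy] fun s => ∫ ν in R.c..s.2, F (s.1, ν) := by
  filter_upwards [coeFn_primY R f, ae_section_eq' R h, ae_μxy_snd R (ae_μy R)] with s h1 h2 h3
  rw [h1]
  exact intervalIntegral_congr_μx R.swap h2 (left_mem_y R) h3

theorem intX_ae {f : Lp E 2 R.μxy} {F : ℝ × ℝ → E} (h : f =ᵐ[R.μxy] F) :
    intX R f =ᵐ[R.μy] fun y => ∫ θ in R.a..R.b, F (θ, y) := by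
  filter_upwards [coeFn_intX R f, ae_ae_of_ae' R h] with s h1 h2
  rw [h1]
  exact intervalIntegral_congr_μx R h2 (left_mem_x R) (right_mem_x R)

theorem intY_ae {f : Lp E 2 R.μxy} {F : ℝ × ℝ → E} (h : f =ᵐ[R.μxy] F) :
    intY R f =ᵐ[R.μx] fun x => ∫ ν in R.c..R.d, F (x, ν) := by
  filter_upwards [coeFn_intY R f, ae_ae_of_ae R h] with s h1 h2
  rw [h1]
  exact intervalIntegral_congr_μx R.swap h2 (left_mem_y R) (right_mem_y R)

theorem liftX_ae {f : Lp E 2 R.μx} {F : ℝ → E} (h : f =ᵐ[R.μx] F) :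
    liftX R f =ᵐ[R.μxy] fun s => F s.1 :=
  (coeFn_liftX R f).trans (ae_μxy_fst R h)

theorem liftY_ae {f : Lp E 2 R.μy} {F : ℝ → E} (h : f =ᵐ[R.μy] F) :
    liftY R f =ᵐ[R.μxy] fun s => F s.2 :=
  (coeFn_liftY R f).trans (ae_μxy_snd R h)

/-- `∫_a^x f(θ) dθ` for functions of `x`. -/
def edgePrimX : Lp E 2 R.μx →L[ℝ] Lp E 2 R.μx :=
  -- Extend constantly in `y`, take the primitive in `x`, average over `y`: boundedness is inherited
  -- and needs no new estimate.
  (R.d - R.c)⁻¹ • (intY R ∘L primX R ∘L liftX R)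

/-- `∫_c^y f(ν) dν` for functions of `y`. -/
def edgePrimY : Lp E 2 R.μy →L[ℝ] Lp E 2 R.μy := edgePrimX R.swap

theorem edgePrimX_ae [CompleteSpace E] {f : Lp E 2 R.μx} {F : ℝ → E} (h : f =ᵐ[R.μx] F) :
    edgePrimX R f =ᵐ[R.μx] fun x => ∫ θ in R.a..x, F θ := by
  refine (Lp.coeFn_smul _ _).trans ?_
  filter_upwards [intY_ae R (primX_ae R (liftX_ae R h))] with x hx
  rw [Pi.smul_apply]
  refine (congrArg _ hx).trans ?_
  have : R.d - R.c ≠ 0 := (sub_pos.2 R.hcd).ne'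
  simp [smul_smul, this]

theorem edgePrimY_ae [CompleteSpace E] {f : Lp E 2 R.μy} {F : ℝ → E} (h : f =ᵐ[R.μy] F) :
    edgePrimY R f =ᵐ[R.μy] fun y => ∫ ν in R.c..y, F ν :=
  edgePrimX_ae R.swap h

/-- `∫_a^b f`. -/
def totX : Lp E 2 R.μx →L[ℝ] E :=
  weightInt R.μx (fun _ => 1) 1 aestronglyMeasurable_const (by simp)

/-- `∫_c^d f`. -/
def totY : Lp E 2 R.μy →L[ℝ] E := totX R.swap

theorem totX_ae {f : Lp E 2 R.μx} {F : ℝ → E} (h : f =ᵐ[R.μx] F) :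
    totX R f = ∫ x in R.a..R.b, F x := by
  rw [← integral_μx]
  refine weightInt_apply (μ := R.μx) f |>.trans (integral_congr_ae ?_)
  simpa using h

theorem totY_ae {f : Lp E 2 R.μy} {F : ℝ → E} (h : f =ᵐ[R.μy] F) :
    totY R f = ∫ y in R.c..R.d, F y := totX_ae R.swap h

theorem primX_liftX [CompleteSpace E] (f : Lp E 2 R.μx) :
    primX R (liftX R f) = liftX R (edgePrimX R f) :=
  Lp.ext ((primX_ae R (coeFn_liftX R f)).trans
    (liftX_ae R (edgePrimX_ae R (Filter.EventuallyEq.refl _ _))).symm)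

theorem primY_liftY [CompleteSpace E] (f : Lp E 2 R.μy) :
    primY R (liftY R f) = liftY R (edgePrimY R f) :=
  Lp.ext ((primY_ae R (coeFn_liftY R f)).trans
    (liftY_ae R (edgePrimY_ae R (Filter.EventuallyEq.refl _ _))).symm)

theorem liftX_constX (w : E) : liftX R (constX R w) = liftY R (constY R w) :=
  Lp.ext ((liftX_ae R (coeFn_constX R w)).trans (liftY_ae R (coeFn_constY R w)).symm)

theorem integral_rect_swap {f : ℝ × ℝ → E} (hf : Integrable f R.μxy) {x y : ℝ}
    (hx : x ∈ Icc R.a R.b) (hy : y ∈ Icc R.c R.d) :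
    ∫ θ in R.a..x, ∫ ν in R.c..y, f (θ, ν) = ∫ ν in R.c..y, ∫ θ in R.a..x, f (θ, ν) := by
  rw [intervalIntegral.integral_of_le hx.1, intervalIntegral.integral_of_le hy.1]
  simp only [intervalIntegral.integral_of_le hx.1, intervalIntegral.integral_of_le hy.1]
  refine integral_integral_swap (f := fun a b => f (a, b)) (hf.mono_measure ?_)
  exact Measure.prod_mono (Measure.restrict_mono (Ioc_subset_Icc_self.trans
    (Icc_subset_Icc_right hx.2)) le_rfl) (Measure.restrict_mono (Ioc_subset_Icc_self.trans
    (Icc_subset_Icc_right hy.2)) le_rfl)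

/-- Fubini in operator form; through it the two orders of reconstruction agree in `jetV_succ_right`.
-/
theorem primX_primY (f : Lp E 2 R.μxy) : primX R (primY R f) = primY R (primX R f) := by
  refine Lp.ext ((primX_ae R (coeFn_primY R f)).trans
    (.trans ?_ (primY_ae R (coeFn_primX R f)).symm))
  filter_upwards [ae_μxy_fst R (ae_μx R), ae_μxy_snd R (ae_μy R)] with s h1 h2
  exact integral_rect_swap R (integrable_L2 f) h1 h2

theorem intY_liftX [CompleteSpace E] (f : Lp E 2 R.μx) :
    intY R (liftX R f) = (R.d - R.c) • f := by
  refine Lp.ext ((intY_ae R (coeFn_liftX R f)).trans (.trans ?_ (Lp.coeFn_smul _ _).symm))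
  exact Filter.Eventually.of_forall fun x => by simp

theorem intX_liftY [CompleteSpace E] (f : Lp E 2 R.μy) :
    intX R (liftY R f) = (R.b - R.a) • f := by
  refine Lp.ext ((intX_ae R (coeFn_liftY R f)).trans (.trans ?_ (Lp.coeFn_smul _ _).symm))
  exact Filter.Eventually.of_forall fun x => by simp

theorem intY_liftY (f : Lp E 2 R.μy) : intY R (liftY R f) = constX R (totY R f) := by
  refine Lp.ext ((intY_ae R (coeFn_liftY R f)).trans (.trans ?_ (coeFn_constX R _).symm))
  exact Filter.Eventually.of_forall fun x => (totY_ae R (Filter.EventuallyEq.refl _ _)).symm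

theorem liftY_injective [CompleteSpace E] {f g : Lp E 2 R.μy} (h : liftY R f = liftY R g) :
    f = g := by
  have := congrArg (intX R) h
  rw [intX_liftY, intX_liftY] at this
  exact smul_right_injective _ (sub_pos.2 R.hab).ne' this

/-- A function that depends on `x` only and on `y` only is constant. -/
theorem exists_const_of_liftX_eq_liftY [CompleteSpace E] {f : Lp E 2 R.μx} {g : Lp E 2 R.μy}
    (h : liftX R f = liftY R g) : ∃ w, f = constX R w ∧ g = constY R w := by
  -- Integration over `y` returns `f` up to the factor `d - c` on one side and a constant on the
  -- other.
  have h1 := congrArg (intY R) h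
  rw [intY_liftX, intY_liftY] at h1
  have h2 : f = constX R ((R.d - R.c)⁻¹ • totY R g) := by
    rw [map_smul, ← h1, smul_smul, inv_mul_cancel₀ (sub_pos.2 R.hcd).ne', one_smul]
  refine ⟨_, h2, liftY_injective R ?_⟩
  rw [← h, ← liftX_constX, ← h2]

theorem intY_primX [CompleteSpace E] (f : Lp E 2 R.μxy) :
    intY R (primX R f) = edgePrimX R (intY R f) := by
  refine Lp.ext ((intY_ae R (coeFn_primX R f)).trans
    (.trans ?_ (edgePrimX_ae R (coeFn_intY R f)).symm))
  filter_upwards [ae_μx R] with x hx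
  exact (integral_rect_swap R (integrable_L2 f) hx (right_mem_y R)).symm

end Bricks

/-! ### Test functions -/

/-- The derivative of `φ` in the direction `v`. -/
def dirD (v : ℝ × ℝ) (φ : ℝ × ℝ → ℝ) (s : ℝ × ℝ) : ℝ := fderiv ℝ φ s v

theorem contDiff_dirD {φ : ℝ × ℝ → ℝ} (h : ContDiff ℝ ∞ φ) (v : ℝ × ℝ) :
    ContDiff ℝ ∞ (dirD v φ) :=
  (h.fderiv_right (m := ∞) (by norm_cast)).clm_apply contDiff_const

theorem contDiff_dirD_iterate {φ : ℝ × ℝ → ℝ} (h : ContDiff ℝ ∞ φ) (v : ℝ × ℝ) (n : ℕ) :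
    ContDiff ℝ ∞ ((dirD v)^[n] φ) := by
  induction n with
  | zero => exact h
  | succ n ih => rw [Function.iterate_succ_apply']; exact contDiff_dirD ih v

/-- Both sides are values of the second Fréchet derivative, which is symmetric. -/
theorem dirD_comm {φ : ℝ × ℝ → ℝ} (h : ContDiff ℝ ∞ φ) (v w : ℝ × ℝ) :
    dirD v (dirD w φ) = dirD w (dirD v φ) := by
  have h1 : ∀ v : ℝ × ℝ, ∀ s, ∀ w : ℝ × ℝ,
      dirD w (dirD v φ) s = fderiv ℝ (fderiv ℝ φ) s w v := by
    intro v s w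
    have hd : DifferentiableAt ℝ (fderiv ℝ φ) s :=
      (h.fderiv_right (m := ∞) (by norm_cast)).differentiable (by simp) s
    have := hd.hasFDerivAt.clm_apply (hasFDerivAt_const v s)
    unfold dirD
    rw [this.fderiv]
    simp
  funext s
  rw [h1, h1]
  exact (h.contDiffAt.isSymmSndFDerivAt (by simp; norm_cast)) v w

theorem dirD_iterate_comm {φ : ℝ × ℝ → ℝ} (h : ContDiff ℝ ∞ φ) (v w : ℝ × ℝ) (m n : ℕ) :
    (dirD v)^[m] ((dirD w)^[n] φ) = (dirD w)^[n] ((dirD v)^[m] φ) := by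
  have h1 : ∀ (n : ℕ) (φ : ℝ × ℝ → ℝ), ContDiff ℝ ∞ φ →
      dirD v ((dirD w)^[n] φ) = (dirD w)^[n] (dirD v φ) := by
    intro n
    induction n with
    | zero => intro φ _; rfl
    | succ n ih =>
      intro φ h
      rw [Function.iterate_succ_apply, ih _ (contDiff_dirD h w), dirD_comm h,
        Function.iterate_succ_apply]
  induction m with
  | zero => rfl
  | succ m ih =>
    rw [Function.iterate_succ_apply', ih, h1 _ _ (contDiff_dirD_iterate h v m),
      Function.iterate_succ_apply']

theorem deriv_snd_eq_dirD {φ : ℝ × ℝ → ℝ} (h : ContDiff ℝ ∞ φ) (x y : ℝ) :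
    deriv (fun y => φ (x, y)) y = dirD (0, 1) φ (x, y) := by
  have hd : DifferentiableAt ℝ φ (x, y) := h.differentiable (by simp) _
  exact (hd.hasFDerivAt.comp_hasDerivAt y
    ((hasDerivAt_const y x).prodMk (hasDerivAt_id y))).deriv

theorem deriv_fst_eq_dirD {φ : ℝ × ℝ → ℝ} (h : ContDiff ℝ ∞ φ) (x y : ℝ) :
    deriv (fun x => φ (x, y)) x = dirD (1, 0) φ (x, y) := by
  have hd : DifferentiableAt ℝ φ (x, y) := h.differentiable (by simp) _
  exact (hd.hasFDerivAt.comp_hasDerivAt x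
    ((hasDerivAt_id x).prodMk (hasDerivAt_const x y))).deriv

/-- Expresses iterated one-variable derivatives through iterates of two operators that commute on
smooth functions, so that composition of derivatives and exchange of the variables become algebra.
-/
theorem pd_eq_dirD {φ : ℝ × ℝ → ℝ} (h : ContDiff ℝ ∞ φ) (i j : ℕ) :
    pd i j φ = (dirD (1, 0))^[i] ((dirD (0, 1))^[j] φ) := by
  have hy : ∀ (j : ℕ) (φ : ℝ × ℝ → ℝ), ContDiff ℝ ∞ φ → ∀ x y,
      iteratedDeriv j (fun y => φ (x, y)) y = (dirD (0, 1))^[j] φ (x, y) := by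
    intro j
    induction j with
    | zero => intro φ _ x y; simp
    | succ j ih =>
      intro φ h x y
      rw [iteratedDeriv_succ', Function.iterate_succ_apply, ← ih _ (contDiff_dirD h _)]
      congr 1
      funext y
      exact deriv_snd_eq_dirD h x y
  have hx : ∀ (j : ℕ) (φ : ℝ × ℝ → ℝ), ContDiff ℝ ∞ φ → ∀ x y,
      iteratedDeriv j (fun x => φ (x, y)) x = (dirD (1, 0))^[j] φ (x, y) := by
    intro j
    induction j with
    | zero => intro φ _ x y; simp
    | succ j ih =>
      intro φ h x y
      rw [iteratedDeriv_succ', Function.iterate_succ_apply, ← ih _ (contDiff_dirD h _)]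
      congr 1
      funext x
      exact deriv_fst_eq_dirD h x y
  funext s
  rw [← hx _ _ (contDiff_dirD_iterate h _ j)]
  simp only [pd, hy j φ h]

/-- Additivity of orders on test functions is what allows weak derivatives to be composed
(`IsWeakDeriv.comp`) and cancelled (`IsWeakDeriv.of_comp`). -/
theorem pd_pd {φ : ℝ × ℝ → ℝ} (h : ContDiff ℝ ∞ φ) (i j k l : ℕ) :
    pd i j (pd k l φ) = pd (i + k) (j + l) φ := by
  have h1 : ContDiff ℝ ∞ (pd k l φ) := by
    rw [pd_eq_dirD h]
    exact contDiff_dirD_iterate (contDiff_dirD_iterate h _ _) _ _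
  rw [pd_eq_dirD h1, pd_eq_dirD h, pd_eq_dirD h, dirD_iterate_comm (contDiff_dirD_iterate h _ _),
    ← Function.iterate_add_apply, ← Function.iterate_add_apply]

/-- Test functions on the open rectangle. -/
structure IsTest (R : Rectangle) (φ : ℝ × ℝ → ℝ) : Prop where
  smooth : ContDiff ℝ ∞ φ
  cpt : HasCompactSupport φ
  supp : tsupport φ ⊆ Ioo R.a R.b ×ˢ Ioo R.c R.d

theorem IsTest.dirD {R : Rectangle} {φ : ℝ × ℝ → ℝ} (h : IsTest R φ) (v : ℝ × ℝ) :
    IsTest R (dirD v φ) := by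
  have hs : tsupport (PIE.dirD v φ) ⊆ tsupport φ := by
    refine (closure_mono ?_).trans (tsupport_fderiv_subset ℝ)
    intro s hs h0
    exact hs (by simp [PIE.dirD, h0])
  exact ⟨contDiff_dirD h.smooth v, h.cpt.of_isClosed_subset (isClosed_tsupport _) hs,
    hs.trans h.supp⟩

theorem IsTest.pd {R : Rectangle} {φ : ℝ × ℝ → ℝ} (h : IsTest R φ) (i j : ℕ) :
    IsTest R (pd i j φ) := by
  rw [pd_eq_dirD h.smooth]
  have : ∀ (v : ℝ × ℝ) (n : ℕ) (φ : ℝ × ℝ → ℝ), IsTest R φ → IsTest R ((PIE.dirD v)^[n] φ) := by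
    intro v n
    induction n with
    | zero => exact fun φ h => h
    | succ n ih => intro φ h; rw [Function.iterate_succ_apply]; exact ih _ (h.dirD v)
  exact this _ _ _ (this _ _ _ h)

theorem IsTest.exists_bound {R : Rectangle} {φ : ℝ × ℝ → ℝ} (h : IsTest R φ) :
    ∃ C, ∀ s, |φ s| ≤ C :=
  h.cpt.exists_bound_of_continuous h.smooth.continuous

/-- Integration against a test function. -/
def testInt (R : Rectangle) {E : Type*} [NormedAddCommGroup E] [NormedSpace ℝ E]
    {φ : ℝ × ℝ → ℝ} (h : IsTest R φ) : Lp E 2 R.μxy →L[ℝ] E :=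
  weightInt R.μxy φ h.exists_bound.choose h.smooth.continuous.aestronglyMeasurable
    h.exists_bound.choose_spec

theorem testInt_apply {R : Rectangle} {E : Type*} [NormedAddCommGroup E] [NormedSpace ℝ E]
    {φ : ℝ × ℝ → ℝ} (h : IsTest R φ) (u : Lp E 2 R.μxy) :
    testInt R h u = ∫ s, φ s • u s ∂(R.μxy) := rfl

/-! ### Weak derivatives -/

section Weak

variable {R : Rectangle} {ι κ : Type} [Fintype ι] [Fintype κ] {i j k l : ℕ}

/-- Recasts the definition as an equation between continuous linear maps of `u` and `v`; linearity
in `(u, v)` and closedness of the graph become immediate. -/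
theorem isWeakDeriv_iff {u v : L2xy R ι} : IsWeakDeriv R i j u v ↔
    ∀ (φ : ℝ × ℝ → ℝ) (h : IsTest R φ),
      testInt R (h.pd i j) u = (-1 : ℝ) ^ (i + j) • testInt R h v :=
  ⟨fun H φ h => H φ h.smooth h.cpt h.supp, fun H φ h1 h2 h3 => H φ ⟨h1, h2, h3⟩⟩

theorem IsWeakDeriv.add {u v u' v' : L2xy R ι} (h : IsWeakDeriv R i j u v)
    (h' : IsWeakDeriv R i j u' v') : IsWeakDeriv R i j (u + u') (v + v') := by
  rw [isWeakDeriv_iff] at *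
  intro φ hφ
  rw [map_add, map_add, h φ hφ, h' φ hφ, smul_add]

theorem IsWeakDeriv.smul {u v : L2xy R ι} (c : ℝ) (h : IsWeakDeriv R i j u v) :
    IsWeakDeriv R i j (c • u) (c • v) := by
  rw [isWeakDeriv_iff] at *
  intro φ hφ
  rw [map_smul, map_smul, h φ hφ, smul_comm]

theorem IsWeakDeriv.sub {u v u' v' : L2xy R ι} (h : IsWeakDeriv R i j u v)
    (h' : IsWeakDeriv R i j u' v') : IsWeakDeriv R i j (u - u') (v - v') := by
  rw [isWeakDeriv_iff] at *
  intro φ hφ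
  rw [map_sub, map_sub, h φ hφ, h' φ hφ, smul_sub]

theorem isWeakDeriv_refl (u : L2xy R ι) : IsWeakDeriv R 0 0 u u := by
  intro φ _ _ _
  simp [pd]

/-- Derivatives of a test function are test functions, so the first identity may be tested against
`∂ₓᵏ∂_yˡφ`. -/
theorem IsWeakDeriv.comp {u v w : L2xy R ι} (h : IsWeakDeriv R i j u v)
    (h' : IsWeakDeriv R k l v w) : IsWeakDeriv R (i + k) (j + l) u w := by
  intro φ h1 h2 h3
  have hφ : IsTest R φ := ⟨h1, h2, h3⟩
  rw [← pd_pd h1]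
  refine (isWeakDeriv_iff.1 h _ (hφ.pd k l)).trans ?_
  rw [isWeakDeriv_iff.1 h' _ hφ, smul_smul, ← pow_add, testInt_apply]
  congr 2
  omega

/-- If `∂ₓⁱ ∂_yʲ u = v` and `∂ₓⁱ⁺ᵏ ∂_yʲ⁺ˡ u = w`, then `∂ₓᵏ ∂_yˡ v = w`. -/
theorem IsWeakDeriv.of_comp {u v w : L2xy R ι} (h : IsWeakDeriv R i j u v)
    (h' : IsWeakDeriv R (i + k) (j + l) u w) : IsWeakDeriv R k l v w := by
  intro φ h1 h2 h3
  have hφ : IsTest R φ := ⟨h1, h2, h3⟩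
  have e1 := isWeakDeriv_iff.1 h _ (hφ.pd k l)
  have e2 := h' φ h1 h2 h3
  rw [← pd_pd h1] at e2
  rw [testInt_apply, testInt_apply, e2] at e1
  -- The sign is its own inverse, so the one produced by `∂ₓⁱ∂_yʲ` can be carried to the other side.
  have e3 : ((-1 : ℝ) ^ (i + j)) * (-1 : ℝ) ^ (i + j) = 1 := by
    rw [← mul_pow]; simp
  calc _ = ((-1 : ℝ) ^ (i + j)) • ((-1 : ℝ) ^ (i + j)) • ∫ s, pd k l φ s • v s ∂(R.μxy) := by
        rw [smul_smul, e3, one_smul]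
    _ = _ := by
        rw [← e1, smul_smul, ← pow_add]
        congr 1
        rw [show i + j + (i + k + (j + l)) = (i + j) + (i + j) + (k + l) by omega, pow_add, pow_add,
          e3, one_mul]

theorem ae_mem_Ioo_μxy (R : Rectangle) : ∀ᵐ s ∂(R.μxy), s ∈ Ioo R.a R.b ×ˢ Ioo R.c R.d := by
  have hx : ∀ᵐ x ∂(R.μx), x ∈ Ioo R.a R.b := by
    rw [Rectangle.μx, ← restrict_Ioo_eq_restrict_Icc]
    exact ae_restrict_mem measurableSet_Ioo
  have hy : ∀ᵐ x ∂(R.μy), x ∈ Ioo R.c R.d := by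
    rw [Rectangle.μy, ← restrict_Ioo_eq_restrict_Icc]
    exact ae_restrict_mem measurableSet_Ioo
  filter_upwards [ae_μxy_fst R hx, ae_μxy_snd R hy] with s h1 h2
  exact ⟨h1, h2⟩

/-- The fundamental lemma of the calculus of variations on the open rectangle; the boundary left out
is a null set. -/
theorem eq_zero_of_testInt {E : Type*} [NormedAddCommGroup E] [NormedSpace ℝ E] [CompleteSpace E]
    {u : Lp E 2 R.μxy} (h : ∀ (φ : ℝ × ℝ → ℝ) (hφ : IsTest R φ), testInt R hφ u = 0) : u = 0 := by
  have h0 := (isOpen_Ioo.prod isOpen_Ioo).ae_eq_zero_of_integral_contDiff_smul_eq_zero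
    (μ := R.μxy) (f := u) (U := Ioo R.a R.b ×ˢ Ioo R.c R.d)
    ((integrable_L2 u).locallyIntegrable.locallyIntegrableOn _)
    fun φ h1 h2 h3 => h φ ⟨h1, h2, h3⟩
  refine (Lp.eq_zero_iff_ae_eq_zero).2 ?_
  filter_upwards [h0, ae_mem_Ioo_μxy R] with s h1 h2
  exact h1 h2

theorem IsWeakDeriv.unique {u v v' : L2xy R ι} (h : IsWeakDeriv R i j u v)
    (h' : IsWeakDeriv R i j u v') : v = v' := by
  rw [← sub_eq_zero]
  refine eq_zero_of_testInt fun φ hφ => ?_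
  have e1 := isWeakDeriv_iff.1 h φ hφ
  rw [isWeakDeriv_iff.1 h' φ hφ] at e1
  rw [map_sub, sub_eq_zero]
  exact (smul_right_injective _ (pow_ne_zero _ (by norm_num : (-1 : ℝ) ≠ 0)) e1).symm

/-- Uniqueness identifies the arbitrarily chosen `weakDeriv` with any derivative at hand. -/
theorem IsWeakDeriv.weakDeriv_eq {u v : L2xy R ι} (h : IsWeakDeriv R i j u v) :
    weakDeriv R i j u = v := by
  have hex : ∃ v, IsWeakDeriv R i j u v := ⟨v, h⟩
  rw [weakDeriv, dif_pos hex]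
  exact hex.choose_spec.unique h

theorem coeFn_matOp {α : Type} [MeasurableSpace α] (μ : Measure α) [DecidableEq ι]
    (A : Matrix κ ι ℝ) (f : Lp (EuclideanSpace ℝ ι) 2 μ) :
    matOp μ A f =ᵐ[μ] fun s => mv A (f s) :=
  ContinuousLinearMap.coeFn_compLpL _ f

theorem IsWeakDeriv.matOp [DecidableEq ι] {u v : L2xy R ι} (A : Matrix κ ι ℝ)
    (h : IsWeakDeriv R i j u v) : IsWeakDeriv R i j (matOp R.μxy A u) (matOp R.μxy A v) := by
  -- A constant matrix is a continuous linear map and so passes through the test integral.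
  have key : ∀ (φ : ℝ × ℝ → ℝ) (hφ : IsTest R φ) (u : L2xy R ι),
      testInt R hφ (PIE.matOp R.μxy A u)
        = (LinearMap.toContinuousLinearMap (Matrix.toEuclideanLin A)) (testInt R hφ u) := by
    intro φ hφ u
    rw [testInt_apply, testInt_apply, ← ContinuousLinearMap.integral_comp_comm]
    · refine integral_congr_ae ?_
      filter_upwards [coeFn_matOp R.μxy A u] with s hs
      rw [hs, map_smul]
      rfl
    · obtain ⟨C, hC⟩ := hφ.exists_bound
      exact integrable_smul_L2 hφ.smooth.continuous.aestronglyMeasurable hC u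
  rw [isWeakDeriv_iff] at *
  intro φ hφ
  rw [key, key, h φ hφ, map_smul]

/-- The graph of a weak derivative is closed. -/
theorem isWeakDeriv_of_tendsto {u v : ℕ → L2xy R ι} {u₀ v₀ : L2xy R ι}
    (h : ∀ n, IsWeakDeriv R i j (u n) (v n)) (hu : Filter.Tendsto u Filter.atTop (nhds u₀))
    (hv : Filter.Tendsto v Filter.atTop (nhds v₀)) : IsWeakDeriv R i j u₀ v₀ := by
  rw [isWeakDeriv_iff]
  intro φ hφ
  have e1 := ((testInt R (hφ.pd i j)).continuous.tendsto u₀).comp hu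
  have e2 := (((testInt R hφ).continuous.tendsto v₀).comp hv).const_smul ((-1 : ℝ) ^ (i + j))
  refine tendsto_nhds_unique e1 (e2.congr fun n => ?_)
  exact (isWeakDeriv_iff.1 (h n) φ hφ).symm

/-- Differentiability of each `S u` suffices: uniqueness makes the derivative linear in `u`, its
graph is closed, and the closed graph theorem makes it bounded. Hence `diffComp` does not take its
default value `0`. -/
theorem diffComp_apply {S : L2xy R κ →L[ℝ] L2xy R ι}
    (h : ∀ u, ∃ v, IsWeakDeriv R i j (S u) v) (u : L2xy R κ) :
    diffComp R i j S u = weakDeriv R i j (S u) := by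
  choose D hD using h
  have hex : ∃ D : L2xy R κ →L[ℝ] L2xy R ι, ∀ u, IsWeakDeriv R i j (S u) (D u) := by
    let L : L2xy R κ →ₗ[ℝ] L2xy R ι :=
      { toFun := D
        map_add' := fun u v => (hD (u + v)).unique (by rw [map_add]; exact (hD u).add (hD v))
        map_smul' := fun c u => (hD (c • u)).unique (by
          rw [map_smul]; exact (hD u).smul c) }
    have hc : Continuous L := L.continuous_of_seq_closed_graph fun v x y hv hy =>
      (isWeakDeriv_of_tendsto (fun n => hD (v n)) ((S.continuous.tendsto x).comp hv) hy).unique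
        (hD x)
    exact ⟨⟨L, hc⟩, hD⟩
  rw [diffComp, dif_pos hex, (hex.choose_spec u).weakDeriv_eq]

end Weak

/-! ### Functions of one variable -/

section OneVar

variable {E : Type*} [NormedAddCommGroup E] [NormedSpace ℝ E] [CompleteSpace E]

/-- Dirichlet's formula for an integral over a triangle. -/
theorem integral_smul_primitive {f : ℝ → E} {ψ : ℝ → ℝ} (hψ : Continuous ψ) {a x : ℝ}
    (h : a ≤ x) (hf : IntegrableOn f (Ioc a x)) :
    ∫ s in a..x, ψ s • ∫ θ in a..s, f θ = ∫ θ in a..x, (∫ s in θ..x, ψ s) • f θ := by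
  set μ : Measure ℝ := volume.restrict (Ioc a x) with hμ
  have hψi : Integrable ψ μ :=
    (hψ.integrableOn_Icc (a := a) (b := x)).mono_set Ioc_subset_Icc_self
  -- The product `ψ(s) f(θ)` is integrable on the square and stays so when cut down to the triangle
  -- `θ ≤ s`. Fubini applies; the two orders of integration are the two sides of the formula.
  have hint : Integrable (fun z : ℝ × ℝ =>
      {z : ℝ × ℝ | z.2 ≤ z.1}.indicator (fun z => ψ z.1 • f z.2) z) (μ.prod μ) :=
    (hψi.smul_prod hf).indicator (measurableSet_le measurable_snd measurable_fst)
  rw [intervalIntegral.integral_of_le h, intervalIntegral.integral_of_le h]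
  have e1 : ∫ s in Ioc a x, ψ s • ∫ θ in a..s, f θ = ∫ s, ∫ θ,
      {z : ℝ × ℝ | z.2 ≤ z.1}.indicator (fun z => ψ z.1 • f z.2) (s, θ) ∂μ ∂μ := by
    refine setIntegral_congr_fun measurableSet_Ioc fun s hs => ?_
    have : ∀ θ, {z : ℝ × ℝ | z.2 ≤ z.1}.indicator (fun z => ψ z.1 • f z.2) (s, θ)
        = (Iic s).indicator (fun θ => ψ s • f θ) θ := fun θ => rfl
    simp only [this]
    rw [integral_indicator measurableSet_Iic, integral_smul, hμ,
      Measure.restrict_restrict measurableSet_Iic, intervalIntegral.integral_of_le hs.1.le]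
    congr 3
    ext t
    simp only [mem_inter_iff, mem_Iic, mem_Ioc]
    exact ⟨fun ⟨h1, h2⟩ => ⟨h2, h1, h2.trans hs.2⟩, fun ⟨h1, h2, _⟩ => ⟨h2, h1⟩⟩
  rw [e1, integral_integral_swap hint]
  refine setIntegral_congr_fun measurableSet_Ioc fun θ hθ => ?_
  have : ∀ s, {z : ℝ × ℝ | z.2 ≤ z.1}.indicator (fun z => ψ z.1 • f z.2) (s, θ)
      = (Ici θ).indicator (fun s => ψ s • f θ) s := fun s => rfl
  simp only [this]
  rw [integral_indicator measurableSet_Ici, integral_smul_const, hμ,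
    Measure.restrict_restrict measurableSet_Ici, intervalIntegral.integral_of_le hθ.2,
    ← integral_Icc_eq_integral_Ioc]
  congr 3
  ext t
  simp only [mem_inter_iff, mem_Ici, mem_Icc, mem_Ioc]
  exact ⟨fun ⟨h1, h2, h3⟩ => ⟨h1, h3⟩, fun ⟨h1, h2⟩ => ⟨h1, hθ.1.trans_le h1, h2⟩⟩

/-- Cauchy's formula for repeated integration, the source of the kernels `x - θ` and `y - ν` in
`𝒦₁`, `𝒦₂` and in the boundary operators. -/
theorem integral_primitive {f : ℝ → E} {a x : ℝ} (h : a ≤ x) (hf : IntegrableOn f (Ioc a x)) :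
    ∫ s in a..x, ∫ θ in a..s, f θ = ∫ θ in a..x, (x - θ) • f θ := by
  simpa using integral_smul_primitive (ψ := fun _ => 1) continuous_const h hf

/-- Integration by parts for merely integrable `f`: in Dirichlet's formula the inner integral of
`ψ'` is `ψ b - ψ θ = -ψ θ`. -/
theorem integral_deriv_smul_primitive {f : ℝ → E} {ψ : ℝ → ℝ} (hψ : ContDiff ℝ ∞ ψ) {a b : ℝ}
    (h : a ≤ b) (hf : IntegrableOn f (Ioc a b)) (hb : ψ b = 0) :
    ∫ s in a..b, deriv ψ s • ∫ θ in a..s, f θ = - ∫ θ in a..b, ψ θ • f θ := by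
  have hc : Continuous (deriv ψ) := hψ.continuous_deriv (by simp)
  rw [integral_smul_primitive hc h hf, ← intervalIntegral.integral_neg]
  refine intervalIntegral.integral_congr fun θ _ => ?_
  rw [intervalIntegral.integral_deriv_eq_sub
    (fun x _ => hψ.differentiable (by simp) x) (hc.intervalIntegrable _ _), hb, zero_sub, neg_smul]

/-- Test functions of one variable. -/
structure IsTest1 (a b : ℝ) (ψ : ℝ → ℝ) : Prop where
  smooth : ContDiff ℝ ∞ ψ
  cpt : HasCompactSupport ψ
  supp : tsupport ψ ⊆ Ioo a b

theorem IsTest1.exists_Icc {a b : ℝ} {ψ : ℝ → ℝ} (h : IsTest1 a b ψ) (hab : a < b) :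
    ∃ m M, a < m ∧ M < b ∧ Function.support ψ ⊆ Icc m M := by
  rcases (tsupport ψ).eq_empty_or_nonempty with he | hne
  · refine ⟨b, a, hab, hab, ?_⟩
    intro x hx
    have := subset_tsupport ψ hx
    simp [he] at this
  · obtain ⟨m, hm, hm'⟩ := h.cpt.isCompact.exists_isLeast hne
    obtain ⟨M, hM, hM'⟩ := h.cpt.isCompact.exists_isGreatest hne
    exact ⟨m, M, (h.supp hm).1, (h.supp hM).2, fun x hx =>
      ⟨hm' (subset_tsupport ψ hx), hM' (subset_tsupport ψ hx)⟩⟩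

theorem exists_isTest1_integral_eq_one {a b : ℝ} (hab : a < b) :
    ∃ ψ, IsTest1 a b ψ ∧ ∫ x, ψ x = 1 := by
  -- The outer radius `(b - a) / 4` keeps the closed support inside the open interval.
  let f : ContDiffBump ((a + b) / 2) := ⟨(b - a) / 8, (b - a) / 4, by linarith, by linarith⟩
  refine ⟨f.normed volume, ⟨f.contDiff_normed, f.hasCompactSupport_normed, ?_⟩,
    f.integral_normed⟩
  rw [f.tsupport_normed_eq, Real.closedBall_eq_Icc]
  refine Icc_subset_Ioo ?_ ?_
  · change a < (a + b) / 2 - (b - a) / 4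
    linarith
  · change (a + b) / 2 + (b - a) / 4 < b
    linarith

/-- A test function with vanishing integral is the derivative of a test function. -/
theorem exists_isTest1_deriv_eq {a b : ℝ} (hab : a < b) {ψ : ℝ → ℝ} (h : IsTest1 a b ψ)
    (h0 : ∫ x, ψ x = 0) : ∃ χ, IsTest1 a b χ ∧ deriv χ = ψ := by
  obtain ⟨m, M, hm, hM, hs⟩ := h.exists_Icc hab
  have hd : ∀ x, HasDerivAt (fun x => ∫ t in a..x, ψ t) (ψ x) x := fun x =>
    intervalIntegral.integral_hasDerivAt_right (h.smooth.continuous.intervalIntegrable _ _)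
      (h.smooth.continuous.stronglyMeasurableAtFilter _ _) h.smooth.continuous.continuousAt
  have hder : deriv (fun x => ∫ t in a..x, ψ t) = ψ := funext fun x => (hd x).deriv
  have hz : ∀ t, t ∉ Icc m M → ψ t = 0 := fun t ht => by
    by_contra hne
    exact ht (hs hne)
  -- To the left of `m` the integrand vanishes; to the right of `M` the primitive equals the total
  -- integral of `ψ`, which is zero.
  have hsupp : Function.support (fun x => ∫ t in a..x, ψ t) ⊆ Icc m M := by
    intro x hx
    by_contra hn
    refine hx ?_
    simp only
    rcases lt_or_ge x m with h1 | h1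
    · rw [intervalIntegral.integral_congr (g := fun _ => 0)]
      · simp
      · intro t ht
        refine hz t fun ht' => ?_
        have := ht.2
        rcases le_max_iff.1 this with h2 | h2 <;> linarith [ht'.1]
    · have h2 : M < x := by
        by_contra h2
        exact hn ⟨h1, not_lt.1 h2⟩
      rw [intervalIntegral.integral_eq_integral_of_support_subset, h0]
      exact fun t ht => ⟨hm.trans_le (hs ht).1, (hs ht).2.trans h2.le⟩
  have hts : tsupport (fun x => ∫ t in a..x, ψ t) ⊆ Icc m M :=
    closure_minimal hsupp isClosed_Icc
  refine ⟨_, ⟨contDiff_infty_iff_deriv.2 ⟨fun x => (hd x).differentiableAt, ?_⟩,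
    isCompact_Icc.of_isClosed_subset (isClosed_tsupport _) hts,
    hts.trans (Icc_subset_Ioo hm hM)⟩, hder⟩
  rw [hder]
  exact h.smooth

theorem IsTest1.sub_smul {a b : ℝ} {ψ χ : ℝ → ℝ} (h : IsTest1 a b ψ) (h' : IsTest1 a b χ) (c : ℝ) :
    IsTest1 a b (fun x => ψ x - c * χ x) := by
  have hs : tsupport (fun x => ψ x - c * χ x) ⊆ tsupport ψ ∪ tsupport χ := by
    refine closure_minimal ?_ ((isClosed_tsupport _).union (isClosed_tsupport _))
    intro x hx
    by_contra hn
    rw [mem_union, not_or] at hn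
    refine hx ?_
    simp [image_eq_zero_of_notMem_tsupport hn.1, image_eq_zero_of_notMem_tsupport hn.2]
  exact ⟨h.smooth.sub (contDiff_const.mul h'.smooth),
    (h.cpt.isCompact.union h'.cpt.isCompact).of_isClosed_subset (isClosed_tsupport _) hs,
    hs.trans (union_subset h.supp h'.supp)⟩

theorem IsTest1.exists_bound {a b : ℝ} {ψ : ℝ → ℝ} (h : IsTest1 a b ψ) : ∃ C, ∀ x, |ψ x| ≤ C :=
  h.cpt.exists_bound_of_continuous h.smooth.continuous

theorem IsTest1.integrable_smul {a b : ℝ} {ψ : ℝ → ℝ} (h : IsTest1 a b ψ) {μ : Measure ℝ}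
    {G : ℝ → E} (hG : Integrable G μ) : Integrable (fun x => ψ x • G x) μ := by
  obtain ⟨C, hC⟩ := h.exists_bound
  exact hG.bdd_smul C h.smooth.continuous.aestronglyMeasurable (Filter.Eventually.of_forall hC)

theorem IsTest1.integral_eq {a b : ℝ} {ψ : ℝ → ℝ} (h : IsTest1 a b ψ) :
    ∫ x in Icc a b, ψ x = ∫ x, ψ x := by
  refine setIntegral_eq_integral_of_forall_compl_eq_zero fun x hx => ?_
  exact image_eq_zero_of_notMem_tsupport fun h' => hx (Ioo_subset_Icc_self (h.supp h'))

theorem ae_eq_zero_of_isTest1 {a b : ℝ} {G : ℝ → E} (hG : IntegrableOn G (Icc a b))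
    (h : ∀ ψ, IsTest1 a b ψ → ∫ x in Icc a b, ψ x • G x = 0) :
    G =ᵐ[volume.restrict (Icc a b)] 0 := by
  have h0 := isOpen_Ioo.ae_eq_zero_of_integral_contDiff_smul_eq_zero
    (μ := volume.restrict (Icc a b)) (f := G) (U := Ioo a b)
    ((Integrable.locallyIntegrable hG).locallyIntegrableOn _)
    fun φ h1 h2 h3 => h φ ⟨h1, h2, h3⟩
  have hm : ∀ᵐ x ∂(volume.restrict (Icc a b)), x ∈ Ioo a b := by
    rw [← restrict_Ioo_eq_restrict_Icc]
    exact ae_restrict_mem measurableSet_Ioo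
  filter_upwards [h0, hm] with x h1 h2
  exact h1 h2

/-- The lemma of du Bois-Reymond. -/
theorem exists_const_of_integral_deriv_smul_eq_zero {a b : ℝ} (hab : a < b) {G : ℝ → E}
    (hG : IntegrableOn G (Icc a b))
    (h : ∀ χ, IsTest1 a b χ → ∫ x in Icc a b, deriv χ x • G x = 0) :
    ∃ w, G =ᵐ[volume.restrict (Icc a b)] fun _ => w := by
  obtain ⟨ρ, hρ, hρ1⟩ := exists_isTest1_integral_eq_one hab
  set w : E := ∫ x in Icc a b, ρ x • G x with hw
  refine ⟨w, ?_⟩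
  have hGw : IntegrableOn (fun x => G x - w) (Icc a b) :=
    Integrable.sub hG (integrable_const w)
  have h0 := ae_eq_zero_of_isTest1 hGw fun ψ hψ => ?_
  · filter_upwards [h0] with x hx
    exact sub_eq_zero.1 hx
  -- The combination `ψ - (∫ψ)ρ` has integral zero and is therefore the derivative of a test
  -- function. The hypothesis yields `∫ψG = (∫ψ)w`, so `G - w` is orthogonal to every `ψ`.
  · have hi := hψ.sub_smul hρ (∫ x, ψ x)
    have hψi : Integrable ψ := hψ.smooth.continuous.integrable_of_hasCompactSupport hψ.cpt
    have hρi : Integrable ρ := hρ.smooth.continuous.integrable_of_hasCompactSupport hρ.cpt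
    obtain ⟨χ, hχ, hχd⟩ := exists_isTest1_deriv_eq hab hi (by
      rw [integral_sub hψi (hρi.const_mul _), integral_const_mul, hρ1]; ring)
    have e := h χ hχ
    rw [hχd] at e
    simp only [sub_smul, mul_smul] at e
    rw [integral_sub (hψ.integrable_smul hG)
      (f := fun x => ψ x • G x) (g := fun x => (∫ x, ψ x) • ρ x • G x)
      ((hρ.integrable_smul hG).smul (∫ x, ψ x)), integral_smul, ← hw] at e
    simp only [smul_sub]
    rw [integral_sub (hψ.integrable_smul hG) (hψ.integrable_smul (integrable_const w)),
      integral_smul_const, hψ.integral_eq, e]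

end OneVar

/-! ### Weak derivatives and primitives -/

section Prim

variable {R : Rectangle} {ι : Type} [Fintype ι]

theorem isTest_mul {χ η : ℝ → ℝ} (hχ : IsTest1 R.a R.b χ) (hη : IsTest1 R.c R.d η) :
    IsTest R (fun s => χ s.1 * η s.2) := by
  have hs : tsupport (fun s : ℝ × ℝ => χ s.1 * η s.2) ⊆ tsupport χ ×ˢ tsupport η := by
    refine closure_minimal ?_ ((isClosed_tsupport _).prod (isClosed_tsupport _))
    intro s hs
    by_contra hn
    rw [mem_prod, not_and_or] at hn
    refine hs ?_
    rcases hn with hn | hn <;> simp [image_eq_zero_of_notMem_tsupport hn]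
  exact ⟨(hχ.smooth.comp contDiff_fst).mul (hη.smooth.comp contDiff_snd),
    (hχ.cpt.isCompact.prod hη.cpt.isCompact).of_isClosed_subset (isClosed_tsupport _) hs,
    hs.trans (prod_mono hχ.supp hη.supp)⟩

theorem IsTest.integrable_smul {E : Type*} [NormedAddCommGroup E] [NormedSpace ℝ E]
    {φ : ℝ × ℝ → ℝ} (h : IsTest R φ) {μ : Measure (ℝ × ℝ)} {G : ℝ × ℝ → E}
    (hG : Integrable G μ) : Integrable (fun x => φ x • G x) μ := by
  obtain ⟨C, hC⟩ := h.exists_bound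
  exact hG.bdd_smul C h.smooth.continuous.aestronglyMeasurable (Filter.Eventually.of_forall hC)

theorem IsTest.eq_zero_left {φ : ℝ × ℝ → ℝ} (h : IsTest R φ) (y : ℝ) : φ (R.a, y) = 0 :=
  image_eq_zero_of_notMem_tsupport fun h' => lt_irrefl _ (h.supp h').1.1

theorem IsTest.eq_zero_right {φ : ℝ × ℝ → ℝ} (h : IsTest R φ) (y : ℝ) : φ (R.b, y) = 0 :=
  image_eq_zero_of_notMem_tsupport fun h' => lt_irrefl _ (h.supp h').1.2

theorem pd_one_zero (φ : ℝ × ℝ → ℝ) (s : ℝ × ℝ) :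
    pd 1 0 φ s = deriv (fun x => φ (x, s.2)) s.1 := by
  simp [pd, iteratedDeriv_one]

theorem integral_μxy_symm {E : Type*} [NormedAddCommGroup E] [NormedSpace ℝ E] {f : ℝ × ℝ → E}
    (hf : Integrable f R.μxy) :
    ∫ s, f s ∂(R.μxy) = ∫ y, (∫ x in R.a..R.b, f (x, y)) ∂(R.μy) := by
  refine (integral_prod_symm (μ := R.μx) (ν := R.μy) f hf).trans ?_
  simp only [integral_μx]

/-- By Fubini it is enough to integrate by parts on almost every line `y = const`: the primitive
vanishes at `x = a` and the test function at `x = b`. -/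
theorem isWeakDeriv_primX (v : L2xy R ι) : IsWeakDeriv R 1 0 (primX R v) v := by
  intro φ h1 h2 h3
  have hφ : IsTest R φ := ⟨h1, h2, h3⟩
  rw [integral_μxy_symm ((hφ.pd 1 0).integrable_smul (integrable_L2 _)),
    integral_μxy_symm (hφ.integrable_smul (integrable_L2 _)), ← integral_smul]
  refine integral_congr_ae ?_
  filter_upwards [ae_section_integrable R v, ae_ae_of_ae' R (coeFn_primX R v)] with y hy hp
  have e1 : ∫ x in R.a..R.b, pd 1 0 φ (x, y) • (primX R v) (x, y)
      = ∫ x in R.a..R.b, deriv (fun x => φ (x, y)) x • ∫ θ in R.a..x, v (θ, y) := by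
    refine intervalIntegral_congr_μx R ?_ (left_mem_x R) (right_mem_x R)
    filter_upwards [hp] with x hx
    rw [hx, pd_one_zero]
  have hyi : IntegrableOn (fun θ => v (θ, y)) (Ioc R.a R.b) :=
    IntegrableOn.mono_set (t := Icc R.a R.b) hy Ioc_subset_Icc_self
  have hc : ContDiff ℝ ∞ fun x => φ (x, y) := h1.comp (contDiff_prodMk_left y)
  rw [e1, integral_deriv_smul_primitive hc R.hab.le hyi (hφ.eq_zero_right y)]
  simp

/-- On each line `y = const` the integral is `h y` times the increment of a test function that
vanishes at both ends. -/
theorem isWeakDeriv_liftY (h : L2y R ι) : IsWeakDeriv R 1 0 (liftY R h) 0 := by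
  intro φ h1 h2 h3
  have hφ : IsTest R φ := ⟨h1, h2, h3⟩
  have e0 : ∫ s, φ s • (0 : L2xy R ι) s ∂(R.μxy) = 0 := (testInt R hφ).map_zero
  rw [integral_μxy_symm ((hφ.pd 1 0).integrable_smul (integrable_L2 _)), e0, smul_zero]
  refine integral_eq_zero_of_ae ?_
  filter_upwards [ae_ae_of_ae' R (coeFn_liftY R h)] with y hp
  have e1 : ∫ x in R.a..R.b, pd 1 0 φ (x, y) • (liftY R h) (x, y)
      = ∫ x in R.a..R.b, deriv (fun x => φ (x, y)) x • h y := by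
    refine intervalIntegral_congr_μx R ?_ (left_mem_x R) (right_mem_x R)
    filter_upwards [hp] with x hx
    rw [hx, pd_one_zero]
  have hc : ContDiff ℝ ∞ fun x => φ (x, y) := h1.comp (contDiff_prodMk_left y)
  rw [e1, intervalIntegral.integral_smul_const, intervalIntegral.integral_deriv_eq_sub
    (fun x _ => hc.differentiable (by simp) x)
    ((hc.continuous_deriv (by simp)).intervalIntegrable _ _), hφ.eq_zero_right, hφ.eq_zero_left]
  simp

/-- A function on the rectangle is determined by its moments in `y` against test functions. -/
theorem eq_zero_of_ae_integral_smul_eq_zero {E : Type*} [NormedAddCommGroup E] [NormedSpace ℝ E]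
    [CompleteSpace E] {k : Lp E 2 R.μxy}
    (h : ∀ η, IsTest1 R.c R.d η → ∀ᵐ x ∂(R.μx), ∫ y, η y • k (x, y) ∂(R.μy) = 0) : k = 0 := by
  have hk : Integrable (fun z => k z) (R.μx.prod R.μy) := integrable_L2 k
  -- For fixed `S` the integral of `k` over `x ∈ S` is a function of `y` orthogonal to all
  -- one-variable test functions, hence zero almost everywhere; integrating it over `T` gives zero
  -- on every rectangle.
  have hrect : ∀ S T : Set ℝ, MeasurableSet S → MeasurableSet T →
      ∫ z in S ×ˢ T, k z ∂(R.μx.prod R.μy) = 0 := by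
    intro S T hS hT
    have hkS : Integrable (fun z => k z) ((R.μx.restrict S).prod R.μy) :=
      hk.mono_measure (Measure.prod_mono Measure.restrict_le_self le_rfl)
    have hK : (fun y => ∫ x in S, k (x, y) ∂(R.μx)) =ᵐ[R.μy] 0 := by
      refine ae_eq_zero_of_isTest1 (a := R.c) (b := R.d) hkS.integral_prod_right fun η hη => ?_
      have hint : Integrable (fun z : ℝ × ℝ => η z.2 • k z) ((R.μx.restrict S).prod R.μy) := by
        obtain ⟨C, hC⟩ := hη.exists_bound
        exact hkS.bdd_smul C
          (hη.smooth.continuous.comp continuous_snd).aestronglyMeasurable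
          (Filter.Eventually.of_forall fun z => hC z.2)
      have e1 : ∫ y, η y • ∫ x in S, k (x, y) ∂(R.μx) ∂(R.μy)
          = ∫ y, ∫ x in S, η y • k (x, y) ∂(R.μx) ∂(R.μy) := by
        simp only [integral_smul]
      refine e1.trans ?_
      rw [← integral_integral_swap (f := fun x y => η y • k (x, y)) hint]
      exact integral_eq_zero_of_ae (ae_restrict_of_ae (h η hη))
    have hkST : Integrable (fun z => k z) ((R.μx.restrict S).prod (R.μy.restrict T)) :=
      hk.mono_measure (Measure.prod_mono Measure.restrict_le_self Measure.restrict_le_self)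
    rw [← Measure.prod_restrict, integral_prod_symm _ hkST]
    exact integral_eq_zero_of_ae (ae_restrict_of_ae hK)
  refine (Lp.eq_zero_iff_ae_eq_zero).2 ?_
  refine Integrable.ae_eq_zero_of_forall_setIntegral_eq_zero (μ := R.μx.prod R.μy) hk
    fun s hs _ => ?_
  -- Dynkin's π-λ argument: measurable rectangles generate the product σ-algebra and are stable
  -- under intersection. Complements are handled by the vanishing of the total integral.
  refine MeasurableSpace.induction_on_inter
    (C := fun s _ => ∫ z in s, k z ∂(R.μx.prod R.μy) = 0) generateFrom_prod.symm isPiSystem_prod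
    (by simp) ?_ ?_ ?_ s hs
  · rintro _ ⟨S, hS, T, hT, rfl⟩
    exact hrect S T hS hT
  · intro t ht h0
    have e := integral_add_compl ht hk
    have e2 := hrect univ univ MeasurableSet.univ MeasurableSet.univ
    rw [univ_prod_univ, Measure.restrict_univ] at e2
    rwa [h0, zero_add, e2] at e
  · intro f hd hm h0
    rw [integral_iUnion hm hd hk.integrableOn]
    simp [h0]

/-- Separation of variables. Tested against `χ(x)η(y)`, the hypothesis says that the moment `x ↦ ∫ η
g(x, ·)` is orthogonal to every `χ'`, so it is constant by du Bois-Reymond. Thus `g` and its average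
over `x` have the same moments in `y`, and moments determine the function. -/
theorem exists_liftY_of_isWeakDeriv_zero {g : L2xy R ι} (hg : IsWeakDeriv R 1 0 g 0) :
    ∃ h : L2y R ι, g = liftY R h := by
  have hgi : Integrable (fun z => g z) (R.μx.prod R.μy) := integrable_L2 g
  set h : L2y R ι := (R.b - R.a)⁻¹ • intX R g with hh
  refine ⟨h, ?_⟩
  rw [← sub_eq_zero]
  refine eq_zero_of_ae_integral_smul_eq_zero fun η hη => ?_
  have hint : Integrable (fun z : ℝ × ℝ => η z.2 • g z) (R.μx.prod R.μy) := by
    obtain ⟨C, hC⟩ := hη.exists_bound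
    exact hgi.bdd_smul C (hη.smooth.continuous.comp continuous_snd).aestronglyMeasurable
      (Filter.Eventually.of_forall fun z => hC z.2)
  obtain ⟨w, hw⟩ := exists_const_of_integral_deriv_smul_eq_zero R.hab
    (G := fun x => ∫ y, η y • g (x, y) ∂(R.μy)) hint.integral_prod_left fun χ hχ => by
      have hφ := isTest_mul hχ hη
      have e := hg _ hφ.smooth hφ.cpt hφ.supp
      have e0 : ∫ s, (χ s.1 * η s.2) • (0 : L2xy R ι) s ∂(R.μxy) = 0 := (testInt R hφ).map_zero
      have e1 := integral_prod _ (μ := R.μx) (ν := R.μy) ((hφ.pd 1 0).integrable_smul hgi)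
      rw [e0, smul_zero] at e
      have e2 := e1.symm.trans e
      simp only [pd_one_zero, deriv_mul_const_field', mul_smul, integral_smul] at e2
      exact e2
  -- Averaging the constant moment over `x` returns the constant, and by Fubini it is the moment of
  -- the average `h`.
  have hw' : ∫ y, η y • h y ∂(R.μy) = w := by
    have e1 : ∫ y, η y • h y ∂(R.μy)
        = (R.b - R.a)⁻¹ • ∫ y, ∫ x, η y • g (x, y) ∂(R.μx) ∂(R.μy) := by
      rw [← integral_smul]
      refine integral_congr_ae ?_
      filter_upwards [Lp.coeFn_smul (R.b - R.a)⁻¹ (intX R g), coeFn_intX R g] with y h1 h2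
      rw [hh, h1, Pi.smul_apply, h2, integral_smul, ← integral_μx, smul_comm]
    rw [e1, ← integral_integral_swap (f := fun x y => η y • g (x, y)) hint]
    have e2 : ∫ x, ∫ y, η y • g (x, y) ∂(R.μy) ∂(R.μx) = ∫ x, w ∂(R.μx) := integral_congr_ae hw
    rw [e2, integral_μx, intervalIntegral.integral_const, smul_smul,
      inv_mul_cancel₀ (sub_pos.2 R.hab).ne', one_smul]
  filter_upwards [hw, ae_ae_of_ae R (Lp.coeFn_sub g (liftY R h)),
    ae_ae_of_ae R (coeFn_liftY R h), hgi.prod_right_ae] with x h1 h2 h3 h4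
  have e1 : ∫ y, η y • (g - liftY R h : L2xy R ι) (x, y) ∂(R.μy)
      = ∫ y, (η y • g (x, y) - η y • h y) ∂(R.μy) := by
    refine integral_congr_ae ?_
    filter_upwards [h2, h3] with y h5 h6
    rw [h5, Pi.sub_apply, h6, smul_sub]
  rw [e1, integral_sub (hη.integrable_smul h4) (hη.integrable_smul (integrable_L2 h)), hw',
    sub_eq_zero]
  exact h1

theorem exists_liftY_add_primX {u v : L2xy R ι} (h : IsWeakDeriv R 1 0 u v) :
    ∃ g : L2y R ι, u = liftY R g + primX R v := by
  obtain ⟨g, hg⟩ := exists_liftY_of_isWeakDeriv_zero (g := u - primX R v) (by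
    simpa using h.sub (isWeakDeriv_primX v))
  exact ⟨g, by rw [← hg]; abel⟩

theorem isWeakDeriv_liftY_add_primX (g : L2y R ι) (v : L2xy R ι) :
    IsWeakDeriv R 1 0 (liftY R g + primX R v) v := by
  simpa using (isWeakDeriv_liftY g).add (isWeakDeriv_primX v)

/-! ### Exchange of the variables -/

/-- The chain rule for the reflection exchanges the two coordinate directions; the order of
differentiation is then restored by symmetry. -/
theorem pd_comp_swap {φ : ℝ × ℝ → ℝ} (h : ContDiff ℝ ∞ φ) (s : ℝ × ℝ) (i j : ℕ) :
    pd i j (fun s => φ s.swap) s = pd j i φ s.swap := by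
  have hD : ∀ (v : ℝ × ℝ) (n : ℕ) (φ : ℝ × ℝ → ℝ), ContDiff ℝ ∞ φ →
      (dirD v)^[n] (fun s => φ s.swap) = fun s => (dirD v.swap)^[n] φ s.swap := by
    intro v n
    induction n with
    | zero => exact fun φ _ => rfl
    | succ n ih =>
      intro φ h
      rw [Function.iterate_succ_apply, Function.iterate_succ_apply, ← ih _ (contDiff_dirD h _)]
      congr 1
      funext s
      have hd : HasFDerivAt φ (fderiv ℝ φ s.swap) s.swap :=
        (h.differentiable (by simp) _).hasFDerivAt
      have hs : HasFDerivAt (Prod.swap : ℝ × ℝ → ℝ × ℝ)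
          (ContinuousLinearEquiv.prodComm ℝ ℝ ℝ : ℝ × ℝ →L[ℝ] ℝ × ℝ) s :=
        (ContinuousLinearEquiv.prodComm ℝ ℝ ℝ).hasFDerivAt
      exact congrArg (fun L : ℝ × ℝ →L[ℝ] ℝ => L v) (hd.comp s hs).fderiv
  have hs : ContDiff ℝ ∞ fun s : ℝ × ℝ => φ s.swap :=
    h.comp (contDiff_snd.prodMk contDiff_fst)
  rw [pd_eq_dirD hs, pd_eq_dirD h, hD _ _ _ h, hD _ _ _ (contDiff_dirD_iterate h _ _),
    dirD_iterate_comm h]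
  rfl

theorem IsTest.swap {φ : ℝ × ℝ → ℝ} (h : IsTest R.swap φ) : IsTest R (fun s => φ s.swap) := by
  have hs : tsupport (fun s : ℝ × ℝ => φ s.swap) ⊆ Prod.swap ⁻¹' tsupport φ :=
    closure_minimal (fun s hs => subset_tsupport φ hs)
      ((isClosed_tsupport φ).preimage continuous_swap)
  refine ⟨h.smooth.comp (contDiff_snd.prodMk contDiff_fst), ?_,
    fun s hs' => ?_⟩
  · refine IsCompact.of_isClosed_subset ?_ (isClosed_tsupport _) hs
    exact (Homeomorph.prodComm ℝ ℝ).isCompact_preimage.2 h.cpt.isCompact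
  · have := h.supp (hs hs')
    exact ⟨this.2, this.1⟩

theorem integral_swapL {E : Type*} [NormedAddCommGroup E] [NormedSpace ℝ E] (φ : ℝ × ℝ → ℝ)
    (u : Lp E 2 R.μxy) :
    ∫ s, φ s • swapL R u s ∂(R.swap.μxy) = ∫ s, φ s.swap • u s ∂(R.μxy) := by
  rw [← (measurePreserving_swap R).integral_comp MeasurableEquiv.prodComm.measurableEmbedding]
  refine integral_congr_ae ?_
  filter_upwards [ae_swap R.swap (coeFn_swapL R u)] with s hs
  rw [hs, Prod.swap_swap]

theorem IsWeakDeriv.swap {i j : ℕ} {u v : L2xy R ι} (h : IsWeakDeriv R i j u v) :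
    IsWeakDeriv R.swap j i (swapL R u) (swapL R v) := by
  intro φ h1 h2 h3
  have hφ : IsTest R.swap φ := ⟨h1, h2, h3⟩
  have e := h _ hφ.swap.smooth hφ.swap.cpt hφ.swap.supp
  rw [integral_swapL, integral_swapL, add_comm j i, ← e]
  simp only [pd_comp_swap h1]

/-- Obtained from the statement in `x` on the reflected rectangle, by reflecting back. -/
theorem exists_liftX_add_primY {u v : L2xy R ι} (h : IsWeakDeriv R 0 1 u v) :
    ∃ f : L2x R ι, u = liftX R f + primY R v := by
  obtain ⟨f, hf⟩ := exists_liftY_add_primX h.swap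
  refine ⟨f, ?_⟩
  have e := congrArg (swapL R.swap) hf
  rw [map_add, swapL_swapL] at e
  rw [e]
  rfl

theorem isWeakDeriv_liftX_add_primY (f : L2x R ι) (v : L2xy R ι) :
    IsWeakDeriv R 0 1 (liftX R f + primY R v) v := by
  have h := (isWeakDeriv_liftY_add_primX (R := R.swap) f (swapL R v)).swap
  rw [map_add, swapL_swapL] at h
  exact h

end Prim

/-! ### Traces -/

section Trace

variable (R : Rectangle) {ι : Type} [Fintype ι]

theorem xEnd_mem (p : Fin 2) : R.xEnd p ∈ Icc R.a R.b := by
  unfold Rectangle.xEnd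
  split_ifs
  exacts [left_mem_x R, right_mem_x R]

theorem yEnd_mem (q : Fin 2) : R.yEnd q ∈ Icc R.c R.d := xEnd_mem R.swap q

/-- Integral over `x` from the left side to the side `p`. -/
def sideIntX (p : Fin 2) : L2xy R ι →L[ℝ] L2y R ι := if p = 1 then intX R else 0

/-- Integral over `y` from the lower side to the side `q`. -/
def sideIntY (q : Fin 2) : L2xy R ι →L[ℝ] L2x R ι := if q = 1 then intY R else 0

/-- Integral of a function of `x` from the left end to the end `p`. -/
def sideTotX (p : Fin 2) : L2x R ι →L[ℝ] EuclideanSpace ℝ ι := if p = 1 then totX R else 0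

/-- Integral of a function of `y` from the lower end to the end `q`. -/
def sideTotY (q : Fin 2) : L2y R ι →L[ℝ] EuclideanSpace ℝ ι := if q = 1 then totY R else 0

variable {R}

theorem sideIntX_ae {p : Fin 2} (v : L2xy R ι) :
    sideIntX R p v =ᵐ[R.μy] fun y => ∫ θ in R.a..R.xEnd p, v (θ, y) := by
  fin_cases p
  · simp only [sideIntX, Rectangle.xEnd]
    filter_upwards [Lp.coeFn_zero (EuclideanSpace ℝ ι) 2 R.μy] with y hy
    simpa using hy
  · simpa [sideIntX, Rectangle.xEnd] using coeFn_intX R v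

theorem sideIntY_ae {q : Fin 2} (v : L2xy R ι) :
    sideIntY R q v =ᵐ[R.μx] fun x => ∫ ν in R.c..R.yEnd q, v (x, ν) := by
  fin_cases q
  · simp only [sideIntY, Rectangle.yEnd]
    filter_upwards [Lp.coeFn_zero (EuclideanSpace ℝ ι) 2 R.μx] with y hy
    simpa using hy
  · simpa [sideIntY, Rectangle.yEnd] using coeFn_intY R v

theorem sideTotX_eq {p : Fin 2} (f : L2x R ι) :
    sideTotX R p f = ∫ θ in R.a..R.xEnd p, f θ := by
  fin_cases p
  · simp [sideTotX, Rectangle.xEnd]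
  · simpa [sideTotX, Rectangle.xEnd] using totX_ae R (Filter.EventuallyEq.refl _ _)

theorem sideTotY_eq {q : Fin 2} (f : L2y R ι) :
    sideTotY R q f = ∫ ν in R.c..R.yEnd q, f ν := sideTotX_eq (R := R.swap) f

theorem continuousOn_primitive_L2x {f : ℝ → EuclideanSpace ℝ ι} (hf : Integrable f R.μx) :
    ContinuousOn (fun x => ∫ θ in R.a..x, f θ) (Icc R.a R.b) := by
  have h := intervalIntegral.continuousOn_primitive_interval (f := f) (μ := volume)
    (a := R.a) (b := R.b) (by rw [uIcc_of_le R.hab.le]; exact hf)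
  rwa [uIcc_of_le R.hab.le] at h

theorem ae_section_integrable' (f : L2xy R ι) :
    ∀ᵐ x ∂(R.μx), Integrable (fun ν => f (x, ν)) R.μy :=
  Integrable.prod_right_ae (μ := R.μx) (ν := R.μy) (integrable_L2 f)

/-- On almost every line `x = const` two representatives agree almost everywhere and are continuous
on the closed interval, so they agree at every `y₀` in it, endpoints included. -/
theorem IsTraceY.unique {y₀ : ℝ} (hy₀ : y₀ ∈ Icc R.c R.d) {f : L2xy R ι} {g g' : L2x R ι}
    (h : IsTraceY R y₀ f g) (h' : IsTraceY R y₀ f g') : g = g' := by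
  obtain ⟨F, h1, h2, h3⟩ := h
  obtain ⟨F', h1', h2', h3'⟩ := h'
  refine Lp.ext ?_
  filter_upwards [h2, h3, h2', h3', ae_ae_of_ae R (h1.symm.trans h1')] with x e1 e2 e3 e4 e5
  rw [e2, e4]
  exact Measure.eqOn_Icc_of_ae_eq volume R.hcd.ne e5 e1 e3 hy₀

theorem IsTraceX.unique {x₀ : ℝ} (hx₀ : x₀ ∈ Icc R.a R.b) {f : L2xy R ι} {g g' : L2y R ι}
    (h : IsTraceX R x₀ f g) (h' : IsTraceX R x₀ f g') : g = g' := by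
  obtain ⟨F, h1, h2, h3⟩ := h
  obtain ⟨F', h1', h2', h3'⟩ := h'
  refine Lp.ext ?_
  filter_upwards [h2, h3, h2', h3', ae_ae_of_ae' R (h1.symm.trans h1')] with x e1 e2 e3 e4 e5
  rw [e2, e4]
  exact Measure.eqOn_Icc_of_ae_eq volume R.hab.ne e5 e1 e3 hx₀

theorem IsValueAt.unique {s : ℝ × ℝ} (hs : s ∈ Icc R.a R.b ×ˢ Icc R.c R.d) {f : L2xy R ι}
    {v v' : EuclideanSpace ℝ ι} (h : IsValueAt R s f v) (h' : IsValueAt R s f v') : v = v' := by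
  obtain ⟨F, h1, h2, h3⟩ := h
  obtain ⟨F', h1', h2', h3'⟩ := h'
  have e : F =ᵐ[(volume : Measure (ℝ × ℝ)).restrict (Icc R.a R.b ×ˢ Icc R.c R.d)] F' := by
    have := h1.symm.trans h1'
    rwa [Rectangle.μxy, Rectangle.μx, Rectangle.μy, Measure.prod_restrict] at this
  rw [← h3, ← h3']
  -- The closed rectangle is the closure of its interior, so agreement almost everywhere of
  -- continuous functions extends to the corners.
  refine Measure.eqOn_of_ae_eq e h2 h2' ?_ hs
  rw [interior_prod_eq, closure_prod_eq, interior_Icc, interior_Icc, closure_Ioo R.hab.ne,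
    closure_Ioo R.hcd.ne]

/-- For almost every `x` the representative `f x + ∫_c^y v(x, ν) dν` is continuous in `y`. So a
trace exists, and uniqueness identifies it with the chosen one. -/
theorem traceY_liftX_add_primY (q : Fin 2) (f : L2x R ι) (v : L2xy R ι) :
    traceY R (R.yEnd q) (liftX R f + primY R v) = f + sideIntY R q v := by
  have h : IsTraceY R (R.yEnd q) (liftX R f + primY R v) (f + sideIntY R q v) := by
    refine ⟨fun x y => f x + ∫ ν in R.c..y, v (x, ν), ?_, ?_, ?_⟩
    · filter_upwards [Lp.coeFn_add (liftX R f) (primY R v), coeFn_liftX R f, coeFn_primY R v]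
        with s h1 h2 h3
      rw [h1, Pi.add_apply, h2, h3]
    · filter_upwards [ae_section_integrable' v] with x hx
      exact continuousOn_const.add (continuousOn_primitive_L2x (R := R.swap) hx)
    · filter_upwards [Lp.coeFn_add f (sideIntY R q v), sideIntY_ae v] with x h1 h2
      rw [h1, Pi.add_apply, h2]
  have hex : ∃ g, IsTraceY R (R.yEnd q) (liftX R f + primY R v) g := ⟨_, h⟩
  rw [traceY, dif_pos hex]
  exact hex.choose_spec.unique (yEnd_mem R q) h

theorem traceX_liftY_add_primX (p : Fin 2) (g : L2y R ι) (v : L2xy R ι) :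
    traceX R (R.xEnd p) (liftY R g + primX R v) = g + sideIntX R p v := by
  have h : IsTraceX R (R.xEnd p) (liftY R g + primX R v) (g + sideIntX R p v) := by
    refine ⟨fun x y => g y + ∫ θ in R.a..x, v (θ, y), ?_, ?_, ?_⟩
    · filter_upwards [Lp.coeFn_add (liftY R g) (primX R v), coeFn_liftY R g, coeFn_primX R v]
        with s h1 h2 h3
      rw [h1, Pi.add_apply, h2, h3]
    · filter_upwards [ae_section_integrable R v] with x hx
      exact continuousOn_const.add (continuousOn_primitive_L2x hx)
    · filter_upwards [Lp.coeFn_add g (sideIntX R p v), sideIntX_ae v] with x h1 h2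
      rw [h1, Pi.add_apply, h2]
  have hex : ∃ g', IsTraceX R (R.xEnd p) (liftY R g + primX R v) g' := ⟨_, h⟩
  rw [traceX, dif_pos hex]
  exact hex.choose_spec.unique (xEnd_mem R p) h

theorem integral_rect_eq {E : Type*} [NormedAddCommGroup E] [NormedSpace ℝ E] {f : ℝ × ℝ → E}
    (hf : Integrable f R.μxy) {x y : ℝ} (hx : x ∈ Icc R.a R.b) (hy : y ∈ Icc R.c R.d) :
    ∫ θ in R.a..x, ∫ ν in R.c..y, f (θ, ν) = ∫ z in Iic x ×ˢ Iic y, f z ∂(R.μxy) := by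
  have hf' : Integrable f ((R.μx.restrict (Iic x)).prod (R.μy.restrict (Iic y))) :=
    Integrable.mono_measure hf
      (Measure.prod_mono Measure.restrict_le_self Measure.restrict_le_self)
  rw [Rectangle.μxy, ← Measure.prod_restrict, integral_prod _ hf', integral_Iic_μx R _ hx]
  refine intervalIntegral.integral_congr fun θ _ => ?_
  exact (integral_Iic_μx R.swap _ hy).symm

/-- Dominated convergence: as `s` moves, the indicator of the quadrant below `s` is discontinuous at
most for points on the two lines through `s`, a null set. -/
theorem continuousOn_integral_rect {E : Type*} [NormedAddCommGroup E] [NormedSpace ℝ E]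
    {f : ℝ × ℝ → E} (hf : Integrable f R.μxy) :
    ContinuousOn (fun s : ℝ × ℝ => ∫ θ in R.a..s.1, ∫ ν in R.c..s.2, f (θ, ν))
      (Icc R.a R.b ×ˢ Icc R.c R.d) := by
  have hc : Continuous fun s : ℝ × ℝ => ∫ z, (Iic s.1 ×ˢ Iic s.2).indicator f z ∂(R.μxy) := by
    refine continuous_iff_continuousAt.2 fun s => ?_
    refine continuousAt_of_dominated (bound := fun z => ‖f z‖) ?_ ?_ hf.norm ?_
    · exact Filter.Eventually.of_forall fun t => hf.aestronglyMeasurable.indicator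
        (measurableSet_Iic.prod measurableSet_Iic)
    · exact Filter.Eventually.of_forall fun t => Filter.Eventually.of_forall fun z =>
        norm_indicator_le_norm_self _ _
    · have h1 : ∀ᵐ z ∂(R.μxy), z.1 ≠ s.1 := by
        refine ae_μxy_fst R (p := fun x => x ≠ s.1) (ae_restrict_of_ae ?_)
        exact compl_mem_ae_iff.2 (measure_singleton s.1)
      have h2 : ∀ᵐ z ∂(R.μxy), z.2 ≠ s.2 := by
        refine ae_μxy_snd R (p := fun x => x ≠ s.2) (ae_restrict_of_ae ?_)
        exact compl_mem_ae_iff.2 (measure_singleton s.2)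
      filter_upwards [h1, h2] with z h1 h2
      have c1 : ContinuousAt (fun t : ℝ × ℝ => t.1) s := continuousAt_fst
      have c2 : ContinuousAt (fun t : ℝ × ℝ => t.2) s := continuousAt_snd
      -- Off the two lines through `s`, membership of `z` in the quadrant below `t` is the same for
      -- all `t` near `s`, so the integrand is locally constant in `t`.
      by_cases hz : z.1 < s.1 ∧ z.2 < s.2
      · refine (continuousAt_const (y := f z)).congr ?_
        filter_upwards [c1.eventually (lt_mem_nhds hz.1), c2.eventually (lt_mem_nhds hz.2)]
          with t ht1 ht2
        rw [indicator_of_mem]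
        exact ⟨ht1.le, ht2.le⟩
      · refine (continuousAt_const (y := (0 : E))).congr ?_
        have hz' : s.1 < z.1 ∨ s.2 < z.2 := by
          rcases h1.lt_or_gt with h | h
          · rcases h2.lt_or_gt with h' | h'
            · exact absurd ⟨h, h'⟩ hz
            · exact Or.inr h'
          · exact Or.inl h
        rcases hz' with h | h
        · filter_upwards [c1.eventually (gt_mem_nhds h)] with t ht
          rw [indicator_of_notMem]
          exact fun hm => not_le.2 ht hm.1
        · filter_upwards [c2.eventually (gt_mem_nhds h)] with t ht
          rw [indicator_of_notMem]
          exact fun hm => not_le.2 ht hm.2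
  refine hc.continuousOn.congr fun s hs => ?_
  rw [integral_rect_eq hf hs.1 hs.2]
  exact (integral_indicator (measurableSet_Iic.prod measurableSet_Iic)).symm

/-- Once the primitives are commuted, `w + ∫k + ∫h + ∬v` is a jointly continuous representative, and
its value at a corner is explicit. -/
theorem valueAt_eq (p q : Fin 2) (w : EuclideanSpace ℝ ι) (k : L2x R ι) (h : L2y R ι)
    (v : L2xy R ι) :
    valueAt R (R.xEnd p) (R.yEnd q)
        (liftX R (constX R w + edgePrimX R k) + primY R (liftY R h + primX R v))
      = w + sideTotX R p k + sideTotY R q h + sideTotX R p (sideIntY R q v) := by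
  set f := liftX R (constX R w + edgePrimX R k) + primY R (liftY R h + primX R v) with hf
  have H : IsValueAt R (R.xEnd p, R.yEnd q) f
      (w + sideTotX R p k + sideTotY R q h + sideTotX R p (sideIntY R q v)) := by
    refine ⟨fun s => w + (∫ θ in R.a..s.1, k θ) + (∫ ν in R.c..s.2, h ν)
      + ∫ θ in R.a..s.1, ∫ ν in R.c..s.2, v (θ, ν), ?_, ?_, ?_⟩
    · have e : f = liftX R (constX R w) + liftX R (edgePrimX R k) + liftY R (edgePrimY R h)
          + primX R (primY R v) := by
        rw [hf, map_add, map_add, primY_liftY, primX_primY]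
        abel
      rw [e]
      filter_upwards [Lp.coeFn_add (liftX R (constX R w) + liftX R (edgePrimX R k)
          + liftY R (edgePrimY R h)) (primX R (primY R v)),
        Lp.coeFn_add (liftX R (constX R w) + liftX R (edgePrimX R k)) (liftY R (edgePrimY R h)),
        Lp.coeFn_add (liftX R (constX R w)) (liftX R (edgePrimX R k)),
        liftX_ae R (coeFn_constX R w),
        liftX_ae R (edgePrimX_ae R (Filter.EventuallyEq.refl _ (k : ℝ → EuclideanSpace ℝ ι))),
        liftY_ae R (edgePrimY_ae R (Filter.EventuallyEq.refl _ (h : ℝ → EuclideanSpace ℝ ι))),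
        primX_ae R (coeFn_primY R v)] with s h1 h2 h3 h4 h5 h6 h7
      rw [h1, Pi.add_apply, h2, Pi.add_apply, h3, Pi.add_apply, h4, h5, h6, h7]
    · refine ((continuousOn_const.add ?_).add ?_).add (continuousOn_integral_rect (integrable_L2 v))
      · exact (continuousOn_primitive_L2x (integrable_L2 k)).comp continuousOn_fst fun s hs => hs.1
      · exact (continuousOn_primitive_L2x (R := R.swap) (integrable_L2 h)).comp continuousOn_snd
          fun s hs => hs.2
    · simp only
      rw [sideTotX_eq, sideTotY_eq, sideTotX_eq]
      congr 1
      exact (intervalIntegral_congr_μx R (sideIntY_ae v) (left_mem_x R) (xEnd_mem R p)).symm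
  have hex : ∃ v, IsValueAt R (R.xEnd p, R.yEnd q) f v := ⟨_, H⟩
  rw [valueAt, dif_pos hex]
  exact hex.choose_spec.unique ⟨xEnd_mem R p, yEnd_mem R q⟩ H

end Trace

/-! ### Reconstruction of a function from boundary data and its highest mixed derivative -/

section Jet

variable (R : Rectangle) (ι : Type) [Fintype ι]

/-- Taylor data: values at the corner `(a, c)`, functions on the edges `y = c` and `x = a`, and
the highest mixed derivative. Indices count the derivatives that remain to be taken. -/
abbrev JetData := (ℕ → ℕ → EuclideanSpace ℝ ι) × (ℕ → L2x R ι) × (ℕ → L2y R ι) × L2xy R ι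

variable {R ι}

/-- With `jetF`, `jetG` and `jetZ`, the coordinates of Taylor data: `W` at the corner, `F` on `y =
c`, `G` on `x = a`, `Z` for the highest mixed derivative. As they are bounded maps, everything
composed from them is bounded. -/
def jetW (p q : ℕ) : JetData R ι →L[ℝ] EuclideanSpace ℝ ι :=
  ContinuousLinearMap.proj q ∘L ContinuousLinearMap.proj (φ := fun _ => ℕ → EuclideanSpace ℝ ι) p
    ∘L ContinuousLinearMap.fst ℝ _ _

def jetF (q : ℕ) : JetData R ι →L[ℝ] L2x R ι :=
  ContinuousLinearMap.proj (φ := fun _ => L2x R ι) q ∘L ContinuousLinearMap.fst ℝ _ _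
    ∘L ContinuousLinearMap.snd ℝ _ _

def jetG (p : ℕ) : JetData R ι →L[ℝ] L2y R ι :=
  ContinuousLinearMap.proj (φ := fun _ => L2y R ι) p ∘L ContinuousLinearMap.fst ℝ _ _
    ∘L ContinuousLinearMap.snd ℝ _ _ ∘L ContinuousLinearMap.snd ℝ _ _

def jetZ : JetData R ι →L[ℝ] L2xy R ι :=
  ContinuousLinearMap.snd ℝ _ _ ∘L ContinuousLinearMap.snd ℝ _ _ ∘L ContinuousLinearMap.snd ℝ _ _

/-- The value on `x = a` of the function with `p + 1` and `q` derivatives remaining. -/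
def jetH (p : ℕ) : ℕ → (JetData R ι →L[ℝ] L2y R ι)
  | 0 => jetG p
  | q + 1 => constY R ∘L jetW p q + edgePrimY R ∘L jetH p q

/-- The value on `y = c` of the function with `p` and `q + 1` derivatives remaining. -/
def jetK (q : ℕ) : ℕ → (JetData R ι →L[ℝ] L2x R ι)
  | 0 => jetF q
  | p + 1 => constX R ∘L jetW p q + edgePrimX R ∘L jetK q p

/-- The function with `0` and `q` derivatives remaining. -/
def jetV₀ : ℕ → (JetData R ι →L[ℝ] L2xy R ι)
  | 0 => jetZ
  | q + 1 => liftX R ∘L jetF q + primY R ∘L jetV₀ q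

/-- The function with `p` and `q` derivatives remaining. -/
def jetV : ℕ → ℕ → (JetData R ι →L[ℝ] L2xy R ι)
  | 0, q => jetV₀ q
  | p + 1, q => liftY R ∘L jetH p q + primX R ∘L jetV p q

theorem jetH_succ (p q : ℕ) (D : JetData R ι) :
    jetH p (q + 1) D = constY R (jetW p q D) + edgePrimY R (jetH p q D) := rfl

theorem jetK_succ (p q : ℕ) (D : JetData R ι) :
    jetK q (p + 1) D = constX R (jetW p q D) + edgePrimX R (jetK q p D) := rfl

theorem jetV_succ_left (p q : ℕ) (D : JetData R ι) :
    jetV (p + 1) q D = liftY R (jetH p q D) + primX R (jetV p q D) := rfl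

/-- The definition of `jetV` integrates in `x` last; this is the mirrored recursion in `y`.
Expanding both orders by induction on `p` leaves the same terms, because primitives commute with
each other and with extension, and constants extend the same way from either edge. -/
theorem jetV_succ_right (p q : ℕ) (D : JetData R ι) :
    jetV p (q + 1) D = liftX R (jetK q p D) + primY R (jetV p q D) := by
  induction p with
  | zero => rfl
  | succ p ih =>
    rw [jetV_succ_left, jetV_succ_left, ih, jetH_succ, jetK_succ]
    simp only [map_add]
    rw [primX_liftX, primY_liftY, primX_primY, liftX_constX]
    abel

/-- One derivative in a variable undoes one step of the recursion in that variable; both recursions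
are available, so the derivatives in `x` are taken first and then those in `y`. -/
theorem isWeakDeriv_jetV (p q i j : ℕ) (D : JetData R ι) :
    IsWeakDeriv R i j (jetV (p + i) (q + j) D) (jetV p q D) := by
  have hx : ∀ i q, IsWeakDeriv R i 0 (jetV (p + i) q D) (jetV p q D) := by
    intro i q
    induction i with
    | zero => exact isWeakDeriv_refl _
    | succ i ih =>
      have h1 := isWeakDeriv_liftY_add_primX (jetH (p + i) q D) (jetV (p + i) q D)
      have h2 := h1.comp ih
      rwa [add_comm 1 i] at h2
  have hy : ∀ j, IsWeakDeriv R 0 j (jetV p (q + j) D) (jetV p q D) := by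
    intro j
    induction j with
    | zero => exact isWeakDeriv_refl _
    | succ j ih =>
      have h1 := isWeakDeriv_liftX_add_primY (jetK (q + j) p D) (jetV p (q + j) D)
      rw [← jetV_succ_right] at h1
      have h2 := h1.comp ih
      rwa [add_comm 1 j] at h2
  have := (hx i (q + j)).comp (hy j)
  rwa [add_zero, zero_add] at this

theorem weakDeriv_jetV (p q i j : ℕ) (D : JetData R ι) :
    weakDeriv R i j (jetV (p + i) (q + j) D) = jetV p q D :=
  (isWeakDeriv_jetV p q i j D).weakDeriv_eq

/-- Every function in `H_m` is reconstructed from its Taylor data. -/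
theorem exists_jetV_eq_of_memH {m : ℕ} {u : L2xy R ι} (hu : MemH R m u) :
    ∃ D : JetData R ι, jetV m m D = u := by
  choose! v hv using hu
  -- The array `v` is indexed by derivatives taken, Taylor data by derivatives remaining, hence the
  -- subtractions. Each entry is the `x`-derivative of its predecessor. Guarding the equation
  -- instead of the existence lets `choose` produce total functions.
  have hx : ∀ p q, ∃ h : L2y R ι, p < m → q ≤ m →
      v (m - (p + 1)) (m - q) = liftY R h + primX R (v (m - p) (m - q)) := by
    intro p q
    by_cases hp : p < m
    · have h1 := hv (m - (p + 1)) (m - q) (by omega) (by omega)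
      have h2 := hv (m - p) (m - q) (by omega) (by omega)
      have e : m - p = m - (p + 1) + 1 := by omega
      rw [e] at h2
      have h3 := IsWeakDeriv.of_comp (k := 1) (l := 0) h1 h2
      rw [← e] at h3
      obtain ⟨h, hh⟩ := exists_liftY_add_primX h3
      exact ⟨h, fun _ _ => hh⟩
    · exact ⟨0, fun h => absurd h hp⟩
  have hy : ∀ p q, ∃ h : L2x R ι, q < m → p ≤ m →
      v (m - p) (m - (q + 1)) = liftX R h + primY R (v (m - p) (m - q)) := by
    intro p q
    by_cases hq : q < m
    · have h1 := hv (m - p) (m - (q + 1)) (by omega) (by omega)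
      have h2 := hv (m - p) (m - q) (by omega) (by omega)
      have e : m - q = m - (q + 1) + 1 := by omega
      rw [e] at h2
      have h3 := IsWeakDeriv.of_comp (k := 0) (l := 1) h1 h2
      rw [← e] at h3
      obtain ⟨h, hh⟩ := exists_liftX_add_primY h3
      exact ⟨h, fun _ _ => hh⟩
    · exact ⟨0, fun h => absurd h hq⟩
  choose h hh using hx
  choose k hk using hy
  -- Expand the entry with `p + 1` and `q + 1` derivatives remaining first in `x` then in `y`, and
  -- the other way round. The double primitives cancel, and what is left equates a function of `x`
  -- alone with a function of `y` alone: the constant is the corner value.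
  have hw : ∀ p q, ∃ w : EuclideanSpace ℝ ι, p < m → q < m →
      h p (q + 1) = constY R w + edgePrimY R (h p q) := by
    intro p q
    by_cases hpq : p < m ∧ q < m
    · obtain ⟨hp, hq⟩ := hpq
      have e1 := hh p (q + 1) hp hq
      rw [hk p q hq hp.le] at e1
      have e2 := hk (p + 1) q hq hp
      rw [hh p q hp hq.le] at e2
      rw [e1] at e2
      simp only [map_add] at e2
      rw [primX_liftX, primY_liftY, primX_primY] at e2
      obtain ⟨w, _, hw⟩ := exists_const_of_liftX_eq_liftY R
        (f := k (p + 1) q - edgePrimX R (k p q)) (g := h p (q + 1) - edgePrimY R (h p q)) (by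
          rw [map_sub, map_sub, sub_eq_sub_iff_add_eq_add]
          have e3 := congrArg (fun z => z - primY R (primX R (v (m - p) (m - q)))) e2
          simp only [← add_assoc, add_sub_cancel_right] at e3
          exact e3.symm)
      exact ⟨w, fun _ _ => by rw [← hw]; abel⟩
    · exact ⟨0, fun h1 h2 => absurd ⟨h1, h2⟩ hpq⟩
  choose w hw using hw
  let D : JetData R ι := (w, fun q => k 0 q, fun p => h p 0, v m m)
  have hH : ∀ q p, p < m → q ≤ m → jetH p q D = h p q := by
    intro q
    induction q with
    | zero => intro p _ _; rfl
    | succ q ih =>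
      intro p hp hq
      rw [jetH_succ, ih p hp (by omega), hw p q hp hq]
      rfl
  have hV0 : ∀ q, q ≤ m → jetV 0 q D = v m (m - q) := by
    intro q
    induction q with
    | zero => intro _; rfl
    | succ q ih =>
      intro hq
      have e := hk 0 q hq (Nat.zero_le _)
      rw [Nat.sub_zero] at e
      rw [jetV_succ_right, ih (by omega), e]
      rfl
  have hV : ∀ p q, p ≤ m → q ≤ m → jetV p q D = v (m - p) (m - q) := by
    intro p
    induction p with
    | zero => intro q _ hq; exact hV0 q hq
    | succ p ih =>
      intro q hp hq
      rw [jetV_succ_left, ih q (by omega) hq, hH q p hp hq, hh p q hp hq]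
  refine ⟨D, ?_⟩
  rw [hV m m le_rfl le_rfl, Nat.sub_self]
  -- The chosen derivative of order zero is `u` itself, by uniqueness.
  exact (hv 0 0 (Nat.zero_le _) (Nat.zero_le _)).unique (isWeakDeriv_refl u)

/-- The value at the corner `(x_P, y_Q)` of the function with `p + 1` and `q + 1` derivatives
remaining. -/
def jetCorner (P Q : Fin 2) (p q : ℕ) : JetData R ι →L[ℝ] EuclideanSpace ℝ ι :=
  jetW p q + sideTotX R P ∘L jetK q p + sideTotY R Q ∘L jetH p q
    + sideTotX R P ∘L sideIntY R Q ∘L jetV p q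

theorem valueAt_jetV (P Q : Fin 2) (p q : ℕ) (D : JetData R ι) :
    valueAt R (R.xEnd P) (R.yEnd Q) (jetV (p + 1) (q + 1) D) = jetCorner P Q p q D := by
  rw [jetV_succ_right, jetV_succ_left, jetK_succ, valueAt_eq]
  rfl

/-- The trace on `y = y_Q` of the function with `0` and `q + 1` derivatives remaining. -/
def jetEdgeY (Q : Fin 2) (q : ℕ) : JetData R ι →L[ℝ] L2x R ι :=
  jetF q + sideIntY R Q ∘L jetV 0 q

theorem traceY_jetV (Q : Fin 2) (q : ℕ) (D : JetData R ι) :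
    traceY R (R.yEnd Q) (jetV 0 (q + 1) D) = jetEdgeY Q q D := by
  rw [jetV_succ_right, traceY_liftX_add_primY]
  rfl

/-- The trace on `x = x_P` of the function with `p + 1` and `0` derivatives remaining. -/
def jetEdgeX (P : Fin 2) (p : ℕ) : JetData R ι →L[ℝ] L2y R ι :=
  jetG p + sideIntX R P ∘L jetV p 0

theorem traceX_jetV (P : Fin 2) (p : ℕ) (D : JetData R ι) :
    traceX R (R.xEnd P) (jetV (p + 1) 0 D) = jetEdgeX P p D := by
  rw [jetV_succ_left, traceX_liftY_add_primX]
  rfl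

end Jet

/-! ### Constant matrices -/

section Mat

variable {ι κ l : Type} [Fintype ι] [Fintype κ] [Fintype l] [DecidableEq ι] [DecidableEq κ]

/-- A constant matrix as a bounded operator on vectors. -/
def mvL (A : Matrix κ ι ℝ) : EuclideanSpace ℝ ι →L[ℝ] EuclideanSpace ℝ κ :=
  LinearMap.toContinuousLinearMap (Matrix.toEuclideanLin A)

theorem mvL_apply (A : Matrix κ ι ℝ) (v : EuclideanSpace ℝ ι) : mvL A v = mv A v := rfl

theorem mv_apply (A : Matrix κ ι ℝ) (v : EuclideanSpace ℝ ι) (i : κ) :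
    mv A v i = ∑ j, A i j * v j := rfl

variable {α : Type} [MeasurableSpace α] {μ : Measure α}

theorem matOp_matOp (A : Matrix l κ ℝ) (B : Matrix κ ι ℝ) (u : Lp (EuclideanSpace ℝ ι) 2 μ) :
    matOp μ A (matOp μ B u) = matOp μ (A * B) u := by
  refine Lp.ext ?_
  filter_upwards [coeFn_matOp μ A (matOp μ B u), coeFn_matOp μ B u, coeFn_matOp μ (A * B) u]
    with s h1 h2 h3
  rw [h1, h2, h3]
  exact congrArg (WithLp.toLp 2) (Matrix.mulVec_mulVec _ _ _)

theorem matOp_add (A B : Matrix κ ι ℝ) (u : Lp (EuclideanSpace ℝ ι) 2 μ) :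
    matOp μ (A + B) u = matOp μ A u + matOp μ B u := by
  refine Lp.ext ?_
  filter_upwards [coeFn_matOp μ (A + B) u, coeFn_matOp μ A u, coeFn_matOp μ B u,
    Lp.coeFn_add (matOp μ A u) (matOp μ B u)] with s h1 h2 h3 h4
  rw [h1, h4, Pi.add_apply, h2, h3]
  exact congrArg (WithLp.toLp 2) (Matrix.add_mulVec _ _ _)

theorem matOp_one (u : Lp (EuclideanSpace ℝ ι) 2 μ) : matOp μ (1 : Matrix ι ι ℝ) u = u := by
  refine Lp.ext ?_
  filter_upwards [coeFn_matOp μ (1 : Matrix ι ι ℝ) u] with s h1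
  rw [h1]
  exact congrArg (WithLp.toLp 2) (Matrix.one_mulVec _)

theorem matOp_zero (u : Lp (EuclideanSpace ℝ ι) 2 μ) : matOp μ (0 : Matrix κ ι ℝ) u = 0 := by
  refine Lp.ext ?_
  filter_upwards [coeFn_matOp μ (0 : Matrix κ ι ℝ) u,
    Lp.coeFn_zero (EuclideanSpace ℝ κ) 2 μ] with s h1 h2
  rw [h1, h2]
  exact congrArg (WithLp.toLp 2) (Matrix.zero_mulVec _)

end Mat

/-! ### States and boundary values in terms of core boundary values and the fundamental state -/

section State

variable (n₀ n₁ n₂ : ℕ)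

theorem T00_add_sel : T00 n₀ n₁ n₂ + (sel1 n₀ n₁ n₂)ᵀ * sel1 n₀ n₁ n₂
    + (sel2 n₀ n₁ n₂)ᵀ * sel2 n₀ n₁ n₂ = 1 := by
  ext i j
  rcases i with i | i | i <;> rcases j with j | j | j <;>
    simp [T00, sel1, sel2, kron, Matrix.mul_apply, Matrix.one_apply, eq_comm]

theorem sel1_mul_T00 : sel1 n₀ n₁ n₂ * T00 n₀ n₁ n₂ = 0 := by
  ext i j
  rcases j with j | j | j <;> simp [T00, sel1, Matrix.mul_apply]

theorem sel2_mul_T00 : sel2 n₀ n₁ n₂ * T00 n₀ n₁ n₂ = 0 := by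
  ext i j
  rcases j with j | j | j <;> simp [T00, sel2, Matrix.mul_apply]

theorem T00_mul_T00 : T00 n₀ n₁ n₂ * T00 n₀ n₁ n₂ = T00 n₀ n₁ n₂ := by
  ext i j
  rcases i with i | i | i <;> rcases j with j | j | j <;> simp [T00, kron, Matrix.mul_apply]

theorem T00_mul_sel1 : T00 n₀ n₁ n₂ * (sel1 n₀ n₁ n₂)ᵀ = 0 := by
  ext i j
  rcases i with i | i | i <;> simp [T00, sel1, Matrix.mul_apply]

theorem T00_mul_sel2 : T00 n₀ n₁ n₂ * (sel2 n₀ n₁ n₂)ᵀ = 0 := by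
  ext i j
  rcases i with i | i | i <;> simp [T00, sel2, Matrix.mul_apply]

theorem sel1_mul_sel1 : sel1 n₀ n₁ n₂ * (sel1 n₀ n₁ n₂)ᵀ = 1 := by
  ext i j
  simp [sel1, Matrix.mul_apply, Matrix.one_apply, eq_comm]

theorem sel2_mul_sel2 : sel2 n₀ n₁ n₂ * (sel2 n₀ n₁ n₂)ᵀ = 1 := by
  ext i j
  simp [sel2, Matrix.mul_apply, Matrix.one_apply, eq_comm]

theorem sel1_mul_sel2 : sel1 n₀ n₁ n₂ * (sel2 n₀ n₁ n₂)ᵀ = 0 := by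
  ext i j
  simp [sel1, sel2, Matrix.mul_apply]

theorem sel2_mul_sel1 : sel2 n₀ n₁ n₂ * (sel1 n₀ n₁ n₂)ᵀ = 0 := by
  ext i j
  simp [sel1, sel2, Matrix.mul_apply]

/-- Selection of the corner value of `u₁`. -/
def selW1 : Matrix (Fin n₁) (Core0 n₁ n₂) ℝ := Matrix.of fun i t => if t = .inl i then 1 else 0

/-- Selection of the corner value of `∂ₓᵏ ∂_yˡ u₂`. -/
def selW2 (k l : Fin 2) : Matrix (Fin n₂) (Core0 n₁ n₂) ℝ :=
  Matrix.of fun i t => if t = .inr (k, l, i) then 1 else 0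

/-- Selection of the edge value of the derivative of `u₁`. -/
def selF1 : Matrix (Fin n₁) (Core1 n₁ n₂) ℝ := Matrix.of fun i t => if t = .inl i then 1 else 0

/-- Selection of the edge value of the derivatives of `u₂` with index `l`. -/
def selF2 (l : Fin 2) : Matrix (Fin n₂) (Core1 n₁ n₂) ℝ :=
  Matrix.of fun i t => if t = .inr (l, i) then 1 else 0

theorem selF1_mul_selF1 : selF1 n₁ n₂ * (selF1 n₁ n₂)ᵀ = 1 := by
  ext i j
  simp [selF1, Matrix.mul_apply, Matrix.one_apply, eq_comm]

theorem selF1_mul_selF2 (l : Fin 2) : selF1 n₁ n₂ * (selF2 n₁ n₂ l)ᵀ = 0 := by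
  ext i j
  simp [selF1, selF2, Matrix.mul_apply]

theorem selF2_mul_selF1 (l : Fin 2) : selF2 n₁ n₂ l * (selF1 n₁ n₂)ᵀ = 0 := by
  ext i j
  simp [selF1, selF2, Matrix.mul_apply]

theorem selF2_mul_selF2 (k l : Fin 2) :
    selF2 n₁ n₂ k * (selF2 n₁ n₂ l)ᵀ = if k = l then 1 else 0 := by
  ext i j
  by_cases h : k = l
  · simp [selF2, Matrix.mul_apply, Matrix.one_apply, h, eq_comm]
  · simp [selF2, Matrix.mul_apply, h, Ne.symm h]

/-- The number of derivatives taken when `p + 1` out of two remain. -/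
def ord (p : ℕ) : Fin 2 := if p = 0 then 1 else 0

variable (R : Rectangle)

/-- Core boundary values and fundamental states. -/
abbrev CoreState :=
  RL R (Core0 n₁ n₂) (Core1 n₁ n₂) × L2xy R (St n₀ n₁ n₂)

/-- The Taylor data of `u₁`. -/
def data1 : CoreState n₀ n₁ n₂ R →L[ℝ] JetData R (Fin n₁) :=
  ((ContinuousLinearMap.pi fun _ => ContinuousLinearMap.pi fun _ =>
    mvL (selW1 n₁ n₂) ∘L ContinuousLinearMap.fst ℝ _ _) ∘L ContinuousLinearMap.fst ℝ _ _).prod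
  (((ContinuousLinearMap.pi fun _ => matOp R.μx (selF1 n₁ n₂) ∘L ContinuousLinearMap.fst ℝ _ _)
    ∘L ContinuousLinearMap.snd ℝ _ _ ∘L ContinuousLinearMap.fst ℝ _ _).prod
  (((ContinuousLinearMap.pi fun _ => matOp R.μy (selF1 n₁ n₂) ∘L ContinuousLinearMap.snd ℝ _ _)
    ∘L ContinuousLinearMap.snd ℝ _ _ ∘L ContinuousLinearMap.fst ℝ _ _).prod
  (matOp R.μxy (sel1 n₀ n₁ n₂) ∘L ContinuousLinearMap.snd ℝ _ _)))

/-- The Taylor data of `u₂`. -/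
def data2 : CoreState n₀ n₁ n₂ R →L[ℝ] JetData R (Fin n₂) :=
  ((ContinuousLinearMap.pi fun p => ContinuousLinearMap.pi fun q =>
    mvL (selW2 n₁ n₂ (ord p) (ord q)) ∘L ContinuousLinearMap.fst ℝ _ _)
    ∘L ContinuousLinearMap.fst ℝ _ _).prod
  (((ContinuousLinearMap.pi fun q =>
      matOp R.μx (selF2 n₁ n₂ (ord q)) ∘L ContinuousLinearMap.fst ℝ _ _)
    ∘L ContinuousLinearMap.snd ℝ _ _ ∘L ContinuousLinearMap.fst ℝ _ _).prod
  (((ContinuousLinearMap.pi fun p =>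
      matOp R.μy (selF2 n₁ n₂ (ord p)) ∘L ContinuousLinearMap.snd ℝ _ _)
    ∘L ContinuousLinearMap.snd ℝ _ _ ∘L ContinuousLinearMap.fst ℝ _ _).prod
  (matOp R.μxy (sel2 n₀ n₁ n₂) ∘L ContinuousLinearMap.snd ℝ _ _)))

/-- The state with given core boundary values and fundamental state: `𝒦₁ w + 𝒦₂ û`. -/
def stateMap : CoreState n₀ n₁ n₂ R →L[ℝ] L2xy R (St n₀ n₁ n₂) :=
  matOp R.μxy (T00 n₀ n₁ n₂) ∘L ContinuousLinearMap.snd ℝ _ _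
    + matOp R.μxy (sel1 n₀ n₁ n₂)ᵀ ∘L jetV 1 1 ∘L data1 n₀ n₁ n₂ R
    + matOp R.μxy (sel2 n₀ n₁ n₂)ᵀ ∘L jetV 2 2 ∘L data2 n₀ n₁ n₂ R

/-- The boundary values of that state: `ℋ₁ w + ℋ₂ û`. -/
def bdryMap : CoreState n₀ n₁ n₂ R →L[ℝ] RL R (Full0 n₁ n₂) (Full1 n₁ n₂) :=
  ((EuclideanSpace.equiv (Full0 n₁ n₂) ℝ).symm.toContinuousLinearMap ∘L
    ContinuousLinearMap.pi fun
      | .inl (p, q, i) => EuclideanSpace.proj i ∘L jetCorner p q 0 0 ∘L data1 n₀ n₁ n₂ R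
      | .inr (p, q, r, s, i) =>
        -- After `r` of two derivatives `(1 - r) + 1` remain, and `jetCorner` is indexed by the
        -- number remaining less one.
        EuclideanSpace.proj i ∘L jetCorner p q (1 - r) (1 - s) ∘L data2 n₀ n₁ n₂ R).prod
  ((∑ q, matOp R.μx (emb1 n₁ n₂ q) ∘L jetEdgeY q 0 ∘L data1 n₀ n₁ n₂ R
      + ∑ q, ∑ s : Fin 2,
        matOp R.μx (emb2 n₁ n₂ q s) ∘L jetEdgeY q (1 - s) ∘L data2 n₀ n₁ n₂ R).prod
    (∑ p, matOp R.μy (emb1 n₁ n₂ p) ∘L jetEdgeX p 0 ∘L data1 n₀ n₁ n₂ R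
      + ∑ p, ∑ s : Fin 2,
        matOp R.μy (emb2 n₁ n₂ p s) ∘L jetEdgeX p (1 - s) ∘L data2 n₀ n₁ n₂ R))

variable {n₀ n₁ n₂ R}

theorem stateMap_apply (z : CoreState n₀ n₁ n₂ R) :
    stateMap n₀ n₁ n₂ R z = matOp R.μxy (T00 n₀ n₁ n₂) z.2
      + matOp R.μxy (sel1 n₀ n₁ n₂)ᵀ (jetV 1 1 (data1 n₀ n₁ n₂ R z))
      + matOp R.μxy (sel2 n₀ n₁ n₂)ᵀ (jetV 2 2 (data2 n₀ n₁ n₂ R z)) := rfl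

theorem sel1_stateMap (z : CoreState n₀ n₁ n₂ R) :
    matOp R.μxy (sel1 n₀ n₁ n₂) (stateMap n₀ n₁ n₂ R z) = jetV 1 1 (data1 n₀ n₁ n₂ R z) := by
  rw [stateMap_apply, map_add, map_add, matOp_matOp, matOp_matOp, matOp_matOp, sel1_mul_T00,
    sel1_mul_sel1, sel1_mul_sel2, matOp_zero, matOp_one, matOp_zero, zero_add, add_zero]

theorem sel2_stateMap (z : CoreState n₀ n₁ n₂ R) :
    matOp R.μxy (sel2 n₀ n₁ n₂) (stateMap n₀ n₁ n₂ R z) = jetV 2 2 (data2 n₀ n₁ n₂ R z) := by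
  rw [stateMap_apply, map_add, map_add, matOp_matOp, matOp_matOp, matOp_matOp, sel2_mul_T00,
    sel2_mul_sel1, sel2_mul_sel2, matOp_zero, matOp_one, matOp_zero, zero_add, zero_add]

/-- The components `u₁`, `u₂` of the state are `jetV 1 1` and `jetV 2 2`; their derivatives are jets
with fewer derivatives remaining, whose traces and corner values are known. -/
theorem bdry_stateMap (z : CoreState n₀ n₁ n₂ R) :
    bdry R (stateMap n₀ n₁ n₂ R z) = bdryMap n₀ n₁ n₂ R z := by
  unfold bdry
  simp only [sel1_stateMap, sel2_stateMap]
  have e10 := weakDeriv_jetV 0 1 1 0 (data1 n₀ n₁ n₂ R z)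
  have e01 := weakDeriv_jetV 1 0 0 1 (data1 n₀ n₁ n₂ R z)
  have e2 : ∀ r s : Fin 2, weakDeriv R r s (jetV 2 2 (data2 n₀ n₁ n₂ R z))
      = jetV ((1 - r) + 1) ((1 - s) + 1) (data2 n₀ n₁ n₂ R z) := by
    intro r s
    have := weakDeriv_jetV ((1 - r) + 1) ((1 - s) + 1) r s (data2 n₀ n₁ n₂ R z)
    -- For numerals `r`, `s` the index `(1 - r) + 1 + r` computes to `2`.
    fin_cases r <;> fin_cases s <;> exact this
  have e2x : ∀ s : Fin 2, weakDeriv R 2 s (jetV 2 2 (data2 n₀ n₁ n₂ R z))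
      = jetV 0 ((1 - s) + 1) (data2 n₀ n₁ n₂ R z) := by
    intro s
    have := weakDeriv_jetV 0 ((1 - s) + 1) 2 s (data2 n₀ n₁ n₂ R z)
    fin_cases s <;> exact this
  have e2y : ∀ s : Fin 2, weakDeriv R s 2 (jetV 2 2 (data2 n₀ n₁ n₂ R z))
      = jetV ((1 - s) + 1) 0 (data2 n₀ n₁ n₂ R z) := by
    intro s
    have := weakDeriv_jetV ((1 - s) + 1) 0 s 2 (data2 n₀ n₁ n₂ R z)
    fin_cases s <;> exact this
  refine Prod.ext ?_ (Prod.ext ?_ ?_)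
  · refine PiLp.ext fun t => ?_
    rcases t with ⟨p, q, i⟩ | ⟨p, q, r, s, i⟩
    · exact congrArg (fun v : EuclideanSpace ℝ (Fin n₁) => v i)
        (valueAt_jetV p q 0 0 (data1 n₀ n₁ n₂ R z))
    · simp only [e2, valueAt_jetV]
      rfl
  · simp only [e2x, traceY_jetV]
    rw [show weakDeriv R 1 0 (jetV 1 1 (data1 n₀ n₁ n₂ R z)) = _ from e10]
    simp only [traceY_jetV (q := 0)]
    simp [bdryMap]
  · simp only [e2y, traceX_jetV]
    rw [show weakDeriv R 0 1 (jetV 1 1 (data1 n₀ n₁ n₂ R z)) = _ from e01]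
    simp only [traceX_jetV (p := 0)]
    simp [bdryMap]

end State

/-! ### Every admissible state is reconstructed, and has the derivatives occurring in the PDE -/

section Recon

variable {R : Rectangle} {n₀ n₁ n₂ : ℕ}

/-- Taylor data are indexed by all of `ℕ`, but `jetV m m` reads only indices below `m`; this
discards the arbitrary values beyond. -/
theorem jetV_congr {ι : Type} [Fintype ι] {m : ℕ} {D D' : JetData R ι}
    (hw : ∀ p q, p < m → q < m → jetW p q D = jetW p q D')
    (hf : ∀ q, q < m → jetF q D = jetF q D') (hg : ∀ p, p < m → jetG p D = jetG p D')
    (hz : jetZ D = jetZ D') : jetV m m D = jetV m m D' := by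
  have hH : ∀ q p, p < m → q ≤ m → jetH p q D = jetH p q D' := by
    intro q
    induction q with
    | zero => exact fun p hp _ => hg p hp
    | succ q ih =>
      intro p hp hq
      rw [jetH_succ, jetH_succ, ih p hp (by omega), hw p q hp hq]
  have hV0 : ∀ q, q ≤ m → jetV 0 q D = jetV 0 q D' := by
    intro q
    induction q with
    | zero => exact fun _ => hz
    | succ q ih =>
      intro hq
      rw [jetV_succ_right, jetV_succ_right, ih (by omega)]
      exact congrArg (fun f => liftX R f + _) (hf q hq)
  have hV : ∀ p q, p ≤ m → q ≤ m → jetV p q D = jetV p q D' := by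
    intro p
    induction p with
    | zero => exact fun q _ hq => hV0 q hq
    | succ p ih =>
      intro q hp hq
      rw [jetV_succ_left, jetV_succ_left, ih q (by omega) hq, hH q p hp hq]
  exact hV m m le_rfl le_rfl

/-- Every function of the required regularity is reconstructed from its core boundary values and
its fundamental state. -/
theorem exists_stateMap_eq {u : L2xy R (St n₀ n₁ n₂)}
    (h1 : MemH R 1 (matOp R.μxy (sel1 n₀ n₁ n₂) u))
    (h2 : MemH R 2 (matOp R.μxy (sel2 n₀ n₁ n₂) u)) :
    ∃ z : CoreState n₀ n₁ n₂ R, stateMap n₀ n₁ n₂ R z = u := by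
  obtain ⟨D₁, hD₁⟩ := exists_jetV_eq_of_memH h1
  obtain ⟨D₂, hD₂⟩ := exists_jetV_eq_of_memH h2
  -- Core values of `u₂` are indexed by derivatives taken, Taylor data by derivatives remaining,
  -- hence `1 - k` and `1 - l`; the same reversal pairs `selF2 0` with index `1` below.
  let w : EuclideanSpace ℝ (Core0 n₁ n₂) := WithLp.toLp 2 fun
    | .inl i => jetW 0 0 D₁ i
    | .inr (k, l, i) => jetW (1 - k) (1 - l) D₂ i
  let f : L2x R (Core1 n₁ n₂) := matOp R.μx (selF1 n₁ n₂)ᵀ (jetF 0 D₁)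
    + (matOp R.μx (selF2 n₁ n₂ 0)ᵀ (jetF 1 D₂) + matOp R.μx (selF2 n₁ n₂ 1)ᵀ (jetF 0 D₂))
  let g : L2y R (Core1 n₁ n₂) := matOp R.μy (selF1 n₁ n₂)ᵀ (jetG 0 D₁)
    + (matOp R.μy (selF2 n₁ n₂ 0)ᵀ (jetG 1 D₂) + matOp R.μy (selF2 n₁ n₂ 1)ᵀ (jetG 0 D₂))
  -- This is the fundamental state `𝒟u`: `u₀` together with the highest mixed derivatives of `u₁`
  -- and `u₂`.
  let v : L2xy R (St n₀ n₁ n₂) := matOp R.μxy (T00 n₀ n₁ n₂) u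
    + matOp R.μxy (sel1 n₀ n₁ n₂)ᵀ (jetZ D₁) + matOp R.μxy (sel2 n₀ n₁ n₂)ᵀ (jetZ D₂)
  have hw1 : mvL (selW1 n₁ n₂) w = jetW 0 0 D₁ := by
    refine PiLp.ext fun i => ?_
    rw [mvL_apply, mv_apply]
    simp [selW1, w]
  have hw2 : ∀ k l : Fin 2, mvL (selW2 n₁ n₂ k l) w = jetW (1 - k) (1 - l) D₂ := by
    intro k l
    refine PiLp.ext fun i => ?_
    rw [mvL_apply, mv_apply]
    simp [selW2, w]
  have hf1 : matOp R.μx (selF1 n₁ n₂) f = jetF 0 D₁ := by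
    simp only [f, map_add]
    simp [matOp_matOp, selF1_mul_selF1, selF1_mul_selF2, matOp_zero, matOp_one]
  have hf20 : matOp R.μx (selF2 n₁ n₂ 0) f = jetF 1 D₂ := by
    simp only [f, map_add]
    simp [matOp_matOp, selF2_mul_selF1, selF2_mul_selF2, matOp_zero, matOp_one]
  have hf21 : matOp R.μx (selF2 n₁ n₂ 1) f = jetF 0 D₂ := by
    simp only [f, map_add]
    simp [matOp_matOp, selF2_mul_selF1, selF2_mul_selF2, matOp_zero, matOp_one]
  have hg1 : matOp R.μy (selF1 n₁ n₂) g = jetG 0 D₁ := by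
    simp only [g, map_add]
    simp [matOp_matOp, selF1_mul_selF1, selF1_mul_selF2, matOp_zero, matOp_one]
  have hg20 : matOp R.μy (selF2 n₁ n₂ 0) g = jetG 1 D₂ := by
    simp only [g, map_add]
    simp [matOp_matOp, selF2_mul_selF1, selF2_mul_selF2, matOp_zero, matOp_one]
  have hg21 : matOp R.μy (selF2 n₁ n₂ 1) g = jetG 0 D₂ := by
    simp only [g, map_add]
    simp [matOp_matOp, selF2_mul_selF1, selF2_mul_selF2, matOp_zero, matOp_one]
  have hv0 : matOp R.μxy (T00 n₀ n₁ n₂) v = matOp R.μxy (T00 n₀ n₁ n₂) u := by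
    simp only [v, map_add]
    rw [matOp_matOp, matOp_matOp, matOp_matOp, T00_mul_T00, T00_mul_sel1, T00_mul_sel2,
      matOp_zero, matOp_zero, add_zero, add_zero]
  have hv1 : matOp R.μxy (sel1 n₀ n₁ n₂) v = jetZ D₁ := by
    simp only [v, map_add]
    rw [matOp_matOp, matOp_matOp, matOp_matOp, sel1_mul_T00, sel1_mul_sel1, sel1_mul_sel2,
      matOp_zero, matOp_zero, matOp_one, add_zero, zero_add]
  have hv2 : matOp R.μxy (sel2 n₀ n₁ n₂) v = jetZ D₂ := by
    simp only [v, map_add]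
    rw [matOp_matOp, matOp_matOp, matOp_matOp, sel2_mul_T00, sel2_mul_sel1, sel2_mul_sel2,
      matOp_zero, matOp_zero, matOp_one, zero_add, zero_add]
  refine ⟨((w, f, g), v), ?_⟩
  have e1 : jetV 1 1 (data1 n₀ n₁ n₂ R ((w, f, g), v)) = jetV 1 1 D₁ := by
    refine jetV_congr (fun p q hp hq => ?_) (fun q hq => ?_) (fun p hp => ?_) hv1
    · obtain rfl : p = 0 := by omega
      obtain rfl : q = 0 := by omega
      exact hw1
    · obtain rfl : q = 0 := by omega
      exact hf1
    · obtain rfl : p = 0 := by omega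
      exact hg1
  have e2 : jetV 2 2 (data2 n₀ n₁ n₂ R ((w, f, g), v)) = jetV 2 2 D₂ := by
    refine jetV_congr (fun p q hp hq => ?_) (fun q hq => ?_) (fun p hp => ?_) hv2
    · have := hw2 (ord p) (ord q)
      interval_cases p <;> interval_cases q <;> exact this
    · interval_cases q
      exacts [hf21, hf20]
    · interval_cases p
      exacts [hg21, hg20]
  rw [stateMap_apply, e1, e2, hD₁, hD₂]
  simp only
  rw [hv0, matOp_matOp, matOp_matOp, ← matOp_add, ← matOp_add, T00_add_sel, matOp_one]

theorem exists_isWeakDeriv_jetV {ι : Type} [Fintype ι] {m i j : ℕ} (hi : i ≤ m) (hj : j ≤ m)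
    (D : JetData R ι) : ∃ v, IsWeakDeriv R i j (jetV m m D) v := by
  have h := isWeakDeriv_jetV (m - i) (m - j) i j D
  rw [Nat.sub_add_cancel hi, Nat.sub_add_cancel hj] at h
  exact ⟨_, h⟩

/-- Components of class at least `1` do not involve `u₀`, for which no derivative is available. -/
theorem selN_mul_T00 {m : ℕ} (hm : 1 ≤ m) : selN n₀ n₁ n₂ m * T00 n₀ n₁ n₂ = 0 := by
  ext ⟨i, hi⟩ j
  rcases i with i | i | i
  · simp only [St.order] at hi
    omega
  all_goals rcases j with j | j | j <;> simp [T00, selN, Matrix.mul_apply]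

theorem selN_mul_sel1 {m : ℕ} (hm : 2 ≤ m) : selN n₀ n₁ n₂ m * (sel1 n₀ n₁ n₂)ᵀ = 0 := by
  ext ⟨i, hi⟩ j
  rcases i with i | i | i
  · simp only [St.order] at hi
    omega
  · simp only [St.order] at hi
    omega
  · simp [sel1, selN, Matrix.mul_apply]

/-- The derivatives that occur in the PDE exist for every reconstructed state. -/
theorem exists_isWeakDeriv_selN_stateMap (z : CoreState n₀ n₁ n₂ R) (i j : Fin 3) :
    ∃ v, IsWeakDeriv R i j
      (matOp R.μxy (selN n₀ n₁ n₂ (max i.val j.val)) (stateMap n₀ n₁ n₂ R z)) v := by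
  set m := max i.val j.val with hm
  have hi : i.val ≤ m := le_max_left _ _
  have hj : j.val ≤ m := le_max_right _ _
  have hm2 : m ≤ 2 := by omega
  -- Order `0` needs no derivative; at order `1` both `u₁` and `u₂` occur, with at most one
  -- derivative in each variable; at order `2` only `u₂` is selected.
  rcases Nat.eq_zero_or_pos m with h0 | h1
  · have hi0 : i.val = 0 := by omega
    have hj0 : j.val = 0 := by omega
    rw [hi0, hj0]
    exact ⟨_, isWeakDeriv_refl _⟩
  · obtain ⟨v₂, hv₂⟩ := exists_isWeakDeriv_jetV (m := 2) (hi.trans hm2) (hj.trans hm2)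
      (data2 n₀ n₁ n₂ R z)
    rw [stateMap_apply, map_add, map_add, matOp_matOp, matOp_matOp, matOp_matOp,
      selN_mul_T00 h1, matOp_zero, zero_add]
    rcases Nat.lt_or_ge m 2 with h2 | h2
    · obtain ⟨v₁, hv₁⟩ := exists_isWeakDeriv_jetV (m := 1) (by omega : i.val ≤ 1)
        (by omega : j.val ≤ 1) (data1 n₀ n₁ n₂ R z)
      exact ⟨_, (hv₁.matOp _).add (hv₂.matOp _)⟩
    · rw [selN_mul_sel1 h2, matOp_zero, zero_add]
      exact ⟨_, hv₂.matOp _⟩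

end Recon

/-! ### Explicit formulas for iterated primitives -/

section Formulas

variable {R : Rectangle}

/-! ### Repeated primitives as integrals with polynomial kernels -/

section Prim

variable {E : Type*} [NormedAddCommGroup E] [NormedSpace ℝ E] [CompleteSpace E]

theorem edgePrimX_constX_ae (w : E) :
    edgePrimX R (constX R w) =ᵐ[R.μx] fun x => (x - R.a) • w := by
  filter_upwards [edgePrimX_ae R (coeFn_constX R w)] with x hx
  rw [hx, intervalIntegral.integral_const]

theorem edgePrimY_constY_ae (w : E) :
    edgePrimY R (constY R w) =ᵐ[R.μy] fun y => (y - R.c) • w :=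
  edgePrimX_constX_ae (R := R.swap) w

theorem integrableOn_Ioc_of_μx {f : ℝ → E} (hf : Integrable f R.μx) {x : ℝ}
    (hx : x ∈ Icc R.a R.b) : IntegrableOn f (Ioc R.a x) :=
  IntegrableOn.mono_set (t := Icc R.a R.b) hf
    (Ioc_subset_Icc_self.trans (Icc_subset_Icc_right hx.2))

theorem edgePrimX_edgePrimX_ae {f : Lp E 2 R.μx} {F : ℝ → E} (h : f =ᵐ[R.μx] F) :
    edgePrimX R (edgePrimX R f) =ᵐ[R.μx] fun x => ∫ θ in R.a..x, (x - θ) • F θ := by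
  filter_upwards [edgePrimX_ae R (edgePrimX_ae R h), ae_μx R] with x h1 h2
  rw [h1, integral_primitive h2.1
    (integrableOn_Ioc_of_μx ((integrable_L2 f).congr h) h2)]

theorem edgePrimY_edgePrimY_ae {f : Lp E 2 R.μy} {F : ℝ → E} (h : f =ᵐ[R.μy] F) :
    edgePrimY R (edgePrimY R f) =ᵐ[R.μy] fun y => ∫ ν in R.c..y, (y - ν) • F ν :=
  edgePrimX_edgePrimX_ae (R := R.swap) h

theorem primX_liftY_ae {f : Lp E 2 R.μy} {F : ℝ → E} (h : f =ᵐ[R.μy] F) :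
    primX R (liftY R f) =ᵐ[R.μxy] fun s => (s.1 - R.a) • F s.2 := by
  filter_upwards [primX_ae R (liftY_ae R h)] with s hs
  rw [hs, intervalIntegral.integral_const]

theorem primY_liftX_ae {f : Lp E 2 R.μx} {F : ℝ → E} (h : f =ᵐ[R.μx] F) :
    primY R (liftX R f) =ᵐ[R.μxy] fun s => (s.2 - R.c) • F s.1 := by
  filter_upwards [primY_ae R (liftX_ae R h)] with s hs
  rw [hs, intervalIntegral.integral_const]

theorem primX_primX_ae (f : Lp E 2 R.μxy) :
    primX R (primX R f) =ᵐ[R.μxy] fun s => ∫ θ in R.a..s.1, (s.1 - θ) • f (θ, s.2) := by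
  filter_upwards [primX_ae R (coeFn_primX R f), ae_μxy_fst R (ae_μx R),
    ae_μxy_snd R (ae_section_integrable R f)] with s h1 h2 h3
  rw [h1]
  exact integral_primitive h2.1 (integrableOn_Ioc_of_μx h3 h2)

theorem primY_primY_ae (f : Lp E 2 R.μxy) :
    primY R (primY R f) =ᵐ[R.μxy] fun s => ∫ ν in R.c..s.2, (s.2 - ν) • f (s.1, ν) := by
  filter_upwards [primY_ae R (coeFn_primY R f), ae_μxy_snd R (ae_μy R),
    ae_μxy_fst R (Integrable.prod_right_ae (μ := R.μx) (ν := R.μy) (integrable_L2 f))]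
    with s h1 h2 h3
  rw [h1]
  exact integral_primitive h2.1 (integrableOn_Ioc_of_μx (R := R.swap) h3 h2)

theorem primX_primX_primY_primY_ae (f : Lp E 2 R.μxy) :
    primX R (primX R (primY R (primY R f))) =ᵐ[R.μxy] fun s =>
      ∫ θ in R.a..s.1, ∫ ν in R.c..s.2, ((s.1 - θ) * (s.2 - ν)) • f (θ, ν) := by
  filter_upwards [primX_primX_ae (primY R (primY R f)), ae_section_eq R (primY_primY_ae f),
    ae_μxy_fst R (ae_μx R)] with s h1 h2 h3
  rw [h1]
  refine intervalIntegral_congr_μx R ?_ (left_mem_x R) h3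
  filter_upwards [h2] with θ hθ
  rw [hθ, ← intervalIntegral.integral_smul]
  simp only [mul_smul]

end Prim

/-! ### Integrability and integrals of vector-valued functions by components -/

section Comp

variable {ι κ : Type} [Fintype ι] [Fintype κ]

theorem intervalIntegral_apply {F : ℝ → EuclideanSpace ℝ ι} {a b : ℝ}
    (hF : IntervalIntegrable F volume a b) (i : ι) :
    (∫ θ in a..b, F θ) i = ∫ θ in a..b, F θ i :=
  ((EuclideanSpace.proj i : EuclideanSpace ℝ ι →L[ℝ] ℝ).intervalIntegral_comp_comm hF).symm

theorem integral_apply {α : Type*} [MeasurableSpace α] {μ : Measure α}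
    {F : α → EuclideanSpace ℝ ι} (hF : Integrable F μ) (i : ι) :
    (∫ θ, F θ ∂μ) i = ∫ θ, F θ i ∂μ :=
  ((EuclideanSpace.proj i : EuclideanSpace ℝ ι →L[ℝ] ℝ).integral_comp_comm hF).symm

theorem integrable_apply {α : Type*} [MeasurableSpace α] {μ : Measure α}
    {F : α → EuclideanSpace ℝ ι} (hF : Integrable F μ) (i : ι) : Integrable (fun θ => F θ i) μ :=
  (EuclideanSpace.proj i : EuclideanSpace ℝ ι →L[ℝ] ℝ).integrable_comp hF

theorem integrable_of_apply {α : Type*} [MeasurableSpace α] {μ : Measure α}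
    {F : α → EuclideanSpace ℝ ι} (hF : ∀ i, Integrable (fun θ => F θ i) μ) : Integrable F μ := by
  have h : Integrable (fun θ => (F θ).ofLp) μ := Integrable.of_eval hF
  exact (EuclideanSpace.equiv ι ℝ).symm.toContinuousLinearMap.integrable_comp h

theorem integrable_continuous_mul_μx {c : ℝ → ℝ} (hc : Continuous c) {h : ℝ → ℝ}
    (hh : Integrable h R.μx) : Integrable (fun θ => c θ * h θ) R.μx := by
  obtain ⟨C, hC⟩ := isCompact_Icc.exists_bound_of_continuousOn (s := Icc R.a R.b) hc.continuousOn
  refine hh.bdd_mul (c := C) hc.aestronglyMeasurable ?_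
  filter_upwards [ae_μx R] with x hx
  exact hC x hx

theorem integrable_continuous_mul_μxy {c : ℝ × ℝ → ℝ} (hc : Continuous c) {h : ℝ × ℝ → ℝ}
    (hh : Integrable h R.μxy) : Integrable (fun θ => c θ * h θ) R.μxy := by
  obtain ⟨C, hC⟩ := (isCompact_Icc.prod isCompact_Icc).exists_bound_of_continuousOn
    (s := Icc R.a R.b ×ˢ Icc R.c R.d) hc.continuousOn
  refine hh.bdd_mul (c := C) hc.aestronglyMeasurable ?_
  filter_upwards [ae_μxy_fst R (ae_μx R), ae_μxy_snd R (ae_μy R)] with x hx hy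
  exact hC x ⟨hx, hy⟩

theorem integrable_mv_μx {M : ℝ → Matrix κ ι ℝ} (hM : ∀ i j, Continuous fun θ => M θ i j)
    {f : ℝ → EuclideanSpace ℝ ι} (hf : Integrable f R.μx) :
    Integrable (fun θ => mv (M θ) (f θ)) R.μx :=
  integrable_of_apply fun i => integrable_finsetSum (f := fun j θ => M θ i j * f θ j) _
    fun j _ => integrable_continuous_mul_μx (hM i j) (integrable_apply hf j)

theorem integrable_mv_μxy {M : ℝ → ℝ → Matrix κ ι ℝ}
    (hM : ∀ i j, Continuous fun s : ℝ × ℝ => M s.1 s.2 i j)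
    {f : ℝ × ℝ → EuclideanSpace ℝ ι} (hf : Integrable f R.μxy) :
    Integrable (fun s : ℝ × ℝ => mv (M s.1 s.2) (f s)) R.μxy :=
  integrable_of_apply fun i =>
    integrable_finsetSum (f := fun j (s : ℝ × ℝ) => M s.1 s.2 i j * f s j) _
      fun j _ => integrable_continuous_mul_μxy (hM i j) (integrable_apply hf j)

theorem integral_mv_apply {M : ℝ → Matrix κ ι ℝ} (hM : ∀ i j, Continuous fun θ => M θ i j)
    {f : ℝ → EuclideanSpace ℝ ι} (hf : Integrable f R.μx) {x : ℝ} (hx : x ∈ Icc R.a R.b) (i : κ) :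
    (∫ θ in R.a..x, mv (M θ) (f θ)) i = ∫ θ in R.a..x, mv (M θ) (f θ) i :=
  intervalIntegral_apply
    (intervalIntegrable_of_μx R (integrable_mv_μx hM hf) (left_mem_x R) hx) i

theorem integral_mv_apply_y {M : ℝ → Matrix κ ι ℝ} (hM : ∀ i j, Continuous fun θ => M θ i j)
    {f : ℝ → EuclideanSpace ℝ ι} (hf : Integrable f R.μy) {y : ℝ} (hy : y ∈ Icc R.c R.d) (i : κ) :
    (∫ θ in R.c..y, mv (M θ) (f θ)) i = ∫ θ in R.c..y, mv (M θ) (f θ) i :=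
  integral_mv_apply (R := R.swap) hM hf hy i

/-- Going through the integral over the product set requires joint integrability only, not
integrability of every section. -/
theorem integral_rect_apply {F : ℝ × ℝ → EuclideanSpace ℝ κ} (hF : Integrable F R.μxy) {x y : ℝ}
    (hx : x ∈ Icc R.a R.b) (hy : y ∈ Icc R.c R.d) (i : κ) :
    (∫ θ in R.a..x, ∫ ν in R.c..y, F (θ, ν)) i = ∫ θ in R.a..x, ∫ ν in R.c..y, F (θ, ν) i := by
  rw [integral_rect_eq hF hx hy, integral_rect_eq (f := fun s => F s i) (integrable_apply hF i) hx hy]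
  exact integral_apply hF.integrableOn i

theorem integral_rect_congr {E : Type*} [NormedAddCommGroup E] [NormedSpace ℝ E]
    {f g : ℝ × ℝ → E} (hf : Integrable f R.μxy) (h : f =ᵐ[R.μxy] g) {x y : ℝ}
    (hx : x ∈ Icc R.a R.b) (hy : y ∈ Icc R.c R.d) :
    ∫ θ in R.a..x, ∫ ν in R.c..y, f (θ, ν) = ∫ θ in R.a..x, ∫ ν in R.c..y, g (θ, ν) := by
  rw [integral_rect_eq hf hx hy, integral_rect_eq (hf.congr h) hx hy]
  exact integral_congr_ae (ae_restrict_of_ae h)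

theorem integral_smul_apply {c : ℝ → ℝ} (hc : Continuous c)
    {f : ℝ → EuclideanSpace ℝ ι} (hf : Integrable f R.μx) {x : ℝ} (hx : x ∈ Icc R.a R.b) (i : ι) :
    (∫ θ in R.a..x, c θ • f θ) i = ∫ θ in R.a..x, c θ * f θ i :=
  intervalIntegral_apply (intervalIntegrable_of_μx R
    (integrable_of_apply fun i => integrable_continuous_mul_μx hc (integrable_apply hf i))
    (left_mem_x R) hx) i

theorem integral_smul_apply_y {c : ℝ → ℝ} (hc : Continuous c)
    {f : ℝ → EuclideanSpace ℝ ι} (hf : Integrable f R.μy) {y : ℝ} (hy : y ∈ Icc R.c R.d) (i : ι) :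
    (∫ θ in R.c..y, c θ • f θ) i = ∫ θ in R.c..y, c θ * f θ i :=
  integral_smul_apply (R := R.swap) hc hf hy i

end Comp

/-! ### The Taylor expansions of orders one and two -/

section JetFormula

variable {ι : Type} [Fintype ι]

theorem jetV_one_one (D : JetData R ι) :
    jetV 1 1 D = liftX R (constX R (jetW 0 0 D)) + liftX R (edgePrimX R (jetF 0 D))
      + liftY R (edgePrimY R (jetG 0 D)) + primX R (primY R (jetZ D)) := by
  change liftY R (constY R (jetW 0 0 D) + edgePrimY R (jetG 0 D))
    + primX R (liftX R (jetF 0 D) + primY R (jetZ D)) = _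
  simp only [map_add]
  rw [primX_liftX, liftX_constX]
  abel

/-- The recursion unrolled: four terms from the corner, two from each edge, one remainder. They are
brought to a form in which each term has an explicit kernel formula. -/
theorem jetV_two_two (D : JetData R ι) :
    jetV 2 2 D = liftX R (constX R (jetW 1 1 D)) + liftY R (edgePrimY R (constY R (jetW 1 0 D)))
      + liftX R (edgePrimX R (constX R (jetW 0 1 D)))
      + primX R (liftY R (edgePrimY R (constY R (jetW 0 0 D))))
      + liftY R (edgePrimY R (edgePrimY R (jetG 1 D)))
      + primX R (liftY R (edgePrimY R (edgePrimY R (jetG 0 D))))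
      + liftX R (edgePrimX R (edgePrimX R (jetF 1 D)))
      + primY R (liftX R (edgePrimX R (edgePrimX R (jetF 0 D))))
      + primX R (primX R (primY R (primY R (jetZ D)))) := by
  change liftY R (constY R (jetW 1 1 D) + edgePrimY R (constY R (jetW 1 0 D)
      + edgePrimY R (jetG 1 D)))
    + primX R (liftY R (constY R (jetW 0 1 D) + edgePrimY R (constY R (jetW 0 0 D)
      + edgePrimY R (jetG 0 D)))
    + primX R (liftX R (jetF 1 D) + primY R (liftX R (jetF 0 D) + primY R (jetZ D)))) = _
  simp only [map_add]
  rw [primX_liftX, primX_liftX, primX_primY, primX_primY, primX_liftX, primX_liftX, ← liftX_constX,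
    ← liftX_constX, primX_liftX]
  abel

theorem coeFn_add_of_ae {α : Type*} [MeasurableSpace α] {μ : Measure α} {E : Type*}
    [NormedAddCommGroup E] {f g : Lp E 2 μ} {F G : α → E} (hf : f =ᵐ[μ] F) (hg : g =ᵐ[μ] G) :
    (f + g : Lp E 2 μ) =ᵐ[μ] fun s => F s + G s := by
  filter_upwards [Lp.coeFn_add f g, hf, hg] with s h1 h2 h3
  rw [h1, Pi.add_apply, h2, h3]

end JetFormula

end Formulas

/-! ### The operators `𝒦₁, 𝒦₂` -/

section Kop

variable {R : Rectangle} {n₀ n₁ n₂ : ℕ}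

/-- The kernel formula fixes the operator, so the one picked by choice is any one that satisfies it;
in particular `op` is not the default `0`. The three lemmas that follow serve the other kinds of
parameters. -/
theorem Par2D.Represents.op_eq {κ ι : Type} [Fintype κ] [Fintype ι] {N : Par2D κ ι}
    {T : L2xy R ι →L[ℝ] L2xy R κ} (h : N.Represents R T) : N.op R = T := by
  have hex : ∃ T, N.Represents R T := ⟨T, h⟩
  rw [Par2D.op, dif_pos hex]
  refine ContinuousLinearMap.ext fun u => Lp.ext ?_
  exact (hex.choose_spec u).trans (h u).symm

theorem Par011to2.Represents.op_eq {κ ι₀ ι₁ : Type} [Fintype κ] [Fintype ι₀] [Fintype ι₁]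
    {C : Par011to2 κ ι₀ ι₁} {T : RL R ι₀ ι₁ →L[ℝ] L2xy R κ} (h : C.Represents R T) :
    C.op R = T := by
  have hex : ∃ T, C.Represents R T := ⟨T, h⟩
  rw [Par011to2.op, dif_pos hex]
  refine ContinuousLinearMap.ext fun ⟨v, f, g⟩ => Lp.ext ?_
  exact (hex.choose_spec v f g).trans (h v f g).symm

theorem Par011.Represents.op_eq {κ₀ κ₁ ι₀ ι₁ : Type} [Fintype κ₀] [Fintype κ₁] [Fintype ι₀]
    [Fintype ι₁] {B : Par011 κ₀ κ₁ ι₀ ι₁} {T : RL R ι₀ ι₁ →L[ℝ] RL R κ₀ κ₁}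
    (h : B.Represents R T) : B.op R = T := by
  have hex : ∃ T, B.Represents R T := ⟨T, h⟩
  rw [Par011.op, dif_pos hex]
  refine ContinuousLinearMap.ext fun ⟨v, f, g⟩ => ?_
  obtain ⟨h1, h2, h3⟩ := hex.choose_spec v f g
  obtain ⟨h1', h2', h3'⟩ := h v f g
  exact Prod.ext (h1.trans h1'.symm)
    (Prod.ext (Lp.ext (h2.trans h2'.symm)) (Lp.ext (h3.trans h3'.symm)))

theorem Par2to011.Represents.op_eq {κ₀ κ₁ ι : Type} [Fintype κ₀] [Fintype κ₁] [Fintype ι]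
    {C : Par2to011 κ₀ κ₁ ι} {T : L2xy R ι →L[ℝ] RL R κ₀ κ₁}
    (h : C.Represents R T) : C.op R = T := by
  have hex : ∃ T, C.Represents R T := ⟨T, h⟩
  rw [Par2to011.op, dif_pos hex]
  refine ContinuousLinearMap.ext fun u => ?_
  obtain ⟨h1, h2, h3⟩ := hex.choose_spec u
  obtain ⟨h1', h2', h3'⟩ := h u
  exact Prod.ext (h1.trans h1'.symm)
    (Prod.ext (Lp.ext (h2.trans h2'.symm)) (Lp.ext (h3.trans h3'.symm)))

theorem mv_sel1 (v : EuclideanSpace ℝ (St n₀ n₁ n₂)) (i : Fin n₁) :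
    (sel1 n₀ n₁ n₂ *ᵥ v.ofLp) i = v (.inr (.inl i)) := by
  refine (mv_apply _ v _).trans ?_; simp [sel1]

theorem mv_sel2 (v : EuclideanSpace ℝ (St n₀ n₁ n₂)) (i : Fin n₂) :
    (sel2 n₀ n₁ n₂ *ᵥ v.ofLp) i = v (.inr (.inr i)) := by
  refine (mv_apply _ v _).trans ?_; simp [sel2]

theorem mv_selW1 (v : EuclideanSpace ℝ (Core0 n₁ n₂)) (i : Fin n₁) :
    (selW1 n₁ n₂ *ᵥ v.ofLp) i = v (.inl i) := by
  refine (mv_apply _ v _).trans ?_; simp [selW1]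

theorem mv_selW2 (k l : Fin 2) (v : EuclideanSpace ℝ (Core0 n₁ n₂)) (i : Fin n₂) :
    (selW2 n₁ n₂ k l *ᵥ v.ofLp) i = v (.inr (k, l, i)) := by
  refine (mv_apply _ v _).trans ?_; simp [selW2]

theorem mv_selF1 (v : EuclideanSpace ℝ (Core1 n₁ n₂)) (i : Fin n₁) :
    (selF1 n₁ n₂ *ᵥ v.ofLp) i = v (.inl i) := by
  refine (mv_apply _ v _).trans ?_; simp [selF1]

theorem mv_selF2 (l : Fin 2) (v : EuclideanSpace ℝ (Core1 n₁ n₂)) (i : Fin n₂) :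
    (selF2 n₁ n₂ l *ᵥ v.ofLp) i = v (.inr (l, i)) := by
  refine (mv_apply _ v _).trans ?_; simp [selF2]

theorem mv_zero {ι κ : Type} [Fintype ι] (v : EuclideanSpace ℝ ι) :
    mv (0 : Matrix κ ι ℝ) v = 0 :=
  congrArg (WithLp.toLp 2) (Matrix.zero_mulVec _)

theorem mv_T00_inl (v : EuclideanSpace ℝ (St n₀ n₁ n₂)) (i : Fin n₀) :
    (T00 n₀ n₁ n₂ *ᵥ v.ofLp) (.inl i) = v (.inl i) := by
  refine (mv_apply _ v _).trans ?_; simp [T00, kron]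

theorem mv_T00_inr (v : EuclideanSpace ℝ (St n₀ n₁ n₂)) (i : Fin n₁ ⊕ Fin n₂) :
    (T00 n₀ n₁ n₂ *ᵥ v.ofLp) (.inr i) = 0 := by
  refine (mv_apply _ v _).trans ?_; simp [T00]

theorem mv_K33_inl (x y θ ν : ℝ) (v : EuclideanSpace ℝ (St n₀ n₁ n₂)) (i : Fin n₀) :
    (K33 n₀ n₁ n₂ x y θ ν *ᵥ v.ofLp) (.inl i) = 0 := by
  refine (mv_apply _ v _).trans ?_; simp [K33]

theorem mv_K33_inr_inl (x y θ ν : ℝ) (v : EuclideanSpace ℝ (St n₀ n₁ n₂)) (i : Fin n₁) :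
    (K33 n₀ n₁ n₂ x y θ ν *ᵥ v.ofLp) (.inr (.inl i)) = v (.inr (.inl i)) := by
  refine (mv_apply _ v _).trans ?_; simp [K33, kron]

theorem mv_K33_inr_inr (x y θ ν : ℝ) (v : EuclideanSpace ℝ (St n₀ n₁ n₂)) (i : Fin n₂) :
    (K33 n₀ n₁ n₂ x y θ ν *ᵥ v.ofLp) (.inr (.inr i)) = (x - θ) * (y - ν) * v (.inr (.inr i)) := by
  refine (mv_apply _ v _).trans ?_; simp [K33, kron]

theorem mv_K30_inl (x y : ℝ) (v : EuclideanSpace ℝ (Core0 n₁ n₂)) (i : Fin n₀) :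
    (K30 R n₀ n₁ n₂ x y *ᵥ v.ofLp) (.inl i) = 0 := by
  refine (mv_apply _ v _).trans ?_; simp [K30]

theorem mv_K30_inr_inl (x y : ℝ) (v : EuclideanSpace ℝ (Core0 n₁ n₂)) (i : Fin n₁) :
    (K30 R n₀ n₁ n₂ x y *ᵥ v.ofLp) (.inr (.inl i)) = v (.inl i) := by
  refine (mv_apply _ v _).trans ?_; simp [K30, kron]

theorem mv_K30_inr_inr (x y : ℝ) (v : EuclideanSpace ℝ (Core0 n₁ n₂)) (i : Fin n₂) :
    (K30 R n₀ n₁ n₂ x y *ᵥ v.ofLp) (.inr (.inr i)) = v (.inr (0, 0, i))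
      + (y - R.c) * v (.inr (0, 1, i)) + (x - R.a) * v (.inr (1, 0, i))
      + (x - R.a) * (y - R.c) * v (.inr (1, 1, i)) := by
  refine (mv_apply _ v _).trans ?_; simp [K30, kron, Fintype.sum_prod_type]; ring

theorem mv_K31_inl (x y θ : ℝ) (v : EuclideanSpace ℝ (Core1 n₁ n₂)) (i : Fin n₀) :
    (K31 R n₀ n₁ n₂ x y θ *ᵥ v.ofLp) (.inl i) = 0 := by
  refine (mv_apply _ v _).trans ?_; simp [K31]

theorem mv_K31_inr_inl (x y θ : ℝ) (v : EuclideanSpace ℝ (Core1 n₁ n₂)) (i : Fin n₁) :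
    (K31 R n₀ n₁ n₂ x y θ *ᵥ v.ofLp) (.inr (.inl i)) = v (.inl i) := by
  refine (mv_apply _ v _).trans ?_; simp [K31, kron]

theorem mv_K31_inr_inr (x y θ : ℝ) (v : EuclideanSpace ℝ (Core1 n₁ n₂)) (i : Fin n₂) :
    (K31 R n₀ n₁ n₂ x y θ *ᵥ v.ofLp) (.inr (.inr i)) = (x - θ) * v (.inr (0, i))
      + (y - R.c) * ((x - θ) * v (.inr (1, i))) := by
  refine (mv_apply _ v _).trans ?_; simp [K31, kron, Fintype.sum_prod_type]; ring

theorem mv_K32_inl (x y ν : ℝ) (v : EuclideanSpace ℝ (Core1 n₁ n₂)) (i : Fin n₀) :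
    (K32 R n₀ n₁ n₂ x y ν *ᵥ v.ofLp) (.inl i) = 0 := by
  refine (mv_apply _ v _).trans ?_; simp [K32]

theorem mv_K32_inr_inl (x y ν : ℝ) (v : EuclideanSpace ℝ (Core1 n₁ n₂)) (i : Fin n₁) :
    (K32 R n₀ n₁ n₂ x y ν *ᵥ v.ofLp) (.inr (.inl i)) = v (.inl i) := by
  refine (mv_apply _ v _).trans ?_; simp [K32, kron]

theorem mv_K32_inr_inr (x y ν : ℝ) (v : EuclideanSpace ℝ (Core1 n₁ n₂)) (i : Fin n₂) :
    (K32 R n₀ n₁ n₂ x y ν *ᵥ v.ofLp) (.inr (.inr i)) = (y - ν) * v (.inr (0, i))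
      + (x - R.a) * ((y - ν) * v (.inr (1, i))) := by
  refine (mv_apply _ v _).trans ?_; simp [K32, kron, Fintype.sum_prod_type]; ring

theorem integral_smul_matOp_apply {ι κ : Type} [Fintype ι] [Fintype κ] [DecidableEq ι]
    (A : Matrix κ ι ℝ) {c : ℝ → ℝ} (hc : Continuous c) (f : L2x R ι) {x : ℝ}
    (hx : x ∈ Icc R.a R.b) (i : κ) :
    (∫ θ in R.a..x, c θ • matOp R.μx A f θ) i = ∫ θ in R.a..x, c θ * mv A (f θ) i := by
  rw [integral_smul_apply hc (integrable_L2 _) hx]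
  refine intervalIntegral_congr_μx R ?_ (left_mem_x R) hx
  filter_upwards [coeFn_matOp R.μx A f] with θ hθ
  rw [hθ]

theorem integral_smul_matOp_apply_y {ι κ : Type} [Fintype ι] [Fintype κ] [DecidableEq ι]
    (A : Matrix κ ι ℝ) {c : ℝ → ℝ} (hc : Continuous c) (f : L2y R ι) {y : ℝ}
    (hy : y ∈ Icc R.c R.d) (i : κ) :
    (∫ ν in R.c..y, c ν • matOp R.μy A f ν) i = ∫ ν in R.c..y, c ν * mv A (f ν) i :=
  integral_smul_matOp_apply (R := R.swap) A hc f hy i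

theorem integral_rect_smul_matOp_apply {ι κ : Type} [Fintype ι] [Fintype κ] [DecidableEq ι]
    (A : Matrix κ ι ℝ) {c : ℝ → ℝ → ℝ} (hc : Continuous fun s : ℝ × ℝ => c s.1 s.2)
    (u : L2xy R ι) {x y : ℝ} (hx : x ∈ Icc R.a R.b) (hy : y ∈ Icc R.c R.d) (i : κ) :
    (∫ θ in R.a..x, ∫ ν in R.c..y, c θ ν • matOp R.μxy A u (θ, ν)) i
      = ∫ θ in R.a..x, ∫ ν in R.c..y, c θ ν * mv A (u (θ, ν)) i := by
  have hi : Integrable (fun s : ℝ × ℝ => c s.1 s.2 • matOp R.μxy A u s) R.μxy :=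
    integrable_of_apply fun j => integrable_continuous_mul_μxy hc
      (integrable_apply (integrable_L2 (matOp R.μxy A u)) j)
  rw [integral_rect_apply hi hx hy]
  refine integral_rect_congr (f := fun s => (c s.1 s.2 • matOp R.μxy A u s) i)
    (g := fun s => c s.1 s.2 * mv A (u s) i) (integrable_apply hi i) ?_ hx hy
  filter_upwards [coeFn_matOp R.μxy A u] with θ hθ
  rw [hθ]
  rfl

theorem intervalIntegrable_mul_apply {ι : Type} [Fintype ι] {c : ℝ → ℝ} (hc : Continuous c)
    (f : L2x R ι) {x : ℝ} (hx : x ∈ Icc R.a R.b) (i : ι) :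
    IntervalIntegrable (fun θ => c θ * f θ i) volume R.a x :=
  intervalIntegrable_of_μx R (integrable_continuous_mul_μx hc
    (integrable_apply (integrable_L2 f) i)) (left_mem_x R) hx

theorem intervalIntegrable_mul_apply_y {ι : Type} [Fintype ι] {c : ℝ → ℝ} (hc : Continuous c)
    (f : L2y R ι) {y : ℝ} (hy : y ∈ Icc R.c R.d) (i : ι) :
    IntervalIntegrable (fun θ => c θ * f θ i) volume R.c y :=
  intervalIntegrable_mul_apply (R := R.swap) hc f hy i

theorem stateMap_ae (z : CoreState n₀ n₁ n₂ R) :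
    ∀ᵐ s ∂(R.μxy), (∀ i, stateMap n₀ n₁ n₂ R z s (.inl i) = z.2 s (.inl i)) ∧
      (∀ i, stateMap n₀ n₁ n₂ R z s (.inr (.inl i)) = jetV 1 1 (data1 n₀ n₁ n₂ R z) s i) ∧
      (∀ i, stateMap n₀ n₁ n₂ R z s (.inr (.inr i)) = jetV 2 2 (data2 n₀ n₁ n₂ R z) s i) := by
  filter_upwards [coeFn_add_of_ae (coeFn_add_of_ae (coeFn_matOp R.μxy (T00 n₀ n₁ n₂) z.2)
    (coeFn_matOp R.μxy (sel1 n₀ n₁ n₂)ᵀ (jetV 1 1 (data1 n₀ n₁ n₂ R z))))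
    (coeFn_matOp R.μxy (sel2 n₀ n₁ n₂)ᵀ (jetV 2 2 (data2 n₀ n₁ n₂ R z)))] with s hs
  rw [stateMap_apply, hs]
  refine ⟨fun i => ?_, fun i => ?_, fun i => ?_⟩ <;>
    rw [PiLp.add_apply, PiLp.add_apply, mv_apply, mv_apply, mv_apply] <;>
    simp [T00, sel1, sel2, kron]

theorem K2_apply (u : ℝ × ℝ → EuclideanSpace ℝ (St n₀ n₁ n₂)) (x y : ℝ) :
    (K2 n₀ n₁ n₂).apply R u x y = mv (T00 n₀ n₁ n₂) (u (x, y))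
      + ∫ θ in R.a..x, ∫ ν in R.c..y, mv (K33 n₀ n₁ n₂ x y θ ν) (u (θ, ν)) := by
  simp only [Par2D.apply, K2, Pi.zero_apply, mv_zero, intervalIntegral.integral_zero, add_zero]

theorem continuous_K33 (x y : ℝ) (i j : St n₀ n₁ n₂) :
    Continuous fun s : ℝ × ℝ => K33 n₀ n₁ n₂ x y s.1 s.2 i j := by
  rcases i with i | i | i <;> rcases j with j | j | j <;>
    simp only [K33, Matrix.of_apply] <;> fun_prop

theorem continuous_K31 (x y : ℝ) (i : St n₀ n₁ n₂) (j : Core1 n₁ n₂) :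
    Continuous fun θ => K31 R n₀ n₁ n₂ x y θ i j := by
  rcases i with i | i | i <;> rcases j with j | ⟨l, j⟩ <;>
    simp only [K31, Matrix.of_apply] <;> fun_prop

theorem continuous_K32 (x y : ℝ) (i : St n₀ n₁ n₂) (j : Core1 n₁ n₂) :
    Continuous fun θ => K32 R n₀ n₁ n₂ x y θ i j := by
  rcases i with i | i | i <;> rcases j with j | ⟨l, j⟩ <;>
    simp only [K32, Matrix.of_apply] <;> fun_prop

/-- With zero core boundary values only the remainder of the Taylor expansion survives, and it is
the integral against `K33`; the component `u₀` passes through `T00`. -/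
theorem K2_represents : (K2 n₀ n₁ n₂).Represents R
    (stateMap n₀ n₁ n₂ R ∘L ContinuousLinearMap.inr ℝ _ _) := by
  intro u
  set z : CoreState n₀ n₁ n₂ R := (0, u) with hz
  have hW1 : jetW 0 0 (data1 n₀ n₁ n₂ R z) = 0 := map_zero (mvL (selW1 n₁ n₂))
  have hF1 : jetF 0 (data1 n₀ n₁ n₂ R z) = 0 := map_zero (matOp R.μx (selF1 n₁ n₂))
  have hG1 : jetG 0 (data1 n₀ n₁ n₂ R z) = 0 := map_zero (matOp R.μy (selF1 n₁ n₂))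
  have hW2 : ∀ p q, jetW p q (data2 n₀ n₁ n₂ R z) = 0 :=
    fun p q => map_zero (mvL (selW2 n₁ n₂ (ord p) (ord q)))
  have hF2 : ∀ p, jetF p (data2 n₀ n₁ n₂ R z) = 0 :=
    fun p => map_zero (matOp R.μx (selF2 n₁ n₂ (ord p)))
  have hG2 : ∀ p, jetG p (data2 n₀ n₁ n₂ R z) = 0 :=
    fun p => map_zero (matOp R.μy (selF2 n₁ n₂ (ord p)))
  have e1 : jetV 1 1 (data1 n₀ n₁ n₂ R z) =ᵐ[R.μxy] fun s =>
      ∫ θ in R.a..s.1, ∫ ν in R.c..s.2, (1 : ℝ) • matOp R.μxy (sel1 n₀ n₁ n₂) u (θ, ν) := by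
    rw [jetV_one_one, hW1, hF1, hG1]
    simp only [map_zero, zero_add, one_smul]
    exact primX_ae R (coeFn_primY R _)
  have e2 : jetV 2 2 (data2 n₀ n₁ n₂ R z) =ᵐ[R.μxy] fun s => ∫ θ in R.a..s.1, ∫ ν in R.c..s.2,
      ((s.1 - θ) * (s.2 - ν)) • matOp R.μxy (sel2 n₀ n₁ n₂) u (θ, ν) := by
    rw [jetV_two_two]
    simp only [hW2, hF2, hG2, map_zero, zero_add]
    exact primX_primX_primY_primY_ae _
  filter_upwards [stateMap_ae z, e1, e2, ae_μxy_fst R (ae_μx R), ae_μxy_snd R (ae_μy R)]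
    with s h0 h1 h2 hx hy
  obtain ⟨h01, h02, h03⟩ := h0
  rw [K2_apply]
  change stateMap n₀ n₁ n₂ R z s = _
  have hint : Integrable (fun t : ℝ × ℝ => mv (K33 n₀ n₁ n₂ s.1 s.2 t.1 t.2) (u t)) R.μxy :=
    integrable_mv_μxy (continuous_K33 s.1 s.2) (integrable_L2 u)
  refine PiLp.ext fun t => ?_
  rw [PiLp.add_apply, integral_rect_apply hint hx hy]
  rcases t with i | i | i
  · rw [h01]
    simp only [mv_T00_inl, mv_K33_inl, intervalIntegral.integral_zero, add_zero]
    rfl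
  · rw [h02, h1, integral_rect_smul_matOp_apply _ (by fun_prop) u hx hy]
    simp only [mv_T00_inr, mv_K33_inr_inl, mv_sel1, one_mul, zero_add]
  · rw [h03, h2, integral_rect_smul_matOp_apply _ (by fun_prop) u hx hy]
    simp only [mv_T00_inr, mv_K33_inr_inr, mv_sel2, zero_add]

theorem K1_C1_apply (f : ℝ → EuclideanSpace ℝ (Core1 n₁ n₂)) (x y : ℝ) :
    (K1 R n₀ n₁ n₂).C1.applyXto2 R f x y
      = ∫ θ in R.a..x, mv (K31 R n₀ n₁ n₂ x y θ) (f θ) := by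
  simp only [ParMix.applyXto2, K1, Pi.zero_apply, mv_zero, intervalIntegral.integral_zero,
    add_zero, zero_add]

theorem K1_C2_apply (f : ℝ → EuclideanSpace ℝ (Core1 n₁ n₂)) (x y : ℝ) :
    (K1 R n₀ n₁ n₂).C2.applyYto2 R f x y
      = ∫ θ in R.c..y, mv (K32 R n₀ n₁ n₂ x y θ) (f θ) := by
  simp only [ParMix.applyYto2, K1, Pi.zero_apply, mv_zero, intervalIntegral.integral_zero,
    add_zero, zero_add]

theorem integral_K31 (f : L2x R (Core1 n₁ n₂)) (x y : ℝ) (i : Fin n₂) (hx : x ∈ Icc R.a R.b) :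
    ∫ θ in R.a..x, mv (K31 R n₀ n₁ n₂ x y θ) (f θ) (.inr (.inr i))
      = (∫ θ in R.a..x, (x - θ) * f θ (.inr (0, i)))
        + (y - R.c) * ∫ θ in R.a..x, (x - θ) * f θ (.inr (1, i)) := by
  rw [← intervalIntegral.integral_const_mul, ← intervalIntegral.integral_add
    (intervalIntegrable_mul_apply (by fun_prop) f hx _)
    ((intervalIntegrable_mul_apply (by fun_prop) f hx _).const_mul _)]
  refine intervalIntegral.integral_congr fun θ _ => ?_
  exact mv_K31_inr_inr _ _ _ _ _

theorem integral_K32 (f : L2y R (Core1 n₁ n₂)) (x y : ℝ) (i : Fin n₂) (hy : y ∈ Icc R.c R.d) :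
    ∫ θ in R.c..y, mv (K32 R n₀ n₁ n₂ x y θ) (f θ) (.inr (.inr i))
      = (∫ θ in R.c..y, (y - θ) * f θ (.inr (0, i)))
        + (x - R.a) * ∫ θ in R.c..y, (y - θ) * f θ (.inr (1, i)) := by
  rw [← intervalIntegral.integral_const_mul, ← intervalIntegral.integral_add
    (intervalIntegrable_mul_apply_y (by fun_prop) f hy _)
    ((intervalIntegrable_mul_apply_y (by fun_prop) f hy _).const_mul _)]
  refine intervalIntegral.integral_congr fun θ _ => ?_
  exact mv_K32_inr_inr _ _ _ _ _

/-- With zero fundamental state the remainder drops out; the corner terms form the polynomial `K30`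
and the edge terms the integrals against `K31` and `K32`. -/
theorem K1_represents : (K1 R n₀ n₁ n₂).Represents R
    (stateMap n₀ n₁ n₂ R ∘L ContinuousLinearMap.inl ℝ _ _) := by
  intro v f g
  set z : CoreState n₀ n₁ n₂ R := ((v, f, g), 0) with hz
  -- The representative of `0` in `L₂` is zero only almost everywhere.
  have hz0 : z.2 =ᵐ[R.μxy] (0 : ℝ × ℝ → _) := Lp.coeFn_zero _ _ _
  have e1 : jetV 1 1 (data1 n₀ n₁ n₂ R z) =ᵐ[R.μxy] fun s => mv (selW1 n₁ n₂) v
      + (∫ θ in R.a..s.1, (1 : ℝ) • matOp R.μx (selF1 n₁ n₂) f θ)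
      + (∫ ν in R.c..s.2, (1 : ℝ) • matOp R.μy (selF1 n₁ n₂) g ν) := by
    rw [jetV_one_one, show jetZ (data1 n₀ n₁ n₂ R z) = 0 from
      map_zero (matOp R.μxy (sel1 n₀ n₁ n₂))]
    simp only [map_zero, add_zero, one_smul]
    exact coeFn_add_of_ae (coeFn_add_of_ae (liftX_ae R (coeFn_constX R _))
      (liftX_ae R (edgePrimX_ae R Filter.EventuallyEq.rfl)))
      (liftY_ae R (edgePrimY_ae R Filter.EventuallyEq.rfl))
  have e2 : jetV 2 2 (data2 n₀ n₁ n₂ R z) =ᵐ[R.μxy] fun s => mv (selW2 n₁ n₂ 0 0) v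
      + (s.2 - R.c) • mv (selW2 n₁ n₂ 0 1) v
      + (s.1 - R.a) • mv (selW2 n₁ n₂ 1 0) v
      + (s.1 - R.a) • (s.2 - R.c) • mv (selW2 n₁ n₂ 1 1) v
      + (∫ ν in R.c..s.2, (s.2 - ν) • matOp R.μy (selF2 n₁ n₂ 0) g ν)
      + (s.1 - R.a) • (∫ ν in R.c..s.2, (s.2 - ν) • matOp R.μy (selF2 n₁ n₂ 1) g ν)
      + (∫ θ in R.a..s.1, (s.1 - θ) • matOp R.μx (selF2 n₁ n₂ 0) f θ)
      + (s.2 - R.c) • (∫ θ in R.a..s.1, (s.1 - θ) • matOp R.μx (selF2 n₁ n₂ 1) f θ) := by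
    rw [jetV_two_two, show jetZ (data2 n₀ n₁ n₂ R z) = 0 from
      map_zero (matOp R.μxy (sel2 n₀ n₁ n₂))]
    simp only [map_zero, add_zero]
    exact coeFn_add_of_ae (coeFn_add_of_ae (coeFn_add_of_ae (coeFn_add_of_ae (coeFn_add_of_ae
      (coeFn_add_of_ae (coeFn_add_of_ae (liftX_ae R (coeFn_constX R _))
      (liftY_ae R (edgePrimY_constY_ae _))) (liftX_ae R (edgePrimX_constX_ae _)))
      (primX_liftY_ae (edgePrimY_constY_ae _)))
      (liftY_ae R (edgePrimY_edgePrimY_ae Filter.EventuallyEq.rfl)))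
      (primX_liftY_ae (edgePrimY_edgePrimY_ae Filter.EventuallyEq.rfl)))
      (liftX_ae R (edgePrimX_edgePrimX_ae Filter.EventuallyEq.rfl)))
      (primY_liftX_ae (edgePrimX_edgePrimX_ae Filter.EventuallyEq.rfl))
  filter_upwards [stateMap_ae z, hz0, e1, e2, ae_μxy_fst R (ae_μx R), ae_μxy_snd R (ae_μy R)]
    with s h0 hz0 h1 h2 hx hy
  obtain ⟨h01, h02, h03⟩ := h0
  rw [K1_C1_apply, K1_C2_apply]
  change stateMap n₀ n₁ n₂ R z s = _
  refine PiLp.ext fun t => ?_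
  rw [PiLp.add_apply, PiLp.add_apply,
    integral_mv_apply (continuous_K31 s.1 s.2) (integrable_L2 f) hx,
    integral_mv_apply_y (continuous_K32 s.1 s.2) (integrable_L2 g) hy]
  rcases t with i | i | i
  · rw [h01, hz0]
    simp only [K1, mv_K30_inl, mv_K31_inl, mv_K32_inl,
      intervalIntegral.integral_zero, add_zero]
    rfl
  · rw [h02, h1, PiLp.add_apply, PiLp.add_apply, integral_smul_matOp_apply _ continuous_const f hx,
      integral_smul_matOp_apply_y _ continuous_const g hy]
    simp only [K1, mv_K30_inr_inl, mv_K31_inr_inl, mv_K32_inr_inl, mv_selW1, mv_selF1, one_mul]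
  · rw [h03, h2, integral_K31 f _ _ _ hx, integral_K32 g _ _ _ hy]
    simp only [PiLp.add_apply, PiLp.smul_apply]
    rw [integral_smul_matOp_apply _ (by fun_prop) f hx,
      integral_smul_matOp_apply _ (by fun_prop) f hx,
      integral_smul_matOp_apply_y _ (by fun_prop) g hy,
      integral_smul_matOp_apply_y _ (by fun_prop) g hy]
    simp only [mv_selW2, mv_selF2, smul_eq_mul]
    simp only [K1, mv_K30_inr_inr]
    ring

end Kop

/-! ### Explicit formulas for boundary values -/

section Side

variable {R : Rectangle} {ι : Type} [Fintype ι]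

theorem sideTotX_constX (p : Fin 2) (w : EuclideanSpace ℝ ι) :
    sideTotX R p (constX R w) = (R.xEnd p - R.a) • w := by
  rw [sideTotX_eq, intervalIntegral_congr_μx R (coeFn_constX R w) (left_mem_x R) (xEnd_mem R p),
    intervalIntegral.integral_const]

theorem sideTotY_constY (q : Fin 2) (w : EuclideanSpace ℝ ι) :
    sideTotY R q (constY R w) = (R.yEnd q - R.c) • w :=
  sideTotX_constX (R := R.swap) q w

theorem sideTotX_edgePrimX (p : Fin 2) (f : L2x R ι) :
    sideTotX R p (edgePrimX R f) = ∫ θ in R.a..R.xEnd p, (R.xEnd p - θ) • f θ := by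
  rw [sideTotX_eq, intervalIntegral_congr_μx R (edgePrimX_ae R Filter.EventuallyEq.rfl)
    (left_mem_x R) (xEnd_mem R p), integral_primitive (xEnd_mem R p).1
    (integrableOn_Ioc_of_μx (integrable_L2 f) (xEnd_mem R p))]

theorem sideTotY_edgePrimY (q : Fin 2) (g : L2y R ι) :
    sideTotY R q (edgePrimY R g) = ∫ ν in R.c..R.yEnd q, (R.yEnd q - ν) • g ν :=
  sideTotX_edgePrimX (R := R.swap) q g

theorem sideIntY_liftX (q : Fin 2) (f : L2x R ι) :
    sideIntY R q (liftX R f) = (R.yEnd q - R.c) • f := by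
  fin_cases q
  · simp [sideIntY, Rectangle.yEnd]
  · simpa [sideIntY, Rectangle.yEnd] using intY_liftX R f

theorem sideIntX_liftY (p : Fin 2) (g : L2y R ι) :
    sideIntX R p (liftY R g) = (R.xEnd p - R.a) • g := by
  fin_cases p
  · simp [sideIntX, Rectangle.xEnd]
  · simpa [sideIntX, Rectangle.xEnd] using intX_liftY R g

theorem sideIntY_liftY (q : Fin 2) (g : L2y R ι) :
    sideIntY R q (liftY R g) = constX R (sideTotY R q g) := by
  fin_cases q
  · simp [sideIntY, sideTotY]
  · simpa [sideIntY, sideTotY] using intY_liftY R g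

/-- Fubini: the integral in `y` and the primitive in `x` commute. -/
theorem sideIntY_primX (q : Fin 2) (v : L2xy R ι) :
    sideIntY R q (primX R v) = edgePrimX R (sideIntY R q v) := by
  fin_cases q
  · simp [sideIntY]
  · simpa [sideIntY] using intY_primX R v

theorem sideIntY_primY_ae (q : Fin 2) (v : L2xy R ι) :
    sideIntY R q (primY R v) =ᵐ[R.μx]
      fun x => ∫ ν in R.c..R.yEnd q, (R.yEnd q - ν) • v (x, ν) := by
  filter_upwards [sideIntY_ae (primY R v), ae_ae_of_ae R (coeFn_primY R v),
    ae_section_integrable' v] with x h1 h2 h3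
  rw [h1, intervalIntegral_congr_μx R.swap h2 (left_mem_y R) (yEnd_mem R q)]
  exact integral_primitive (yEnd_mem R q).1
    (integrableOn_Ioc_of_μx (R := R.swap) h3 (yEnd_mem R q))

theorem sideIntX_primX_ae (p : Fin 2) (v : L2xy R ι) :
    sideIntX R p (primX R v) =ᵐ[R.μy]
      fun y => ∫ θ in R.a..R.xEnd p, (R.xEnd p - θ) • v (θ, y) := by
  filter_upwards [sideIntX_ae (primX R v), ae_ae_of_ae' R (coeFn_primX R v),
    ae_section_integrable R v] with y h1 h2 h3
  rw [h1, intervalIntegral_congr_μx R h2 (left_mem_x R) (xEnd_mem R p)]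
  exact integral_primitive (xEnd_mem R p).1
    (integrableOn_Ioc_of_μx h3 (xEnd_mem R p))

theorem sideTotX_of_ae (p : Fin 2) {f : L2x R ι} {F : ℝ → EuclideanSpace ℝ ι}
    (h : f =ᵐ[R.μx] F) : sideTotX R p f = ∫ θ in R.a..R.xEnd p, F θ := by
  rw [sideTotX_eq, intervalIntegral_congr_μx R h (left_mem_x R) (xEnd_mem R p)]

theorem sideTotX_edgePrimX_of_ae (p : Fin 2) {f : L2x R ι} {F : ℝ → EuclideanSpace ℝ ι}
    (h : f =ᵐ[R.μx] F) :
    sideTotX R p (edgePrimX R f) = ∫ θ in R.a..R.xEnd p, (R.xEnd p - θ) • F θ := by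
  rw [sideTotX_edgePrimX]
  refine intervalIntegral_congr_μx R ?_ (left_mem_x R) (xEnd_mem R p)
  filter_upwards [h] with θ hθ
  rw [hθ]

/-- The remainder keeps the powers `^ 0`, here and in the next three formulas, so that all four
match the kernel `(b - x)^(1 - r) (d - y)^(1 - s)` of `H03`. -/
theorem jetCorner_zero_zero (P Q : Fin 2) (D : JetData R ι) :
    jetCorner P Q 0 0 D = jetW 0 0 D + (∫ θ in R.a..R.xEnd P, jetF 0 D θ)
      + (∫ ν in R.c..R.yEnd Q, jetG 0 D ν)
      + ∫ θ in R.a..R.xEnd P, ∫ ν in R.c..R.yEnd Q,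
          ((R.xEnd P - θ) ^ 0 * (R.yEnd Q - ν) ^ 0) • jetZ D (θ, ν) := by
  simp only [pow_zero, mul_one, one_smul]
  change jetW 0 0 D + sideTotX R P (jetF 0 D) + sideTotY R Q (jetG 0 D)
    + sideTotX R P (sideIntY R Q (jetZ D)) = _
  rw [sideTotX_eq, sideTotY_eq, sideTotX_of_ae P (sideIntY_ae (jetZ D))]

theorem jetCorner_one_zero (P Q : Fin 2) (D : JetData R ι) :
    jetCorner P Q 1 0 D = jetW 1 0 D + (R.xEnd P - R.a) • jetW 0 0 D
      + (∫ θ in R.a..R.xEnd P, (R.xEnd P - θ) • jetF 0 D θ)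
      + (∫ ν in R.c..R.yEnd Q, jetG 1 D ν)
      + (R.xEnd P - R.a) • (∫ ν in R.c..R.yEnd Q, jetG 0 D ν)
      + ∫ θ in R.a..R.xEnd P, ∫ ν in R.c..R.yEnd Q,
          ((R.xEnd P - θ) ^ 1 * (R.yEnd Q - ν) ^ 0) • jetZ D (θ, ν) := by
  simp only [pow_zero, pow_one, mul_one, intervalIntegral.integral_smul]
  change jetW 1 0 D + sideTotX R P (constX R (jetW 0 0 D) + edgePrimX R (jetF 0 D))
    + sideTotY R Q (jetG 1 D)
    + sideTotX R P (sideIntY R Q (liftY R (jetG 0 D) + primX R (jetZ D))) = _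
  simp only [map_add]
  rw [sideTotX_constX, sideTotX_edgePrimX, sideTotY_eq, sideIntY_liftY, sideTotX_constX,
    sideTotY_eq, sideIntY_primX, sideTotX_edgePrimX_of_ae P (sideIntY_ae (jetZ D))]
  abel

theorem jetCorner_zero_one (P Q : Fin 2) (D : JetData R ι) :
    jetCorner P Q 0 1 D = jetW 0 1 D + (R.yEnd Q - R.c) • jetW 0 0 D
      + (∫ θ in R.a..R.xEnd P, jetF 1 D θ)
      + (R.yEnd Q - R.c) • (∫ θ in R.a..R.xEnd P, jetF 0 D θ)
      + (∫ ν in R.c..R.yEnd Q, (R.yEnd Q - ν) • jetG 0 D ν)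
      + ∫ θ in R.a..R.xEnd P, ∫ ν in R.c..R.yEnd Q,
          ((R.xEnd P - θ) ^ 0 * (R.yEnd Q - ν) ^ 1) • jetZ D (θ, ν) := by
  simp only [pow_zero, pow_one, one_mul]
  change jetW 0 1 D + sideTotX R P (jetF 1 D)
    + sideTotY R Q (constY R (jetW 0 0 D) + edgePrimY R (jetG 0 D))
    + sideTotX R P (sideIntY R Q (liftX R (jetF 0 D) + primY R (jetZ D))) = _
  simp only [map_add]
  rw [sideTotY_constY, sideTotY_edgePrimY, sideTotX_eq, sideIntY_liftX, map_smul, sideTotX_eq,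
    sideTotX_of_ae P (sideIntY_primY_ae Q (jetZ D))]
  abel

theorem jetCorner_one_one (P Q : Fin 2) (D : JetData R ι) :
    jetCorner P Q 1 1 D = jetW 1 1 D + (R.xEnd P - R.a) • jetW 0 1 D
      + (R.yEnd Q - R.c) • jetW 1 0 D + (R.xEnd P - R.a) • (R.yEnd Q - R.c) • jetW 0 0 D
      + (∫ θ in R.a..R.xEnd P, (R.xEnd P - θ) • jetF 1 D θ)
      + (R.yEnd Q - R.c) • (∫ θ in R.a..R.xEnd P, (R.xEnd P - θ) • jetF 0 D θ)
      + (∫ ν in R.c..R.yEnd Q, (R.yEnd Q - ν) • jetG 1 D ν)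
      + (R.xEnd P - R.a) • (∫ ν in R.c..R.yEnd Q, (R.yEnd Q - ν) • jetG 0 D ν)
      + ∫ θ in R.a..R.xEnd P, ∫ ν in R.c..R.yEnd Q,
          ((R.xEnd P - θ) ^ 1 * (R.yEnd Q - ν) ^ 1) • jetZ D (θ, ν) := by
  simp only [pow_one, mul_smul, intervalIntegral.integral_smul]
  have h : jetCorner P Q 1 1 D
      = jetW 1 1 D + sideTotX R P (constX R (jetW 0 1 D) + edgePrimX R (jetF 1 D))
        + sideTotY R Q (constY R (jetW 1 0 D) + edgePrimY R (jetG 1 D))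
        + sideTotX R P (sideIntY R Q (jetV 1 1 D)) := rfl
  rw [h, jetV_one_one]
  simp only [map_add]
  rw [sideTotX_constX, sideTotX_edgePrimX, sideTotY_constY, sideTotY_edgePrimY, sideIntY_liftX,
    sideIntY_liftX, map_smul, map_smul, sideTotX_constX, sideTotX_edgePrimX, sideIntY_liftY,
    sideTotX_constX, sideTotY_edgePrimY, sideIntY_primX,
    sideTotX_edgePrimX_of_ae P (sideIntY_primY_ae Q (jetZ D)), smul_comm (R.yEnd Q - R.c)]
  abel

theorem jetEdgeY_zero (Q : Fin 2) (D : JetData R ι) :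
    jetEdgeY Q 0 D = jetF 0 D + sideIntY R Q (jetZ D) := rfl

theorem jetEdgeX_zero (P : Fin 2) (D : JetData R ι) :
    jetEdgeX P 0 D = jetG 0 D + sideIntX R P (jetZ D) := rfl

theorem jetEdgeY_one (Q : Fin 2) (D : JetData R ι) :
    jetEdgeY Q 1 D = jetF 1 D + (R.yEnd Q - R.c) • jetF 0 D
      + sideIntY R Q (primY R (jetZ D)) := by
  change jetF 1 D + sideIntY R Q (liftX R (jetF 0 D) + primY R (jetZ D)) = _
  rw [map_add, sideIntY_liftX, add_assoc]

theorem jetEdgeX_one (P : Fin 2) (D : JetData R ι) :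
    jetEdgeX P 1 D = jetG 1 D + (R.xEnd P - R.a) • jetG 0 D
      + sideIntX R P (primX R (jetZ D)) := by
  change jetG 1 D + sideIntX R P (liftY R (jetG 0 D) + primX R (jetZ D)) = _
  rw [map_add, sideIntX_liftY, add_assoc]

end Side

/-! ### Reading off the components of edge data -/

section Emb

variable {n₁ n₂ : ℕ} {α : Type} [MeasurableSpace α] {μ : Measure α}

theorem mv_emb1_inl (q q' : Fin 2) (v : EuclideanSpace ℝ (Fin n₁)) (i : Fin n₁) :
    (emb1 n₁ n₂ q *ᵥ v.ofLp) (.inl (q', i)) = if q' = q then v i else 0 := by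
  refine (mv_apply _ v _).trans ?_
  by_cases h : q' = q <;> simp [emb1, h]

theorem mv_emb1_inr (q : Fin 2) (v : EuclideanSpace ℝ (Fin n₁)) (t : Fin 2 × Fin 2 × Fin n₂) :
    (emb1 n₁ n₂ q *ᵥ v.ofLp) (.inr t) = 0 := by
  refine (mv_apply _ v _).trans ?_
  simp [emb1]

theorem mv_emb2_inl (q s : Fin 2) (v : EuclideanSpace ℝ (Fin n₂)) (t : Fin 2 × Fin n₁) :
    (emb2 n₁ n₂ q s *ᵥ v.ofLp) (.inl t) = 0 := by
  refine (mv_apply _ v _).trans ?_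
  simp [emb2]

theorem mv_emb2_inr (q s q' s' : Fin 2) (v : EuclideanSpace ℝ (Fin n₂)) (i : Fin n₂) :
    (emb2 n₁ n₂ q s *ᵥ v.ofLp) (.inr (q', s', i)) = if q' = q ∧ s' = s then v i else 0 := by
  refine (mv_apply _ v _).trans ?_
  by_cases h : q' = q <;> by_cases h' : s' = s <;> simp [emb2, h, h']

/-- The blocks `emb1 q` and `emb2 q s` fill disjoint sets of coordinates, so each coordinate of the
sum receives exactly one term. -/
theorem emb_sum_ae (f : Fin 2 → Lp (EuclideanSpace ℝ (Fin n₁)) 2 μ)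
    (g : Fin 2 → Fin 2 → Lp (EuclideanSpace ℝ (Fin n₂)) 2 μ) :
    ∀ᵐ x ∂μ,
      (∀ q i, (∑ q, matOp μ (emb1 n₁ n₂ q) (f q)
        + ∑ q, ∑ s, matOp μ (emb2 n₁ n₂ q s) (g q s) : Lp _ 2 μ) x (.inl (q, i)) = f q x i) ∧
      (∀ q s i, (∑ q, matOp μ (emb1 n₁ n₂ q) (f q)
        + ∑ q, ∑ s, matOp μ (emb2 n₁ n₂ q s) (g q s) : Lp _ 2 μ) x (.inr (q, s, i))
          = g q s x i) := by
  simp only [Fin.sum_univ_two]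
  filter_upwards [coeFn_add_of_ae (coeFn_add_of_ae (coeFn_matOp μ (emb1 n₁ n₂ 0) (f 0))
    (coeFn_matOp μ (emb1 n₁ n₂ 1) (f 1)))
    (coeFn_add_of_ae (coeFn_add_of_ae (coeFn_matOp μ (emb2 n₁ n₂ 0 0) (g 0 0))
      (coeFn_matOp μ (emb2 n₁ n₂ 0 1) (g 0 1)))
      (coeFn_add_of_ae (coeFn_matOp μ (emb2 n₁ n₂ 1 0) (g 1 0))
        (coeFn_matOp μ (emb2 n₁ n₂ 1 1) (g 1 1))))] with x hx
  rw [hx]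
  refine ⟨fun q i => ?_, fun q s i => ?_⟩
  · simp only [PiLp.add_apply, mv_emb1_inl, mv_emb2_inl]
    fin_cases q <;> simp
  · simp only [PiLp.add_apply, mv_emb1_inr, mv_emb2_inr]
    fin_cases q <;> fin_cases s <;> simp

end Emb

/-! ### The operators `ℋ₁, ℋ₂` -/

section Hop

variable {R : Rectangle} {n₀ n₁ n₂ : ℕ}

theorem mv_H00_inl (v : EuclideanSpace ℝ (Core0 n₁ n₂)) (p q : Fin 2) (i : Fin n₁) :
    (H00 R n₁ n₂ *ᵥ v.ofLp) (.inl (p, q, i)) = v (.inl i) := by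
  refine (mv_apply _ v _).trans ?_; simp [H00, kron]

theorem mv_H00_inr (v : EuclideanSpace ℝ (Core0 n₁ n₂)) (p q r s : Fin 2) (i : Fin n₂) :
    (H00 R n₁ n₂ *ᵥ v.ofLp) (.inr (p, q, r, s, i))
      = tay r 0 (R.xEnd p - R.a) * tay s 0 (R.yEnd q - R.c) * v (.inr (0, 0, i))
        + tay r 0 (R.xEnd p - R.a) * tay s 1 (R.yEnd q - R.c) * v (.inr (0, 1, i))
        + tay r 1 (R.xEnd p - R.a) * tay s 0 (R.yEnd q - R.c) * v (.inr (1, 0, i))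
        + tay r 1 (R.xEnd p - R.a) * tay s 1 (R.yEnd q - R.c) * v (.inr (1, 1, i)) := by
  refine (mv_apply _ v _).trans ?_
  simp [H00, kron, Fintype.sum_prod_type]
  ring

theorem mv_H01_inl (x : ℝ) (v : EuclideanSpace ℝ (Core1 n₁ n₂)) (p q : Fin 2) (i : Fin n₁) :
    (H01 R n₁ n₂ x *ᵥ v.ofLp) (.inl (p, q, i)) = if p = 1 then v (.inl i) else 0 := by
  refine (mv_apply _ v _).trans ?_
  by_cases h : p = 1 <;> simp [H01, kron, h]

theorem mv_H01_inr (x : ℝ) (v : EuclideanSpace ℝ (Core1 n₁ n₂)) (p q r s : Fin 2) (i : Fin n₂) :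
    (H01 R n₁ n₂ x *ᵥ v.ofLp) (.inr (p, q, r, s, i))
      = if p = 1 then tay s 0 (R.yEnd q - R.c) * ((R.b - x) ^ (1 - r.val) * v (.inr (0, i)))
        + tay s 1 (R.yEnd q - R.c) * ((R.b - x) ^ (1 - r.val) * v (.inr (1, i))) else 0 := by
  refine (mv_apply _ v _).trans ?_
  by_cases h : p = 1
  · simp [H01, kron, h, Fintype.sum_prod_type]
    ring
  · simp [H01, h]

theorem mv_H02_inl (y : ℝ) (v : EuclideanSpace ℝ (Core1 n₁ n₂)) (p q : Fin 2) (i : Fin n₁) :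
    (H02 R n₁ n₂ y *ᵥ v.ofLp) (.inl (p, q, i)) = if q = 1 then v (.inl i) else 0 := by
  refine (mv_apply _ v _).trans ?_
  by_cases h : q = 1 <;> simp [H02, kron, h]

theorem mv_H02_inr (y : ℝ) (v : EuclideanSpace ℝ (Core1 n₁ n₂)) (p q r s : Fin 2) (i : Fin n₂) :
    (H02 R n₁ n₂ y *ᵥ v.ofLp) (.inr (p, q, r, s, i))
      = if q = 1 then tay r 0 (R.xEnd p - R.a) * ((R.d - y) ^ (1 - s.val) * v (.inr (0, i)))
        + tay r 1 (R.xEnd p - R.a) * ((R.d - y) ^ (1 - s.val) * v (.inr (1, i))) else 0 := by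
  refine (mv_apply _ v _).trans ?_
  by_cases h : q = 1
  · simp [H02, kron, h, Fintype.sum_prod_type]
    ring
  · simp [H02, h]

theorem mv_H11_inl (v : EuclideanSpace ℝ (Core1 n₁ n₂)) (q : Fin 2) (i : Fin n₁) :
    (H11 R n₁ n₂ *ᵥ v.ofLp) (.inl (q, i)) = v (.inl i) := by
  refine (mv_apply _ v _).trans ?_; simp [H11, kron]

theorem mv_H11_inr (v : EuclideanSpace ℝ (Core1 n₁ n₂)) (q s : Fin 2) (i : Fin n₂) :
    (H11 R n₁ n₂ *ᵥ v.ofLp) (.inr (q, s, i)) = tay s 0 (R.yEnd q - R.c) * v (.inr (0, i))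
      + tay s 1 (R.yEnd q - R.c) * v (.inr (1, i)) := by
  refine (mv_apply _ v _).trans ?_; simp [H11, kron, Fintype.sum_prod_type]

theorem mv_H22_inl (v : EuclideanSpace ℝ (Core1 n₁ n₂)) (q : Fin 2) (i : Fin n₁) :
    (H22 R n₁ n₂ *ᵥ v.ofLp) (.inl (q, i)) = v (.inl i) := by
  refine (mv_apply _ v _).trans ?_; simp [H22, kron]

theorem mv_H22_inr (v : EuclideanSpace ℝ (Core1 n₁ n₂)) (q s : Fin 2) (i : Fin n₂) :
    (H22 R n₁ n₂ *ᵥ v.ofLp) (.inr (q, s, i)) = tay s 0 (R.xEnd q - R.a) * v (.inr (0, i))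
      + tay s 1 (R.xEnd q - R.a) * v (.inr (1, i)) := by
  refine (mv_apply _ v _).trans ?_; simp [H22, kron, Fintype.sum_prod_type]

theorem mv_H03_inl (x y : ℝ) (v : EuclideanSpace ℝ (St n₀ n₁ n₂)) (p q : Fin 2) (i : Fin n₁) :
    (H03 R n₀ n₁ n₂ x y *ᵥ v.ofLp) (.inl (p, q, i))
      = if p = 1 then (if q = 1 then v (.inr (.inl i)) else 0) else 0 := by
  refine (mv_apply _ v _).trans ?_
  by_cases h : p = 1 <;> by_cases h' : q = 1 <;> simp [H03, kron, h, h']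

theorem mv_H03_inr (x y : ℝ) (v : EuclideanSpace ℝ (St n₀ n₁ n₂)) (p q r s : Fin 2)
    (i : Fin n₂) : (H03 R n₀ n₁ n₂ x y *ᵥ v.ofLp) (.inr (p, q, r, s, i))
      = if p = 1 then (if q = 1 then (R.b - x) ^ (1 - r.val) * (R.d - y) ^ (1 - s.val)
          * v (.inr (.inr i)) else 0) else 0 := by
  refine (mv_apply _ v _).trans ?_
  by_cases h : p = 1 <;> by_cases h' : q = 1 <;> simp [H03, kron, h, h']

theorem mv_H13_inl (y : ℝ) (v : EuclideanSpace ℝ (St n₀ n₁ n₂)) (q : Fin 2) (i : Fin n₁) :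
    (H13 R n₀ n₁ n₂ y *ᵥ v.ofLp) (.inl (q, i)) = if q = 1 then v (.inr (.inl i)) else 0 := by
  refine (mv_apply _ v _).trans ?_
  by_cases h : q = 1 <;> simp [H13, kron, h]

theorem mv_H13_inr (y : ℝ) (v : EuclideanSpace ℝ (St n₀ n₁ n₂)) (q s : Fin 2) (i : Fin n₂) :
    (H13 R n₀ n₁ n₂ y *ᵥ v.ofLp) (.inr (q, s, i))
      = if q = 1 then (R.d - y) ^ (1 - s.val) * v (.inr (.inr i)) else 0 := by
  refine (mv_apply _ v _).trans ?_
  by_cases h : q = 1 <;> simp [H13, kron, h]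

theorem mv_H23_inl (x : ℝ) (v : EuclideanSpace ℝ (St n₀ n₁ n₂)) (p : Fin 2) (i : Fin n₁) :
    (H23 R n₀ n₁ n₂ x *ᵥ v.ofLp) (.inl (p, i)) = if p = 1 then v (.inr (.inl i)) else 0 := by
  refine (mv_apply _ v _).trans ?_
  by_cases h : p = 1 <;> simp [H23, kron, h]

theorem mv_H23_inr (x : ℝ) (v : EuclideanSpace ℝ (St n₀ n₁ n₂)) (p s : Fin 2) (i : Fin n₂) :
    (H23 R n₀ n₁ n₂ x *ᵥ v.ofLp) (.inr (p, s, i))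
      = if p = 1 then (R.b - x) ^ (1 - s.val) * v (.inr (.inr i)) else 0 := by
  refine (mv_apply _ v _).trans ?_
  by_cases h : p = 1 <;> simp [H23, kron, h]

theorem continuous_H01 (i : Full0 n₁ n₂) (j : Core1 n₁ n₂) :
    Continuous fun x => H01 R n₁ n₂ x i j := by
  rcases i with ⟨p, q, i⟩ | ⟨p, q, r, s, i⟩ <;> rcases j with j | ⟨l, j⟩ <;>
    simp only [H01, Matrix.of_apply] <;> (try split_ifs) <;> fun_prop

theorem continuous_H02 (i : Full0 n₁ n₂) (j : Core1 n₁ n₂) :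
    Continuous fun y => H02 R n₁ n₂ y i j := by
  rcases i with ⟨p, q, i⟩ | ⟨p, q, r, s, i⟩ <;> rcases j with j | ⟨l, j⟩ <;>
    simp only [H02, Matrix.of_apply] <;> (try split_ifs) <;> fun_prop

theorem continuous_H03 (i : Full0 n₁ n₂) (j : St n₀ n₁ n₂) :
    Continuous fun s : ℝ × ℝ => H03 R n₀ n₁ n₂ s.1 s.2 i j := by
  rcases i with ⟨p, q, i⟩ | ⟨p, q, r, s, i⟩ <;> rcases j with j | j | j <;>
    simp only [H03, Matrix.of_apply] <;> (try split_ifs) <;> fun_prop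

theorem continuous_H13 (i : Full1 n₁ n₂) (j : St n₀ n₁ n₂) :
    Continuous fun y => H13 R n₀ n₁ n₂ y i j := by
  rcases i with ⟨q, i⟩ | ⟨q, s, i⟩ <;> rcases j with j | j | j <;>
    simp only [H13, Matrix.of_apply] <;> (try split_ifs) <;> fun_prop

theorem continuous_H23 (i : Full1 n₁ n₂) (j : St n₀ n₁ n₂) :
    Continuous fun x => H23 R n₀ n₁ n₂ x i j := by
  rcases i with ⟨q, i⟩ | ⟨q, s, i⟩ <;> rcases j with j | j | j <;>
    simp only [H23, Matrix.of_apply] <;> (try split_ifs) <;> fun_prop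

/-- Reconciles two encodings of the side: the kernels test `p = 1`, the jet formulas integrate up to
`xEnd p`. At the left end both integrals vanish. The first argument of `F` lets the endpoint inside
the integrand change as well. -/
theorem integral_ite_xEnd (p : Fin 2) (F : ℝ → ℝ → ℝ) :
    (∫ θ in R.a..R.b, if p = 1 then F R.b θ else 0)
      = ∫ θ in R.a..R.xEnd p, F (R.xEnd p) θ := by
  fin_cases p <;> simp [Rectangle.xEnd]

theorem integral_ite_yEnd (q : Fin 2) (F : ℝ → ℝ → ℝ) :
    (∫ θ in R.c..R.d, if q = 1 then F R.d θ else 0)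
      = ∫ θ in R.c..R.yEnd q, F (R.yEnd q) θ :=
  integral_ite_xEnd (R := R.swap) q F

theorem integral_H01_inl (f : L2x R (Core1 n₁ n₂)) (p q : Fin 2) (i : Fin n₁) :
    (∫ x in R.a..R.b, mv (H01 R n₁ n₂ x) (f x)) (.inl (p, q, i))
      = ∫ θ in R.a..R.xEnd p, f θ (.inl i) := by
  rw [integral_mv_apply continuous_H01 (integrable_L2 f) (right_mem_x R)]
  simp only [mv_H01_inl]
  exact integral_ite_xEnd p fun _ θ => f θ (.inl i)

theorem integral_H02_inl (g : L2y R (Core1 n₁ n₂)) (p q : Fin 2) (i : Fin n₁) :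
    (∫ y in R.c..R.d, mv (H02 R n₁ n₂ y) (g y)) (.inl (p, q, i))
      = ∫ ν in R.c..R.yEnd q, g ν (.inl i) := by
  rw [integral_mv_apply_y continuous_H02 (integrable_L2 g) (right_mem_y R)]
  simp only [mv_H02_inl]
  exact integral_ite_yEnd q fun _ ν => g ν (.inl i)

theorem integral_H01_inr (f : L2x R (Core1 n₁ n₂)) (p q r s : Fin 2) (i : Fin n₂) :
    (∫ x in R.a..R.b, mv (H01 R n₁ n₂ x) (f x)) (.inr (p, q, r, s, i))
      = tay s 0 (R.yEnd q - R.c)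
          * (∫ θ in R.a..R.xEnd p, (R.xEnd p - θ) ^ (1 - r.val) * f θ (.inr (0, i)))
        + tay s 1 (R.yEnd q - R.c)
          * ∫ θ in R.a..R.xEnd p, (R.xEnd p - θ) ^ (1 - r.val) * f θ (.inr (1, i)) := by
  rw [integral_mv_apply continuous_H01 (integrable_L2 f) (right_mem_x R)]
  simp only [mv_H01_inr]
  refine (integral_ite_xEnd p fun e θ =>
    tay s 0 (R.yEnd q - R.c) * ((e - θ) ^ (1 - r.val) * f θ (.inr (0, i)))
      + tay s 1 (R.yEnd q - R.c) * ((e - θ) ^ (1 - r.val) * f θ (.inr (1, i)))).trans ?_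
  rw [intervalIntegral.integral_add
    ((intervalIntegrable_mul_apply (by fun_prop) f (xEnd_mem R p) _).const_mul _)
    ((intervalIntegrable_mul_apply (by fun_prop) f (xEnd_mem R p) _).const_mul _),
    intervalIntegral.integral_const_mul, intervalIntegral.integral_const_mul]

theorem integral_H02_inr (g : L2y R (Core1 n₁ n₂)) (p q r s : Fin 2) (i : Fin n₂) :
    (∫ y in R.c..R.d, mv (H02 R n₁ n₂ y) (g y)) (.inr (p, q, r, s, i))
      = tay r 0 (R.xEnd p - R.a)
          * (∫ ν in R.c..R.yEnd q, (R.yEnd q - ν) ^ (1 - s.val) * g ν (.inr (0, i)))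
        + tay r 1 (R.xEnd p - R.a)
          * ∫ ν in R.c..R.yEnd q, (R.yEnd q - ν) ^ (1 - s.val) * g ν (.inr (1, i)) := by
  rw [integral_mv_apply_y continuous_H02 (integrable_L2 g) (right_mem_y R)]
  simp only [mv_H02_inr]
  refine (integral_ite_yEnd q fun e θ =>
    tay r 0 (R.xEnd p - R.a) * ((e - θ) ^ (1 - s.val) * g θ (.inr (0, i)))
      + tay r 1 (R.xEnd p - R.a) * ((e - θ) ^ (1 - s.val) * g θ (.inr (1, i)))).trans ?_
  rw [intervalIntegral.integral_add
    ((intervalIntegrable_mul_apply_y (by fun_prop) g (yEnd_mem R q) _).const_mul _)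
    ((intervalIntegrable_mul_apply_y (by fun_prop) g (yEnd_mem R q) _).const_mul _),
    intervalIntegral.integral_const_mul, intervalIntegral.integral_const_mul]

theorem integral_ite_xEnd_yEnd (p q : Fin 2) (F : ℝ → ℝ → ℝ → ℝ → ℝ) :
    (∫ θ in R.a..R.b, ∫ ν in R.c..R.d,
        if p = 1 then (if q = 1 then F R.b R.d θ ν else 0) else 0)
      = ∫ θ in R.a..R.xEnd p, ∫ ν in R.c..R.yEnd q, F (R.xEnd p) (R.yEnd q) θ ν := by
  fin_cases p <;> fin_cases q <;> simp [Rectangle.xEnd, Rectangle.yEnd]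

theorem integral_H03_inl (u : L2xy R (St n₀ n₁ n₂)) (p q : Fin 2) (i : Fin n₁) :
    (∫ x in R.a..R.b, ∫ y in R.c..R.d, mv (H03 R n₀ n₁ n₂ x y) (u (x, y))) (.inl (p, q, i))
      = ∫ θ in R.a..R.xEnd p, ∫ ν in R.c..R.yEnd q, u (θ, ν) (.inr (.inl i)) := by
  rw [integral_rect_apply (F := fun s => mv (H03 R n₀ n₁ n₂ s.1 s.2) (u s))
    (integrable_mv_μxy continuous_H03 (integrable_L2 u)) (right_mem_x R) (right_mem_y R)]
  simp only [mv_H03_inl]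
  exact integral_ite_xEnd_yEnd p q fun _ _ θ ν => u (θ, ν) (.inr (.inl i))

theorem integral_H03_inr (u : L2xy R (St n₀ n₁ n₂)) (p q r s : Fin 2) (i : Fin n₂) :
    (∫ x in R.a..R.b, ∫ y in R.c..R.d, mv (H03 R n₀ n₁ n₂ x y) (u (x, y)))
        (.inr (p, q, r, s, i))
      = ∫ θ in R.a..R.xEnd p, ∫ ν in R.c..R.yEnd q,
        (R.xEnd p - θ) ^ (1 - r.val) * (R.yEnd q - ν) ^ (1 - s.val)
          * u (θ, ν) (.inr (.inr i)) := by
  rw [integral_rect_apply (F := fun s => mv (H03 R n₀ n₁ n₂ s.1 s.2) (u s))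
    (integrable_mv_μxy continuous_H03 (integrable_L2 u)) (right_mem_x R) (right_mem_y R)]
  simp only [mv_H03_inr]
  exact integral_ite_xEnd_yEnd p q fun e e' θ ν =>
    (e - θ) ^ (1 - r.val) * (e' - ν) ^ (1 - s.val) * u (θ, ν) (.inr (.inr i))

end Hop

/-! ### Integrals of the zero class and of matrix multiples -/

section Zero

variable {R : Rectangle} {ι κ : Type} [Fintype ι] [Fintype κ] [DecidableEq ι]

/-- The function chosen to represent `0` in `L₂` may be nonzero on a null set, so the integral
vanishes only after an almost everywhere argument. -/
theorem integral_smul_coe_zero (c : ℝ → ℝ) (p : Fin 2) :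
    ∫ θ in R.a..R.xEnd p, c θ • (0 : L2x R ι) θ = 0 := by
  rw [intervalIntegral_congr_μx R (g := fun _ => 0) ?_ (left_mem_x R) (xEnd_mem R p),
    intervalIntegral.integral_zero]
  filter_upwards [Lp.coeFn_zero (EuclideanSpace ℝ ι) 2 R.μx] with θ h
  rw [h, Pi.zero_apply, smul_zero]

theorem integral_smul_coe_zero_y (c : ℝ → ℝ) (q : Fin 2) :
    ∫ ν in R.c..R.yEnd q, c ν • (0 : L2y R ι) ν = 0 :=
  integral_smul_coe_zero (R := R.swap) c q

theorem integral_coe_zero (p : Fin 2) : ∫ θ in R.a..R.xEnd p, (0 : L2x R ι) θ = 0 := by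
  simpa using integral_smul_coe_zero (R := R) (ι := ι) (fun _ => 1) p

theorem integral_coe_zero_y (q : Fin 2) : ∫ ν in R.c..R.yEnd q, (0 : L2y R ι) ν = 0 :=
  integral_coe_zero (R := R.swap) q

theorem integral_rect_smul_coe_zero (c : ℝ → ℝ → ℝ) (p q : Fin 2) :
    ∫ θ in R.a..R.xEnd p, ∫ ν in R.c..R.yEnd q, c θ ν • (0 : L2xy R ι) (θ, ν) = 0 := by
  rw [intervalIntegral_congr_μx R (g := fun _ => 0) ?_ (left_mem_x R) (xEnd_mem R p),
    intervalIntegral.integral_zero]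
  filter_upwards [ae_ae_of_ae R (Lp.coeFn_zero (EuclideanSpace ℝ ι) 2 R.μxy)] with θ h
  rw [intervalIntegral_congr_μx R.swap (g := fun _ => 0) ?_ (left_mem_y R) (yEnd_mem R q),
    intervalIntegral.integral_zero]
  filter_upwards [h] with ν h'
  rw [h', Pi.zero_apply, smul_zero]

theorem integral_xEnd_smul_matOp_apply (A : Matrix κ ι ℝ) (f : L2x R ι) (p : Fin 2) (i : κ) :
    (∫ θ in R.a..R.xEnd p, (R.xEnd p - θ) • matOp R.μx A f θ) i
      = ∫ θ in R.a..R.xEnd p, (R.xEnd p - θ) * mv A (f θ) i :=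
  integral_smul_matOp_apply A (by fun_prop) f (xEnd_mem R p) i

theorem integral_yEnd_smul_matOp_apply (A : Matrix κ ι ℝ) (g : L2y R ι) (q : Fin 2) (i : κ) :
    (∫ ν in R.c..R.yEnd q, (R.yEnd q - ν) • matOp R.μy A g ν) i
      = ∫ ν in R.c..R.yEnd q, (R.yEnd q - ν) * mv A (g ν) i :=
  integral_smul_matOp_apply_y A (by fun_prop) g (yEnd_mem R q) i

theorem integral_xEnd_matOp_apply (A : Matrix κ ι ℝ) (f : L2x R ι) (p : Fin 2) (i : κ) :
    (∫ θ in R.a..R.xEnd p, matOp R.μx A f θ) i = ∫ θ in R.a..R.xEnd p, mv A (f θ) i := by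
  simpa using integral_smul_matOp_apply A (continuous_const (y := (1 : ℝ))) f (xEnd_mem R p) i

theorem integral_yEnd_matOp_apply (A : Matrix κ ι ℝ) (g : L2y R ι) (q : Fin 2) (i : κ) :
    (∫ ν in R.c..R.yEnd q, matOp R.μy A g ν) i = ∫ ν in R.c..R.yEnd q, mv A (g ν) i :=
  integral_xEnd_matOp_apply (R := R.swap) A g q i

theorem integral_xEnd_yEnd_smul_matOp_apply (A : Matrix κ ι ℝ) (u : L2xy R ι) (p q : Fin 2)
    (m n : ℕ) (i : κ) :
    (∫ θ in R.a..R.xEnd p, ∫ ν in R.c..R.yEnd q,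
        ((R.xEnd p - θ) ^ m * (R.yEnd q - ν) ^ n) • matOp R.μxy A u (θ, ν)) i
      = ∫ θ in R.a..R.xEnd p, ∫ ν in R.c..R.yEnd q,
        (R.xEnd p - θ) ^ m * (R.yEnd q - ν) ^ n * mv A (u (θ, ν)) i :=
  integral_rect_smul_matOp_apply A (by fun_prop) u (xEnd_mem R p) (yEnd_mem R q) i

end Zero

/-! ### Boundary values of `𝒦₁w`: the operator `ℋ₁` -/

section Hop

variable {R : Rectangle} {n₀ n₁ n₂ : ℕ}

theorem bdryMap_snd_fst (z : CoreState n₀ n₁ n₂ R) : (bdryMap n₀ n₁ n₂ R z).2.1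
    = ∑ q, matOp R.μx (emb1 n₁ n₂ q) (jetEdgeY q 0 (data1 n₀ n₁ n₂ R z))
      + ∑ q, ∑ s : Fin 2,
        matOp R.μx (emb2 n₁ n₂ q s) (jetEdgeY q (1 - s) (data2 n₀ n₁ n₂ R z)) := by
  simp [bdryMap]

theorem bdryMap_snd_snd (z : CoreState n₀ n₁ n₂ R) : (bdryMap n₀ n₁ n₂ R z).2.2
    = ∑ p, matOp R.μy (emb1 n₁ n₂ p) (jetEdgeX p 0 (data1 n₀ n₁ n₂ R z))
      + ∑ p, ∑ s : Fin 2,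
        matOp R.μy (emb2 n₁ n₂ p s) (jetEdgeX p (1 - s) (data2 n₀ n₁ n₂ R z)) := by
  simp [bdryMap]

theorem bdryMap_fst_inl (z : CoreState n₀ n₁ n₂ R) (p q : Fin 2) (i : Fin n₁) :
    (bdryMap n₀ n₁ n₂ R z).1 (.inl (p, q, i)) = jetCorner p q 0 0 (data1 n₀ n₁ n₂ R z) i := rfl

theorem bdryMap_fst_inr (z : CoreState n₀ n₁ n₂ R) (p q r s : Fin 2) (i : Fin n₂) :
    (bdryMap n₀ n₁ n₂ R z).1 (.inr (p, q, r, s, i))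
      = jetCorner p q (1 - r.val) (1 - s.val) (data2 n₀ n₁ n₂ R z) i := rfl

-- Without remainder the four corner expansions are compared, case by case in `(r, s)`, with `H00`,
-- `H01`, `H02`; the factors `tay` are the derivatives of the Taylor monomials at the corner.
set_option maxHeartbeats 1600000 in
theorem bdryMap_inl_fst (v : EuclideanSpace ℝ (Core0 n₁ n₂)) (f : L2x R (Core1 n₁ n₂))
    (g : L2y R (Core1 n₁ n₂)) :
    (bdryMap n₀ n₁ n₂ R ((v, f, g), 0)).1 = mv (H00 R n₁ n₂) v
      + (∫ x in R.a..R.b, mv (H01 R n₁ n₂ x) (f x))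
      + ∫ y in R.c..R.d, mv (H02 R n₁ n₂ y) (g y) := by
  set z : CoreState n₀ n₁ n₂ R := ((v, f, g), 0) with hz
  have hZ1 : jetZ (data1 n₀ n₁ n₂ R z) = 0 := map_zero (matOp R.μxy (sel1 n₀ n₁ n₂))
  have hZ2 : jetZ (data2 n₀ n₁ n₂ R z) = 0 := map_zero (matOp R.μxy (sel2 n₀ n₁ n₂))
  have hW1 : jetW 0 0 (data1 n₀ n₁ n₂ R z) = mv (selW1 n₁ n₂) v := rfl
  have hF1 : jetF 0 (data1 n₀ n₁ n₂ R z) = matOp R.μx (selF1 n₁ n₂) f := rfl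
  have hG1 : jetG 0 (data1 n₀ n₁ n₂ R z) = matOp R.μy (selF1 n₁ n₂) g := rfl
  -- Indices reverse: index `0` means one derivative remaining, hence one of two taken, so `jetW 0
  -- 0` is the value of `∂ₓ∂_y u₂`.
  have hW00 : jetW 0 0 (data2 n₀ n₁ n₂ R z) = mv (selW2 n₁ n₂ 1 1) v := rfl
  have hW01 : jetW 0 1 (data2 n₀ n₁ n₂ R z) = mv (selW2 n₁ n₂ 1 0) v := rfl
  have hW10 : jetW 1 0 (data2 n₀ n₁ n₂ R z) = mv (selW2 n₁ n₂ 0 1) v := rfl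
  have hW11 : jetW 1 1 (data2 n₀ n₁ n₂ R z) = mv (selW2 n₁ n₂ 0 0) v := rfl
  have hF20 : jetF 0 (data2 n₀ n₁ n₂ R z) = matOp R.μx (selF2 n₁ n₂ 1) f := rfl
  have hF21 : jetF 1 (data2 n₀ n₁ n₂ R z) = matOp R.μx (selF2 n₁ n₂ 0) f := rfl
  have hG20 : jetG 0 (data2 n₀ n₁ n₂ R z) = matOp R.μy (selF2 n₁ n₂ 1) g := rfl
  have hG21 : jetG 1 (data2 n₀ n₁ n₂ R z) = matOp R.μy (selF2 n₁ n₂ 0) g := rfl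
  refine PiLp.ext fun t => ?_
  rw [PiLp.add_apply, PiLp.add_apply]
  rcases t with ⟨p, q, i⟩ | ⟨p, q, r, s, i⟩
  · rw [bdryMap_fst_inl, jetCorner_zero_zero, hZ1,
      integral_rect_smul_coe_zero, integral_H01_inl, integral_H02_inl, hW1, hF1, hG1]
    simp only [PiLp.add_apply, add_zero, integral_xEnd_matOp_apply, integral_yEnd_matOp_apply,
      mv_H00_inl, mv_selW1, mv_selF1]
  · rw [bdryMap_fst_inr, integral_H01_inr, integral_H02_inr]
    rcases Fin.exists_fin_two.1 ⟨r, rfl⟩ with rfl | rfl <;>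
      rcases Fin.exists_fin_two.1 ⟨s, rfl⟩ with rfl | rfl
    · change jetCorner p q 1 1 (data2 n₀ n₁ n₂ R z) i = _
      rw [jetCorner_one_one, hZ2,
        integral_rect_smul_coe_zero, hW00, hW01, hW10, hW11, hF20, hF21, hG20, hG21]
      simp only [PiLp.add_apply, PiLp.smul_apply, add_zero, integral_xEnd_smul_matOp_apply,
        integral_yEnd_smul_matOp_apply, mv_H00_inr, mv_selW2, mv_selF2, smul_eq_mul]
      simp [tay]
      ring
    · change jetCorner p q 1 0 (data2 n₀ n₁ n₂ R z) i = _
      rw [jetCorner_one_zero, hZ2,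
        integral_rect_smul_coe_zero, hW00, hW10, hF20, hG20, hG21]
      simp only [PiLp.add_apply, PiLp.smul_apply, add_zero, integral_xEnd_smul_matOp_apply,
        integral_yEnd_matOp_apply, mv_H00_inr, mv_selW2, mv_selF2, smul_eq_mul]
      simp [tay]
      ring
    · change jetCorner p q 0 1 (data2 n₀ n₁ n₂ R z) i = _
      rw [jetCorner_zero_one, hZ2,
        integral_rect_smul_coe_zero, hW00, hW01, hF20, hF21, hG20]
      simp only [PiLp.add_apply, PiLp.smul_apply, add_zero, integral_xEnd_matOp_apply,
        integral_yEnd_smul_matOp_apply, mv_H00_inr, mv_selW2, mv_selF2, smul_eq_mul]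
      simp [tay]
      ring
    · change jetCorner p q 0 0 (data2 n₀ n₁ n₂ R z) i = _
      rw [jetCorner_zero_zero, hZ2,
        integral_rect_smul_coe_zero, hW00, hF20, hG20]
      simp only [PiLp.add_apply, add_zero, integral_xEnd_matOp_apply,
        integral_yEnd_matOp_apply, mv_H00_inr, mv_selW2, mv_selF2]
      simp [tay]

theorem bdryMap_inl_snd_fst (v : EuclideanSpace ℝ (Core0 n₁ n₂)) (f : L2x R (Core1 n₁ n₂))
    (g : L2y R (Core1 n₁ n₂)) :
    (bdryMap n₀ n₁ n₂ R ((v, f, g), 0)).2.1 =ᵐ[R.μx] fun x => mv (H11 R n₁ n₂) (f x) := by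
  set z : CoreState n₀ n₁ n₂ R := ((v, f, g), 0) with hz
  have hZ1 : jetZ (data1 n₀ n₁ n₂ R z) = 0 := map_zero (matOp R.μxy (sel1 n₀ n₁ n₂))
  have hZ2 : jetZ (data2 n₀ n₁ n₂ R z) = 0 := map_zero (matOp R.μxy (sel2 n₀ n₁ n₂))
  have hF1 : jetF 0 (data1 n₀ n₁ n₂ R z) = matOp R.μx (selF1 n₁ n₂) f := rfl
  have hF20 : jetF 0 (data2 n₀ n₁ n₂ R z) = matOp R.μx (selF2 n₁ n₂ 1) f := rfl
  have hF21 : jetF 1 (data2 n₀ n₁ n₂ R z) = matOp R.μx (selF2 n₁ n₂ 0) f := rfl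
  rw [bdryMap_snd_fst]
  have e : ∀ q : Fin 2, jetEdgeY q 1 (data2 n₀ n₁ n₂ R z) =ᵐ[R.μx] fun x =>
      mv (selF2 n₁ n₂ 0) (f x) + (R.yEnd q - R.c) • mv (selF2 n₁ n₂ 1) (f x) := by
    intro q
    rw [jetEdgeY_one, hZ2, map_zero, map_zero, add_zero, hF20, hF21]
    refine coeFn_add_of_ae (coeFn_matOp _ _ _) ((Lp.coeFn_smul _ _).trans ?_)
    filter_upwards [coeFn_matOp R.μx (selF2 n₁ n₂ 1) f] with x hx
    rw [Pi.smul_apply, hx]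
  filter_upwards [emb_sum_ae (fun q => jetEdgeY q 0 (data1 n₀ n₁ n₂ R z))
    (fun q s => jetEdgeY q (1 - s) (data2 n₀ n₁ n₂ R z)), e 0, e 1,
    coeFn_matOp R.μx (selF1 n₁ n₂) f, coeFn_matOp R.μx (selF2 n₁ n₂ 1) f]
    with x h0 h1 h2 h3 h4
  refine PiLp.ext fun t => ?_
  rcases t with ⟨q, i⟩ | ⟨q, s, i⟩
  · rw [h0.1 q i, jetEdgeY_zero, hZ1, map_zero, add_zero, hF1, h3]
    simp only [mv_selF1, mv_H11_inl]
  · rw [h0.2 q s i]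
    rcases Fin.exists_fin_two.1 ⟨s, rfl⟩ with rfl | rfl
    · have h5 : jetEdgeY q 1 (data2 n₀ n₁ n₂ R z) x = mv (selF2 n₁ n₂ 0) (f x)
          + (R.yEnd q - R.c) • mv (selF2 n₁ n₂ 1) (f x) := by
        rcases Fin.exists_fin_two.1 ⟨q, rfl⟩ with rfl | rfl
        exacts [h1, h2]
      change jetEdgeY q 1 (data2 n₀ n₁ n₂ R z) x i = _
      rw [h5]
      simp only [PiLp.add_apply, PiLp.smul_apply, mv_selF2, mv_H11_inr, smul_eq_mul]
      simp [tay]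
    · change jetEdgeY q 0 (data2 n₀ n₁ n₂ R z) x i = _
      rw [jetEdgeY_zero, hZ2, map_zero, add_zero, hF20, h4]
      simp only [mv_selF2, mv_H11_inr]
      simp [tay]

theorem bdryMap_inl_snd_snd (v : EuclideanSpace ℝ (Core0 n₁ n₂)) (f : L2x R (Core1 n₁ n₂))
    (g : L2y R (Core1 n₁ n₂)) :
    (bdryMap n₀ n₁ n₂ R ((v, f, g), 0)).2.2 =ᵐ[R.μy] fun y => mv (H22 R n₁ n₂) (g y) := by
  set z : CoreState n₀ n₁ n₂ R := ((v, f, g), 0) with hz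
  have hZ1 : jetZ (data1 n₀ n₁ n₂ R z) = 0 := map_zero (matOp R.μxy (sel1 n₀ n₁ n₂))
  have hZ2 : jetZ (data2 n₀ n₁ n₂ R z) = 0 := map_zero (matOp R.μxy (sel2 n₀ n₁ n₂))
  have hG1 : jetG 0 (data1 n₀ n₁ n₂ R z) = matOp R.μy (selF1 n₁ n₂) g := rfl
  have hG20 : jetG 0 (data2 n₀ n₁ n₂ R z) = matOp R.μy (selF2 n₁ n₂ 1) g := rfl
  have hG21 : jetG 1 (data2 n₀ n₁ n₂ R z) = matOp R.μy (selF2 n₁ n₂ 0) g := rfl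
  rw [bdryMap_snd_snd]
  have e : ∀ p : Fin 2, jetEdgeX p 1 (data2 n₀ n₁ n₂ R z) =ᵐ[R.μy] fun y =>
      mv (selF2 n₁ n₂ 0) (g y) + (R.xEnd p - R.a) • mv (selF2 n₁ n₂ 1) (g y) := by
    intro p
    rw [jetEdgeX_one, hZ2, map_zero, map_zero, add_zero, hG20, hG21]
    refine coeFn_add_of_ae (coeFn_matOp _ _ _) ((Lp.coeFn_smul _ _).trans ?_)
    filter_upwards [coeFn_matOp R.μy (selF2 n₁ n₂ 1) g] with y hy
    rw [Pi.smul_apply, hy]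
  filter_upwards [emb_sum_ae (fun p => jetEdgeX p 0 (data1 n₀ n₁ n₂ R z))
    (fun p s => jetEdgeX p (1 - s) (data2 n₀ n₁ n₂ R z)), e 0, e 1,
    coeFn_matOp R.μy (selF1 n₁ n₂) g, coeFn_matOp R.μy (selF2 n₁ n₂ 1) g]
    with y h0 h1 h2 h3 h4
  refine PiLp.ext fun t => ?_
  rcases t with ⟨p, i⟩ | ⟨p, s, i⟩
  · rw [h0.1 p i, jetEdgeX_zero, hZ1, map_zero, add_zero, hG1, h3]
    simp only [mv_selF1, mv_H22_inl]
  · rw [h0.2 p s i]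
    rcases Fin.exists_fin_two.1 ⟨s, rfl⟩ with rfl | rfl
    · have h5 : jetEdgeX p 1 (data2 n₀ n₁ n₂ R z) y = mv (selF2 n₁ n₂ 0) (g y)
          + (R.xEnd p - R.a) • mv (selF2 n₁ n₂ 1) (g y) := by
        rcases Fin.exists_fin_two.1 ⟨p, rfl⟩ with rfl | rfl
        exacts [h1, h2]
      change jetEdgeX p 1 (data2 n₀ n₁ n₂ R z) y i = _
      rw [h5]
      simp only [PiLp.add_apply, PiLp.smul_apply, mv_selF2, mv_H22_inr, smul_eq_mul]
      simp [tay]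
    · change jetEdgeX p 0 (data2 n₀ n₁ n₂ R z) y i = _
      rw [jetEdgeX_zero, hZ2, map_zero, add_zero, hG20, h4]
      simp only [mv_selF2, mv_H22_inr]
      simp [tay]

/-- Here `n₀` is arbitrary: it enters `bdryMap` only through the fundamental state, which is zero,
and not `H1`. -/
theorem H1_represents : (H1 R n₁ n₂).Represents R
    (bdryMap n₀ n₁ n₂ R ∘L ContinuousLinearMap.inl ℝ _ _) := by
  intro v f g
  simp only [H1, Par1D.apply, Pi.zero_apply, mv_zero, intervalIntegral.integral_zero, add_zero,
    zero_add]
  exact ⟨bdryMap_inl_fst v f g, bdryMap_inl_snd_fst v f g, bdryMap_inl_snd_snd v f g⟩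

end Hop

/-! ### Boundary values of `𝒦₂û`: the operator `ℋ₂` -/

section Hop

variable {R : Rectangle} {n₀ n₁ n₂ : ℕ}

/-- With vanishing corner and edge data only the remainder is left, which puts the four expansions
into the single formula that `H03` encodes. -/
theorem jetCorner_of_zero (P Q : Fin 2) (D : JetData R (Fin n₂))
    (hW : ∀ p q, jetW p q D = 0) (hF : ∀ q, jetF q D = 0) (hG : ∀ p, jetG p D = 0)
    (r s : Fin 2) :
    jetCorner P Q (1 - r.val) (1 - s.val) D
      = ∫ θ in R.a..R.xEnd P, ∫ ν in R.c..R.yEnd Q,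
        ((R.xEnd P - θ) ^ (1 - r.val) * (R.yEnd Q - ν) ^ (1 - s.val)) • jetZ D (θ, ν) := by
  rcases Fin.exists_fin_two.1 ⟨r, rfl⟩ with rfl | rfl <;>
    rcases Fin.exists_fin_two.1 ⟨s, rfl⟩ with rfl | rfl
  · refine (jetCorner_one_one P Q D).trans ?_
    simp only [hW, hF, hG, integral_smul_coe_zero, integral_smul_coe_zero_y, smul_zero, zero_add]
    rfl
  · refine (jetCorner_one_zero P Q D).trans ?_
    simp only [hW, hF, hG, integral_smul_coe_zero, integral_coe_zero_y, smul_zero, zero_add]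
    rfl
  · refine (jetCorner_zero_one P Q D).trans ?_
    simp only [hW, hF, hG, integral_coe_zero, integral_smul_coe_zero_y, smul_zero, zero_add]
    rfl
  · refine (jetCorner_zero_zero P Q D).trans ?_
    simp only [hW, hF, hG, integral_coe_zero, integral_coe_zero_y, zero_add]
    rfl

theorem bdryMap_inr_fst (u : L2xy R (St n₀ n₁ n₂)) :
    (bdryMap n₀ n₁ n₂ R (0, u)).1
      = ∫ x in R.a..R.b, ∫ y in R.c..R.d, mv (H03 R n₀ n₁ n₂ x y) (u (x, y)) := by
  set z : CoreState n₀ n₁ n₂ R := (0, u) with hz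
  have hW1 : jetW 0 0 (data1 n₀ n₁ n₂ R z) = 0 := map_zero (mvL (selW1 n₁ n₂))
  have hF1 : jetF 0 (data1 n₀ n₁ n₂ R z) = 0 := map_zero (matOp R.μx (selF1 n₁ n₂))
  have hG1 : jetG 0 (data1 n₀ n₁ n₂ R z) = 0 := map_zero (matOp R.μy (selF1 n₁ n₂))
  have hZ1 : jetZ (data1 n₀ n₁ n₂ R z) = matOp R.μxy (sel1 n₀ n₁ n₂) u := rfl
  have hZ2 : jetZ (data2 n₀ n₁ n₂ R z) = matOp R.μxy (sel2 n₀ n₁ n₂) u := rfl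
  refine PiLp.ext fun t => ?_
  rcases t with ⟨p, q, i⟩ | ⟨p, q, r, s, i⟩
  · rw [bdryMap_fst_inl, integral_H03_inl, jetCorner_zero_zero, hW1, hF1, hG1, hZ1,
      integral_coe_zero, integral_coe_zero_y, zero_add, zero_add, zero_add,
      integral_xEnd_yEnd_smul_matOp_apply]
    simp only [mv_sel1, pow_zero, one_mul]
  · rw [bdryMap_fst_inr, integral_H03_inr, jetCorner_of_zero p q _
      (fun p q => map_zero (mvL (selW2 n₁ n₂ (ord p) (ord q))))
      (fun q => map_zero (matOp R.μx (selF2 n₁ n₂ (ord q))))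
      (fun p => map_zero (matOp R.μy (selF2 n₁ n₂ (ord p)))), hZ2,
      integral_xEnd_yEnd_smul_matOp_apply]
    simp only [mv_sel2]

theorem integral_H13_inl {f : ℝ → EuclideanSpace ℝ (St n₀ n₁ n₂)} (hf : Integrable f R.μy)
    (q : Fin 2) (i : Fin n₁) :
    (∫ y in R.c..R.d, mv (H13 R n₀ n₁ n₂ y) (f y)) (.inl (q, i))
      = ∫ ν in R.c..R.yEnd q, f ν (.inr (.inl i)) := by
  rw [integral_mv_apply_y continuous_H13 hf (right_mem_y R)]
  simp only [mv_H13_inl]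
  exact integral_ite_yEnd q fun _ ν => f ν (.inr (.inl i))

theorem integral_H13_inr {f : ℝ → EuclideanSpace ℝ (St n₀ n₁ n₂)} (hf : Integrable f R.μy)
    (q s : Fin 2) (i : Fin n₂) :
    (∫ y in R.c..R.d, mv (H13 R n₀ n₁ n₂ y) (f y)) (.inr (q, s, i))
      = ∫ ν in R.c..R.yEnd q, (R.yEnd q - ν) ^ (1 - s.val) * f ν (.inr (.inr i)) := by
  rw [integral_mv_apply_y continuous_H13 hf (right_mem_y R)]
  simp only [mv_H13_inr]
  exact integral_ite_yEnd q fun e ν => (e - ν) ^ (1 - s.val) * f ν (.inr (.inr i))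

theorem integral_H23_inl {f : ℝ → EuclideanSpace ℝ (St n₀ n₁ n₂)} (hf : Integrable f R.μx)
    (p : Fin 2) (i : Fin n₁) :
    (∫ x in R.a..R.b, mv (H23 R n₀ n₁ n₂ x) (f x)) (.inl (p, i))
      = ∫ θ in R.a..R.xEnd p, f θ (.inr (.inl i)) := by
  rw [integral_mv_apply continuous_H23 hf (right_mem_x R)]
  simp only [mv_H23_inl]
  exact integral_ite_xEnd p fun _ θ => f θ (.inr (.inl i))

theorem integral_H23_inr {f : ℝ → EuclideanSpace ℝ (St n₀ n₁ n₂)} (hf : Integrable f R.μx)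
    (p s : Fin 2) (i : Fin n₂) :
    (∫ x in R.a..R.b, mv (H23 R n₀ n₁ n₂ x) (f x)) (.inr (p, s, i))
      = ∫ θ in R.a..R.xEnd p, (R.xEnd p - θ) ^ (1 - s.val) * f θ (.inr (.inr i)) := by
  rw [integral_mv_apply continuous_H23 hf (right_mem_x R)]
  simp only [mv_H23_inr]
  exact integral_ite_xEnd p fun e θ => (e - θ) ^ (1 - s.val) * f θ (.inr (.inr i))

theorem sideIntY_matOp_ae {ι κ : Type} [Fintype ι] [Fintype κ] [DecidableEq ι] (q : Fin 2)
    (A : Matrix κ ι ℝ) (u : L2xy R ι) :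
    ∀ᵐ x ∂(R.μx), ∀ i, sideIntY R q (matOp R.μxy A u) x i
      = ∫ ν in R.c..R.yEnd q, mv A (u (x, ν)) i := by
  filter_upwards [sideIntY_ae (q := q) (matOp R.μxy A u), ae_ae_of_ae R (coeFn_matOp R.μxy A u),
    ae_section_integrable' (matOp R.μxy A u)] with x h1 h2 h3 i
  rw [h1, intervalIntegral_apply (intervalIntegrable_of_μx R.swap h3 (left_mem_y R)
    (yEnd_mem R q))]
  refine intervalIntegral_congr_μx R.swap ?_ (left_mem_y R) (yEnd_mem R q)
  filter_upwards [h2] with ν h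
  rw [h]

theorem sideIntX_matOp_ae {ι κ : Type} [Fintype ι] [Fintype κ] [DecidableEq ι] (p : Fin 2)
    (A : Matrix κ ι ℝ) (u : L2xy R ι) :
    ∀ᵐ y ∂(R.μy), ∀ i, sideIntX R p (matOp R.μxy A u) y i
      = ∫ θ in R.a..R.xEnd p, mv A (u (θ, y)) i := by
  filter_upwards [sideIntX_ae (p := p) (matOp R.μxy A u), ae_ae_of_ae' R (coeFn_matOp R.μxy A u),
    ae_section_integrable R (matOp R.μxy A u)] with y h1 h2 h3 i
  rw [h1, intervalIntegral_apply (intervalIntegrable_of_μx R h3 (left_mem_x R) (xEnd_mem R p))]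
  refine intervalIntegral_congr_μx R ?_ (left_mem_x R) (xEnd_mem R p)
  filter_upwards [h2] with ν h
  rw [h]

theorem sideIntY_primY_matOp_ae {ι κ : Type} [Fintype ι] [Fintype κ] [DecidableEq ι]
    (q : Fin 2) (A : Matrix κ ι ℝ) (u : L2xy R ι) :
    ∀ᵐ x ∂(R.μx), ∀ i, sideIntY R q (primY R (matOp R.μxy A u)) x i
      = ∫ ν in R.c..R.yEnd q, (R.yEnd q - ν) * mv A (u (x, ν)) i := by
  filter_upwards [sideIntY_primY_ae q (matOp R.μxy A u), ae_ae_of_ae R (coeFn_matOp R.μxy A u),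
    ae_section_integrable' (matOp R.μxy A u)] with x h1 h2 h3 i
  rw [h1, integral_smul_apply_y (by fun_prop) h3 (yEnd_mem R q)]
  refine intervalIntegral_congr_μx R.swap ?_ (left_mem_y R) (yEnd_mem R q)
  filter_upwards [h2] with ν h
  rw [h]

theorem sideIntX_primX_matOp_ae {ι κ : Type} [Fintype ι] [Fintype κ] [DecidableEq ι]
    (p : Fin 2) (A : Matrix κ ι ℝ) (u : L2xy R ι) :
    ∀ᵐ y ∂(R.μy), ∀ i, sideIntX R p (primX R (matOp R.μxy A u)) y i
      = ∫ θ in R.a..R.xEnd p, (R.xEnd p - θ) * mv A (u (θ, y)) i := by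
  filter_upwards [sideIntX_primX_ae p (matOp R.μxy A u), ae_ae_of_ae' R (coeFn_matOp R.μxy A u),
    ae_section_integrable R (matOp R.μxy A u)] with y h1 h2 h3 i
  rw [h1, integral_smul_apply (by fun_prop) h3 (xEnd_mem R p)]
  refine intervalIntegral_congr_μx R ?_ (left_mem_x R) (xEnd_mem R p)
  filter_upwards [h2] with ν h
  rw [h]

theorem bdryMap_inr_snd_fst (u : L2xy R (St n₀ n₁ n₂)) :
    (bdryMap n₀ n₁ n₂ R (0, u)).2.1
      =ᵐ[R.μx] fun x => ∫ y in R.c..R.d, mv (H13 R n₀ n₁ n₂ y) (u (x, y)) := by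
  set z : CoreState n₀ n₁ n₂ R := (0, u) with hz
  have hF1 : jetF 0 (data1 n₀ n₁ n₂ R z) = 0 := map_zero (matOp R.μx (selF1 n₁ n₂))
  have hF2 : ∀ q, jetF q (data2 n₀ n₁ n₂ R z) = 0 :=
    fun q => map_zero (matOp R.μx (selF2 n₁ n₂ (ord q)))
  have hZ1 : jetZ (data1 n₀ n₁ n₂ R z) = matOp R.μxy (sel1 n₀ n₁ n₂) u := rfl
  have hZ2 : jetZ (data2 n₀ n₁ n₂ R z) = matOp R.μxy (sel2 n₀ n₁ n₂) u := rfl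
  rw [bdryMap_snd_fst]
  filter_upwards [emb_sum_ae (fun q => jetEdgeY q 0 (data1 n₀ n₁ n₂ R z))
    (fun q s => jetEdgeY q (1 - s) (data2 n₀ n₁ n₂ R z)),
    ae_all_iff.2 fun q => sideIntY_matOp_ae q (sel1 n₀ n₁ n₂) u,
    ae_all_iff.2 fun q => sideIntY_matOp_ae q (sel2 n₀ n₁ n₂) u,
    ae_all_iff.2 fun q => sideIntY_primY_matOp_ae q (sel2 n₀ n₁ n₂) u,
    ae_section_integrable' u] with x h0 h1 h2 h3 h4
  refine PiLp.ext fun t => ?_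
  rcases t with ⟨q, i⟩ | ⟨q, s, i⟩
  · rw [h0.1 q i, jetEdgeY_zero, hZ1, hF1, zero_add, h1, integral_H13_inl h4]
    simp only [mv_sel1]
  · rw [h0.2 q s i, integral_H13_inr h4]
    rcases Fin.exists_fin_two.1 ⟨s, rfl⟩ with rfl | rfl
    · change jetEdgeY q 1 (data2 n₀ n₁ n₂ R z) x i = _
      rw [jetEdgeY_one, hZ2, hF2, hF2, smul_zero, zero_add, zero_add, h3]
      simp [mv_sel2]
    · change jetEdgeY q 0 (data2 n₀ n₁ n₂ R z) x i = _
      rw [jetEdgeY_zero, hZ2, hF2, zero_add, h2]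
      simp [mv_sel2]

theorem bdryMap_inr_snd_snd (u : L2xy R (St n₀ n₁ n₂)) :
    (bdryMap n₀ n₁ n₂ R (0, u)).2.2
      =ᵐ[R.μy] fun y => ∫ x in R.a..R.b, mv (H23 R n₀ n₁ n₂ x) (u (x, y)) := by
  set z : CoreState n₀ n₁ n₂ R := (0, u) with hz
  have hG1 : jetG 0 (data1 n₀ n₁ n₂ R z) = 0 := map_zero (matOp R.μy (selF1 n₁ n₂))
  have hG2 : ∀ p, jetG p (data2 n₀ n₁ n₂ R z) = 0 :=
    fun p => map_zero (matOp R.μy (selF2 n₁ n₂ (ord p)))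
  have hZ1 : jetZ (data1 n₀ n₁ n₂ R z) = matOp R.μxy (sel1 n₀ n₁ n₂) u := rfl
  have hZ2 : jetZ (data2 n₀ n₁ n₂ R z) = matOp R.μxy (sel2 n₀ n₁ n₂) u := rfl
  rw [bdryMap_snd_snd]
  filter_upwards [emb_sum_ae (fun p => jetEdgeX p 0 (data1 n₀ n₁ n₂ R z))
    (fun p s => jetEdgeX p (1 - s) (data2 n₀ n₁ n₂ R z)),
    ae_all_iff.2 fun p => sideIntX_matOp_ae p (sel1 n₀ n₁ n₂) u,
    ae_all_iff.2 fun p => sideIntX_matOp_ae p (sel2 n₀ n₁ n₂) u,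
    ae_all_iff.2 fun p => sideIntX_primX_matOp_ae p (sel2 n₀ n₁ n₂) u,
    ae_section_integrable R u] with y h0 h1 h2 h3 h4
  refine PiLp.ext fun t => ?_
  rcases t with ⟨p, i⟩ | ⟨p, s, i⟩
  · rw [h0.1 p i, jetEdgeX_zero, hZ1, hG1, zero_add, h1, integral_H23_inl h4]
    simp only [mv_sel1]
  · rw [h0.2 p s i, integral_H23_inr h4]
    rcases Fin.exists_fin_two.1 ⟨s, rfl⟩ with rfl | rfl
    · change jetEdgeX p 1 (data2 n₀ n₁ n₂ R z) y i = _
      rw [jetEdgeX_one, hZ2, hG2, hG2, smul_zero, zero_add, zero_add, h3]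
      simp [mv_sel2]
    · change jetEdgeX p 0 (data2 n₀ n₁ n₂ R z) y i = _
      rw [jetEdgeX_zero, hZ2, hG2, zero_add, h2]
      simp [mv_sel2]

/-- With zero core values every boundary value is an integral of the highest derivative alone, over
the rectangle at a corner and over a line across it on an edge. -/
theorem H2_represents : (H2 R n₀ n₁ n₂).Represents R
    (bdryMap n₀ n₁ n₂ R ∘L ContinuousLinearMap.inr ℝ _ _) := by
  intro u
  refine ⟨bdryMap_inr_fst u, (bdryMap_inr_snd_fst u).trans (Filter.Eventually.of_forall fun x => ?_),
    (bdryMap_inr_snd_snd u).trans (Filter.Eventually.of_forall fun y => ?_)⟩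
  · simp only [H2, ParMix.apply2toX, Pi.zero_apply, mv_zero, intervalIntegral.integral_zero,
      add_zero]
  · simp only [H2, ParMix.apply2toY, Pi.zero_apply, mv_zero, intervalIntegral.integral_zero,
      add_zero]

end Hop

/-! ### Decay of the energy -/

section Decay

open scoped InnerProductSpace

variable {H : Type*} [NormedAddCommGroup H] [InnerProductSpace ℝ H] [CompleteSpace H]

/-- A linear operator inequality gives exponential decay of `⟪u, P u⟫` along trajectories. -/
theorem energy_decay {P T A : H →L[ℝ] H} {ε δ : ℝ} (hε : 0 < ε) (hδ : 0 < δ) (hpos : ε • ContinuousLinearMap.id ℝ H ≤ P)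
    (hLPI : ContinuousLinearMap.adjoint A ∘L P ∘L T + ContinuousLinearMap.adjoint T ∘L P ∘L A
      ≤ -(δ • (ContinuousLinearMap.adjoint T ∘L T)))
    {u v : ℝ → H} (hu : ∀ t, 0 ≤ t → u t = T (v t))
    (hu' : ∀ t, 0 ≤ t → HasDerivWithinAt u (A (v t)) (Ici 0) t) {t : ℝ} (ht : 0 ≤ t) :
    ‖u t‖ ^ 2 ≤ ‖P‖ / ε * ‖u 0‖ ^ 2 * Real.exp (-(δ / ‖P‖) * t) := by
  have hlow : ∀ x : H, ε * ‖x‖ ^ 2 ≤ ⟪x, P x⟫_ℝ := by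
    intro x
    have h := (ContinuousLinearMap.le_def _ _ |>.1 hpos).inner_nonneg_right x
    simp only [sub_apply, smul_apply,
      ContinuousLinearMap.id_apply, inner_sub_right, inner_smul_right,
      real_inner_self_eq_norm_sq] at h
    linarith
  have hup : ∀ x : H, ⟪x, P x⟫_ℝ ≤ ‖P‖ * ‖x‖ ^ 2 := by
    intro x
    calc ⟪x, P x⟫_ℝ ≤ ‖x‖ * ‖P x‖ := real_inner_le_norm _ _
      _ ≤ ‖x‖ * (‖P‖ * ‖x‖) := by gcongr; exact P.le_opNorm x
      _ = _ := by ring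
  -- The operator inequality is paired with `x`, and the adjoints are moved to the other factor.
  have hdiss : ∀ x : H, ⟪T x, P (A x)⟫_ℝ + ⟪A x, P (T x)⟫_ℝ ≤ -(δ * ‖T x‖ ^ 2) := by
    intro x
    have h := (ContinuousLinearMap.le_def _ _ |>.1 hLPI).inner_nonneg_right x
    simp only [sub_apply, neg_apply,
      add_apply, smul_apply,
      ContinuousLinearMap.comp_apply, inner_sub_right, inner_neg_right, inner_add_right,
      inner_smul_right, ContinuousLinearMap.adjoint_inner_right,
      real_inner_self_eq_norm_sq] at h
    linarith
  set k := δ / ‖P‖ with hk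
  have hkP : k * ‖P‖ ≤ δ := by
    -- If `‖P‖ = 0`, the division by zero gives `k = 0` and the bound is trivial.
    rcases eq_or_ne ‖P‖ 0 with h0 | h0
    · rw [h0, mul_zero]
      exact hδ.le
    · rw [hk, div_mul_cancel₀ _ h0]
  have hk0 : 0 ≤ k := div_nonneg hδ.le (norm_nonneg _)
  -- The factor `exp (k s)` turns the inequality `V' ≤ -kV` into monotonicity. The derivative of `u`
  -- is `A (v s)`, so no derivative of `v` occurs.
  have hV : ∀ s, 0 ≤ s → HasDerivWithinAt (fun s => ⟪u s, P (u s)⟫_ℝ * Real.exp (k * s))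
      ((⟪u s, P (A (v s))⟫_ℝ + ⟪A (v s), P (u s)⟫_ℝ) * Real.exp (k * s)
        + ⟪u s, P (u s)⟫_ℝ * (Real.exp (k * s) * k)) (Ici 0) s := by
    intro s hs
    have h1 := hu' s hs
    have h2 : HasDerivWithinAt (fun s => P (u s)) (P (A (v s))) (Ici 0) s :=
      P.hasFDerivAt.comp_hasDerivWithinAt s h1
    have h3 : HasDerivAt (fun s => Real.exp (k * s)) (Real.exp (k * s) * k) s := by
      simpa using ((hasDerivAt_id s).const_mul k).exp
    exact (h1.inner ℝ h2).mul h3.hasDerivWithinAt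
  have hanti : AntitoneOn (fun s => ⟪u s, P (u s)⟫_ℝ * Real.exp (k * s)) (Ici 0) := by
    refine antitoneOn_of_hasDerivWithinAt_nonpos (convex_Ici 0)
      (fun s hs => (hV s hs).continuousWithinAt)
      (fun s hs => (hV s (interior_subset hs)).mono interior_subset) fun s hs => ?_
    have hs0 : 0 ≤ s := interior_subset hs
    rw [hu s hs0]
    have h1 := hdiss (v s)
    have h2 := hup (T (v s))
    -- Since `V ≤ ‖P‖‖Tv‖²` and `k‖P‖ ≤ δ`, the dissipation `δ‖Tv‖²` dominates `kV`.
    have h3 : k * ⟪T (v s), P (T (v s))⟫_ℝ ≤ δ * ‖T (v s)‖ ^ 2 := by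
      calc k * ⟪T (v s), P (T (v s))⟫_ℝ ≤ k * (‖P‖ * ‖T (v s)‖ ^ 2) := by gcongr
        _ = k * ‖P‖ * ‖T (v s)‖ ^ 2 := by ring
        _ ≤ δ * ‖T (v s)‖ ^ 2 := by gcongr
    have h4 := (Real.exp_pos (k * s)).le
    calc _ = (⟪T (v s), P (A (v s))⟫_ℝ + ⟪A (v s), P (T (v s))⟫_ℝ
            + k * ⟪T (v s), P (T (v s))⟫_ℝ) * Real.exp (k * s) := by ring
      _ ≤ 0 := mul_nonpos_of_nonpos_of_nonneg (by linarith) h4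
  have h := hanti (mem_Ici.2 le_rfl) (mem_Ici.2 ht) ht
  simp only [mul_zero, Real.exp_zero, mul_one] at h
  have h1 : ε * ‖u t‖ ^ 2 * Real.exp (k * t) ≤ ‖P‖ * ‖u 0‖ ^ 2 :=
    (mul_le_mul_of_nonneg_right (hlow (u t)) (Real.exp_pos _).le).trans (h.trans (hup (u 0)))
  clear_value k
  rw [neg_mul, Real.exp_neg, ← div_eq_mul_inv, le_div_iff₀ (Real.exp_pos _),
    div_mul_eq_mul_div, le_div_iff₀ hε]
  linarith

end Decay

/-! ### The PDE in terms of the fundamental state -/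

section PDE

variable {R : Rectangle} {n₀ n₁ n₂ : ℕ}

/-- The core boundary values that the boundary conditions assign to a fundamental state. -/
def coreOf (R : Rectangle) (n₀ : ℕ) {n₁ n₂ : ℕ} (B : BCPar n₁ n₂) (v : L2xy R (St n₀ n₁ n₂)) :
    RL R (Core0 n₁ n₂) (Core1 n₁ n₂) :=
  -ContinuousLinearMap.inverse (B.op R ∘L (H1 R n₁ n₂).op R) (B.op R ((H2 R n₀ n₁ n₂).op R v))

/-- Splitting `(w, v)` as `(w, 0) + (0, v)` recovers `𝒦₁w + 𝒦₂v` from `stateMap`; the minus sign in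
`𝒯` sits in `coreOf`. -/
theorem opT_apply (B : BCPar n₁ n₂) (v : L2xy R (St n₀ n₁ n₂)) :
    opT R n₀ B v = stateMap n₀ n₁ n₂ R (coreOf R n₀ B v, v) := by
  have h : ((coreOf R n₀ B v, v) : CoreState n₀ n₁ n₂ R)
      = ContinuousLinearMap.inl ℝ _ _ (coreOf R n₀ B v) + ContinuousLinearMap.inr ℝ _ _ v := by
    simp
  rw [h, map_add, opT, K2_represents.op_eq, K1_represents.op_eq, coreOf, map_neg, map_neg]
  simp only [sub_apply, ContinuousLinearMap.comp_apply]
  rw [sub_eq_neg_add]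

/-- Write `u` through its core values `w` and fundamental state `v`. The boundary condition becomes
`ℬℋ₁w = -ℬℋ₂v`, and inverting `ℬℋ₁` shows that `w` is the value that `𝒯` assigns to `v`. -/
theorem exists_opT_eq {B : BCPar n₁ n₂} (hwp : WellPosed R B) {u : L2xy R (St n₀ n₁ n₂)}
    (hu : u ∈ stateSpace R B) : ∃ v, opT R n₀ B v = u := by
  obtain ⟨E, -, hE1, hE2⟩ := hwp
  obtain ⟨h1, h2, h3⟩ := hu
  obtain ⟨⟨w, v⟩, rfl⟩ := exists_stateMap_eq h1 h2
  refine ⟨v, ?_⟩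
  rw [opT_apply]
  have hw : coreOf R n₀ B v = w := by
    have e : ((w, v) : CoreState n₀ n₁ n₂ R)
        = ContinuousLinearMap.inl ℝ _ _ w + ContinuousLinearMap.inr ℝ _ _ v := by simp
    rw [bdry_stateMap, e, map_add, map_add] at h3
    have h4 : B.op R ((H1 R n₁ n₂).op R w) + B.op R ((H2 R n₀ n₁ n₂).op R v) = 0 := by
      rw [(H1_represents (n₀ := n₀)).op_eq, H2_represents.op_eq]
      exact h3
    have h5 := congrArg (fun L => L w) hE1
    -- The two-sided inverse supplied by well-posedness identifies `ContinuousLinearMap.inverse`,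
    -- which would otherwise be `0` by convention.
    rw [coreOf, ContinuousLinearMap.inverse_eq hE2 hE1, ← map_neg, ← eq_neg_of_add_eq_zero_left h4]
    exact h5
  rw [hw]

/-- Every `𝒯v` is a reconstructed state, so all the derivatives exist and `diffComp` agrees with
`weakDeriv` pointwise. -/
theorem opA_apply (A : Coeffs n₀ n₁ n₂) (B : BCPar n₁ n₂) (v : L2xy R (St n₀ n₁ n₂)) :
    opA R A B v = pdeRHS R A (opT R n₀ B v) := by
  have h : ∀ i j : Fin 3,
      diffComp R i j (matOp R.μxy (selN n₀ n₁ n₂ (max i.val j.val)) ∘L opT R n₀ B) v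
        = weakDeriv R i j (matOp R.μxy (selN n₀ n₁ n₂ (max i.val j.val)) (opT R n₀ B v)) :=
    fun i j => diffComp_apply (fun v' => by
      rw [ContinuousLinearMap.comp_apply, opT_apply]
      exact exists_isWeakDeriv_selN_stateMap _ i j) v
  simp only [opA, pdeRHS, sum_apply, ContinuousLinearMap.comp_apply, h]

end PDE

end PIE

end

theorem mainTheorem3 (R : PIE.Rectangle) (n₀ n₁ n₂ : ℕ) (A : PIE.Coeffs n₀ n₁ n₂)
    (B : PIE.BCPar n₁ n₂) (hB : PIE.MemN011 R B) (hwp : PIE.WellPosed R B)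
    (ε δ : ℝ) (hε : 0 < ε) (hδ : 0 < δ)
    (P : PIE.Par2D (PIE.St n₀ n₁ n₂) (PIE.St n₀ n₁ n₂)) (hP : PIE.MemN2D R P)
    (hsa : P.op R = ContinuousLinearMap.adjoint (P.op R))
    (hpos : ε • ContinuousLinearMap.id ℝ (PIE.L2xy R (PIE.St n₀ n₁ n₂)) ≤ P.op R)
    (hLPI : ContinuousLinearMap.adjoint (PIE.opA R A B) ∘L P.op R ∘L PIE.opT R n₀ B
        + ContinuousLinearMap.adjoint (PIE.opT R n₀ B) ∘L P.op R ∘L PIE.opA R A B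
      ≤ -(δ • (ContinuousLinearMap.adjoint (PIE.opT R n₀ B) ∘L PIE.opT R n₀ B)))
    (uI : PIE.L2xy R (PIE.St n₀ n₁ n₂)) (u : ℝ → PIE.L2xy R (PIE.St n₀ n₁ n₂))
    (hu : PIE.IsSolution R A B uI u) (t : ℝ) (ht : 0 ≤ t) :
    ‖u t‖ ^ 2 ≤ ‖P.op R‖ / ε * ‖u 0‖ ^ 2 * Real.exp (-(δ / ‖P.op R‖) * t) := by
  -- A fundamental state is chosen separately at each time; at negative times, where nothing is
  -- claimed, it is `0`.
  have h : ∀ s, ∃ v, 0 ≤ s → PIE.opT R n₀ B v = u s := fun s => by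
    by_cases hs : 0 ≤ s
    · obtain ⟨v, hv⟩ := PIE.exists_opT_eq hwp (hu.mem s hs)
      exact ⟨v, fun _ => hv⟩
    · exact ⟨0, fun hs' => absurd hs' hs⟩
  choose v hv using h
  refine PIE.energy_decay hε hδ hpos hLPI (fun s hs => (hv s hs).symm) (fun s hs => ?_) ht
  rw [PIE.opA_apply, hv s hs]
  exact hu.eq s hs
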